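/- Let $n\ge 2$ and let $(M,g)$ be a compact connected $n$-dimensional $C^\infty$ Riemannian manifold with non-empty $C^\infty$ boundary $\partial M$. Let $dV$ be its Riemannian volume, $d(\cdot,\partial M)$ the geodesic distance to the boundary, and $\Delta u=\frac{1}{\sqrt{\det g}}\,\partial_i\big(\sqrt{\det g}\,g^{ij}\partial_j u\big)$ the Laplace–Beltrami operator. Functions in $L^2(M)$ and in the Sobolev spaces are real-valued or complex-valued (the statement holds in either case), $H^1(M)$ and $H^2(M)$ are defined by weak derivatives, with $$\|f\|_{H^2(M)}^2=\int_M\big(|f|^2+|\nabla f|^2+|\nabla^2 f|^2\big)\,dV ,$$ and $H^1_0(M)$ is the closure in $H^1(M)$ of the smooth functions with compact support in the interior of $M$. Assume that Hardy's inequality holds on $M$: for some constant $c>0$, $$\int_M|\nabla f|^2\,dV\ \ge\ c\int_M\frac{|f(x)|^2}{d(x,\partial M)^2}\,dV(x)\qquad\text{for all } f\in H^1_0(M).$$ Let $q\in C(M)$ be real-valued with $q\le 0$, and let $u\in C^2(M)\cap H^1_0(M)$ be real-valued, not identically zero, with $\Delta u+qu\le 0$ in $M$. Then there is a constant $C_u$,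 depending only on $u$ and $M$, such that $$\|f\|_{L^2(M)}\le C_u\,\|fu\|_{L^2(M)}^{1/2}\,\|f\|_{H^2(M)}^{1/2}\qquad\text{for all } f\in H^2(M).$$ -/

import Mathlib

open Set MeasureTheory Bundle
open scoped Manifold ContDiff ENNReal NNReal

noncomputable section

namespace RiemannianSobolev

/-- The `i`-th standard basis vector of `ℝⁿ`. -/
def stdVec {n : ℕ} (i : Fin n) : EuclideanSpace ℝ (Fin n) := EuclideanSpace.single i (1 : ℝ)

/-- `D` is the weak partial derivative `∂ᵢ F` on the open set `Ω ⊆ ℝⁿ`: both functions are locally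
integrable on `Ω` and `∫ (∂ᵢ ψ) F = - ∫ ψ D` for every test function `ψ ∈ C_c^∞(Ω)`. -/
def HasWeakPartial {𝕜 : Type*} [RCLike 𝕜] {n : ℕ} (Ω : Set (EuclideanSpace ℝ (Fin n))) (i : Fin n)
    (F D : EuclideanSpace ℝ (Fin n) → 𝕜) : Prop :=
  LocallyIntegrableOn F Ω ∧ LocallyIntegrableOn D Ω ∧
    ∀ ψ : EuclideanSpace ℝ (Fin n) → ℝ, ContDiff ℝ ∞ ψ → HasCompactSupport ψ → tsupport ψ ⊆ Ω →
      ∫ y, (fderiv ℝ ψ y (stdVec i)) • F y = - ∫ y, ψ y • D y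

/-- The classical partial derivative `∂ᵢ F` of a function on the closed half-space
(one-sided at the boundary; the usual partial derivative at interior points). -/
def coordDeriv {n : ℕ} [NeZero n] (i : Fin n) (F : EuclideanSpace ℝ (Fin n) → ℝ)
    (y : EuclideanSpace ℝ (Fin n)) : ℝ :=
  fderivWithin ℝ F (range (𝓡∂ n)) y (stdVec i)

section Charts

variable {n : ℕ} [NeZero n] {M : Type*} [MetricSpace M] [ChartedSpace (EuclideanHalfSpace n) M]

/-- The inverse of the chart centred at `a`, as a map from (the half-space in) `ℝⁿ` to `M`. -/
abbrev chartInv (a : M) : EuclideanSpace ℝ (Fin n) → M := (extChartAt (𝓡∂ n) a).symm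

/-- The open subset of `ℝⁿ` that corresponds to the interior points of `M` in the domain of
the chart centred at `a`. -/
def chartDomain (a : M) : Set (EuclideanSpace ℝ (Fin n)) := interior (extChartAt (𝓡∂ n) a).target

/-- The coordinate vector `∂ᵢ` of the chart centred at `a`, at the point with coordinates `y`. -/
def coordVec (a : M) (y : EuclideanSpace ℝ (Fin n)) (i : Fin n) :
    TangentSpace (𝓡∂ n) (chartInv (n := n) a y) :=
  mfderivWithin 𝓘(ℝ, EuclideanSpace ℝ (Fin n)) (𝓡∂ n) (chartInv (n := n) a) (range (𝓡∂ n)) y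
    (stdVec i : EuclideanSpace ℝ (Fin n))

variable [RiemannianBundle (fun x : M ↦ TangentSpace (𝓡∂ n) x)]

/-- The matrix `(g_{ij})` of the metric in the chart centred at `a`. -/
def gram (a : M) (y : EuclideanSpace ℝ (Fin n)) : Matrix (Fin n) (Fin n) ℝ :=
  Matrix.of fun i j ↦ inner ℝ (coordVec a y i) (coordVec a y j)

/-- The volume density `√(det g)` in the chart centred at `a`. -/
def volDensity (a : M) (y : EuclideanSpace ℝ (Fin n)) : ℝ := √(gram a y).det

/-- The Christoffel symbols
`Γ^k_{ij} = ½ g^{kl} (∂ᵢ g_{jl} + ∂ⱼ g_{il} - ∂ₗ g_{ij})` in the chart centred at `a`. -/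
def christoffel (a : M) (y : EuclideanSpace ℝ (Fin n)) (k i j : Fin n) : ℝ :=
  2⁻¹ * ∑ l, (gram a y)⁻¹ k l *
    (coordDeriv i (fun z ↦ gram a z j l) y + coordDeriv j (fun z ↦ gram a z i l) y
      - coordDeriv l (fun z ↦ gram a z i j) y)

/-- The Laplace–Beltrami operator
`Δu = (det g)^{-1/2} ∂ᵢ ((det g)^{1/2} g^{ij} ∂ⱼ u)`, evaluated at `p` in the chart centred at `p`
(the value does not depend on the chart). -/
def laplaceBeltrami (u : M → ℝ) (p : M) : ℝ :=
  (volDensity p (extChartAt (𝓡∂ n) p p))⁻¹ *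
    ∑ i, coordDeriv i
      (fun y ↦ volDensity p y * ∑ j, (gram p y)⁻¹ i j *
        coordDeriv j (fun z ↦ u (chartInv p z)) y)
      (extChartAt (𝓡∂ n) p p)

/-- The Riemannian volume of the domain of the chart centred at `a`: the measure `√(det g) dx` on
the range of the chart, transported to `M`. -/
def chartVolume [MeasurableSpace M] (a : M) : Measure M :=
  (((volume : Measure (EuclideanSpace ℝ (Fin n))).restrict
      (extChartAt (𝓡∂ n) a).target).withDensity
    fun y ↦ ENNReal.ofReal (volDensity a y)).map (chartInv (n := n) a)

variable (n) in
/-- The Riemannian volume measure `dV`. The measures `chartVolume a` agree on the overlaps of the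
chart domains, and their supremum is the measure on `M` that coincides with `chartVolume a` on the
domain of the chart centred at `a`, for every `a`. -/
def riemannianVolume (M : Type*) [MetricSpace M] [ChartedSpace (EuclideanHalfSpace n) M]
    [RiemannianBundle (fun x : M ↦ TangentSpace (𝓡∂ n) x)] [MeasurableSpace M] : Measure M :=
  ⨆ a : M, chartVolume (n := n) a

end Charts

section Sobolev

variable {𝕜 : Type*} [RCLike 𝕜] {n : ℕ} [NeZero n]
  {M : Type*} [MetricSpace M] [ChartedSpace (EuclideanHalfSpace n) M]

/-- The field of covectors `α` is the weak differential `df` of `f`: in every chart, `α(∂ᵢ)` is the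
weak partial derivative `∂ᵢ f`. (A weak differential is unique almost everywhere.) -/
def IsWeakDifferential (f : M → 𝕜) (α : ∀ p : M, TangentSpace (𝓡∂ n) p →L[ℝ] 𝕜) : Prop :=
  ∀ (a : M) (i : Fin n), HasWeakPartial (chartDomain a) i
    (fun y ↦ f (chartInv a y)) (fun y ↦ α (chartInv a y) (coordVec a y i))

variable [RiemannianBundle (fun x : M ↦ TangentSpace (𝓡∂ n) x)]

/-- The field of bilinear forms `B` is the weak covariant derivative of the field of covectors `α`:
in every chart, `∂ᵢ (α(∂ⱼ)) = B(∂ᵢ, ∂ⱼ) + Γ^k_{ij} α(∂ₖ)` weakly. For `α = df` this says that `B` is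
the weak Hessian `∇²f`. -/
def IsWeakCovDeriv (α : ∀ p : M, TangentSpace (𝓡∂ n) p →L[ℝ] 𝕜)
    (B : ∀ p : M, TangentSpace (𝓡∂ n) p →L[ℝ] TangentSpace (𝓡∂ n) p →L[ℝ] 𝕜) : Prop :=
  ∀ (a : M) (i j : Fin n), HasWeakPartial (chartDomain a) i
    (fun y ↦ α (chartInv a y) (coordVec a y j))
    (fun y ↦ B (chartInv a y) (coordVec a y i) (coordVec a y j)
      + ∑ k, christoffel a y k i j • α (chartInv a y) (coordVec a y k))

instance finiteDimensional_tangentSpace (p : M) : FiniteDimensional ℝ (TangentSpace (𝓡∂ n) p) :=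
  inferInstanceAs (FiniteDimensional ℝ (EuclideanSpace ℝ (Fin n)))

/-- `|α|²` for a (real or complex) covector `α` at `p`, i.e. `∑ᵢ |α(eᵢ)|²` for an orthonormal basis
`(eᵢ)` of the tangent space; for `α = df` this is `|∇f|² = g^{ij} ∂ᵢf ∂ⱼf`. -/
def covectorNormSq (p : M) (α : TangentSpace (𝓡∂ n) p →L[ℝ] 𝕜) : ℝ≥0∞ :=
  ∑ i, ‖α (stdOrthonormalBasis ℝ (TangentSpace (𝓡∂ n) p) i)‖ₑ ^ 2

/-- `|B|²` for a (real or complex) bilinear form `B` at `p`, i.e. `∑ᵢⱼ |B(eᵢ, eⱼ)|²` for an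
orthonormal basis `(eᵢ)` of the tangent space. -/
def bilinNormSq (p : M)
    (B : TangentSpace (𝓡∂ n) p →L[ℝ] TangentSpace (𝓡∂ n) p →L[ℝ] 𝕜) : ℝ≥0∞ :=
  ∑ i, ∑ j, ‖B (stdOrthonormalBasis ℝ (TangentSpace (𝓡∂ n) p) i)
    (stdOrthonormalBasis ℝ (TangentSpace (𝓡∂ n) p) j)‖ₑ ^ 2

variable [MeasurableSpace M]

variable (n) in
/-- `∫ |∇f|² dV`; it is `∞` if `f` has no weak differential. (The infimum only serves to pick a
weak differential: all of them agree almost everywhere.) -/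
def energy (f : M → 𝕜) : ℝ≥0∞ :=
  ⨅ (α : ∀ p : M, TangentSpace (𝓡∂ n) p →L[ℝ] 𝕜) (_ : IsWeakDifferential f α),
    ∫⁻ p, covectorNormSq p (α p) ∂(riemannianVolume n M)

variable (n) in
/-- The norm of `L²(M)`. -/
def l2Norm (f : M → 𝕜) : ℝ≥0∞ := eLpNorm f 2 (riemannianVolume n M)

variable (n) in
/-- The norm of `H¹(M)`, `(∫ |f|² + |∇f|² dV)^{1/2}`; it is `∞` if `f` has no weak differential. -/
def h1Norm (f : M → 𝕜) : ℝ≥0∞ := (l2Norm n f ^ 2 + energy n f) ^ (1 / 2 : ℝ)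

variable (n) in
/-- The norm of `H²(M)`, `(∫ |f|² + |∇f|² + |∇²f|² dV)^{1/2}`; it is `∞` if `f` has no weak
differential or no weak Hessian. (Again all choices of these agree almost everywhere.) -/
def h2Norm (f : M → 𝕜) : ℝ≥0∞ :=
  (l2Norm n f ^ 2 +
    ⨅ (α : ∀ p : M, TangentSpace (𝓡∂ n) p →L[ℝ] 𝕜) (_ : IsWeakDifferential f α)
      (B : ∀ p : M, TangentSpace (𝓡∂ n) p →L[ℝ] TangentSpace (𝓡∂ n) p →L[ℝ] 𝕜)
      (_ : IsWeakCovDeriv α B),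
      ∫⁻ p, (covectorNormSq p (α p) + bilinNormSq p (B p)) ∂(riemannianVolume n M)) ^ (1 / 2 : ℝ)

variable (n) in
/-- `f ∈ H¹(M)`. -/
def MemH1 (f : M → 𝕜) : Prop :=
  AEStronglyMeasurable f (riemannianVolume n M) ∧ h1Norm n f < ⊤

variable (n) in
/-- `f ∈ H²(M)`. -/
def MemH2 (f : M → 𝕜) : Prop :=
  AEStronglyMeasurable f (riemannianVolume n M) ∧ h2Norm n f < ⊤

variable (n) in
/-- `f ∈ H¹₀(M)`: `f` lies in the closure in `H¹(M)` of the smooth functions with compact support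
in the interior of `M`. (`M` is compact in all uses, so that closed supports are compact.) -/
def MemH10 (f : M → 𝕜) : Prop :=
  MemH1 n f ∧ ∀ ε : ℝ≥0∞, 0 < ε → ∃ φ : M → 𝕜, ContMDiff (𝓡∂ n) 𝓘(ℝ, 𝕜) ∞ φ ∧
    HasCompactSupport φ ∧ tsupport φ ⊆ (𝓡∂ n).interior M ∧ h1Norm n (fun p ↦ f p - φ p) < ε

variable (n) in
/-- Hardy's inequality on `M` for `𝕜`-valued functions: there is `c > 0` such that
`∫ |∇f|² dV ≥ c ∫ |f|² / d(x, ∂M)² dV` for all `f ∈ H¹₀(M)`. -/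
def HardyInequality (𝕜 : Type*) [RCLike 𝕜] (M : Type*) [MetricSpace M]
    [ChartedSpace (EuclideanHalfSpace n) M]
    [RiemannianBundle (fun x : M ↦ TangentSpace (𝓡∂ n) x)] [MeasurableSpace M] : Prop :=
  ∃ c : ℝ≥0, 0 < c ∧ ∀ f : M → 𝕜, MemH10 n f →
    c * ∫⁻ p, ‖f p‖ₑ ^ 2 / Metric.infEDist p ((𝓡∂ n).boundary M) ^ 2 ∂(riemannianVolume n M)
      ≤ energy n f

end Sobolev

end RiemannianSobolev

end

/-! The weight `u` may vanish only at the boundary, and there it decays no faster than the distance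
to the boundary. Interpolation against such a weight reduces to one integration by parts in the
normal direction.

Behaviour of `u`. Elements of `H¹₀` that are continuous vanish on the boundary
(`eq_zero_on_boundary_of_memH10`). Since `q ≤ 0`, the strong maximum principle applies to the
supersolution `u`: a negative minimum would force `u` to be a negative constant
(`nonneg_of_supersolution`), and an interior zero would force `u = 0` (`pos_of_supersolution`). A
quantitative Hopf lemma, `exists_hopf_constant`, whose constant is the same for all balls of a given
radius, then gives `u ≥ c x₀` in a boundary chart, where `x₀` is the normal coordinate
(`exists_boundary_lower_bound`).

The estimate. Because `∂₀ x₀ = 1`, integrating `χ |f|² ∂₀ x₀` by parts leaves no boundary term and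
gives `∫ χ |f|² ≤ C ∫ x₀ |f| (|f| + |∂₀ f|)` (`exists_lintegral_normSq_le`). Replacing `x₀` by `u /
c` and using the Cauchy-Schwarz inequality bounds `(∫ |f|²)²` near the boundary by a multiple of `∫
|u f|²` times the squared `H¹` norm (`hasLocalEstimate_of_boundary`). Near an interior point `u` is
bounded below and the same bound is immediate. Compactness of `M` sums the local bounds, the `H²`
norm dominates the `H¹` norm, and a fourth root finishes the proof.

Transfer between `M` and charts. The Laplacian is defined at each point in that point's own chart,
so the maximum principle in a fixed chart needs invariance under coordinate changes. This is proved
weakly (`divOp_comp`), through the invariance of the Dirichlet form and of the volume. Integrals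
over `M` and over a chart are compared by `lintegral_chartInv_le` and
`setLIntegral_riemannianVolume_le`. -/

open Set MeasureTheory Bundle
open scoped Manifold ContDiff ENNReal NNReal

noncomputable section

namespace RiemannianSobolev

/-! ### Second order elliptic operators on `ℝⁿ`: Hopf lemma and strong maximum principle. -/

section MaximumPrinciple

open Metric

variable {n : ℕ}

/-- The `i`-th partial derivative of a real function on `ℝⁿ`. -/
def partialDeriv (i : Fin n) (F : EuclideanSpace ℝ (Fin n) → ℝ) (y : EuclideanSpace ℝ (Fin n)) :
    ℝ :=
  fderiv ℝ F y (stdVec i)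

/-- The second order operator `∑ Aᵢⱼ ∂ᵢ∂ⱼ + ∑ Bⱼ ∂ⱼ`. -/
def nondivOp (A : EuclideanSpace ℝ (Fin n) → Matrix (Fin n) (Fin n) ℝ)
    (B : EuclideanSpace ℝ (Fin n) → Fin n → ℝ) (v : EuclideanSpace ℝ (Fin n) → ℝ)
    (x : EuclideanSpace ℝ (Fin n)) : ℝ :=
  ∑ i, ∑ j, A x i j * partialDeriv i (partialDeriv j v) x + ∑ j, B x j * partialDeriv j v x

lemma partialDeriv_congr {i : Fin n} {F G : EuclideanSpace ℝ (Fin n) → ℝ}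
    {x : EuclideanSpace ℝ (Fin n)} (h : F =ᶠ[nhds x] G) :
    partialDeriv i F x = partialDeriv i G x := by
  simp only [partialDeriv, h.fderiv_eq]

lemma partialDeriv_partialDeriv {v : EuclideanSpace ℝ (Fin n) → ℝ}
    {x : EuclideanSpace ℝ (Fin n)} (hv : ContDiffAt ℝ 2 v x) (i j : Fin n) :
    partialDeriv i (partialDeriv j v) x = fderiv ℝ (fderiv ℝ v) x (stdVec i) (stdVec j) := by
  have hd : DifferentiableAt ℝ (fderiv ℝ v) x :=
    (hv.fderiv_right (m := 1) (by norm_num)).differentiableAt (by norm_num)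
  unfold partialDeriv
  rw [fderiv_clm_apply hd (differentiableAt_const _)]
  simp

lemma differentiableAt_partialDeriv {v : EuclideanSpace ℝ (Fin n) → ℝ}
    {x : EuclideanSpace ℝ (Fin n)} (hv : ContDiffAt ℝ 2 v x) (j : Fin n) :
    DifferentiableAt ℝ (partialDeriv j v) x := by
  have hd : DifferentiableAt ℝ (fderiv ℝ v) x :=
    (hv.fderiv_right (m := 1) (by norm_num)).differentiableAt (by norm_num)
  exact hd.clm_apply (differentiableAt_const _)

/-- If the second derivative were negative, the second derivative test would make `t` a local
maximum as well. Then `g` is locally constant and its second derivative is zero, a contradiction. -/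
lemma deriv_deriv_nonneg_of_isLocalMin {g : ℝ → ℝ} {t : ℝ} (hg : ContinuousAt g t)
    (h : IsLocalMin g t) : 0 ≤ deriv (deriv g) t := by
  by_contra! hneg
  have hmax : IsLocalMax g t := isLocalMax_of_deriv_deriv_neg hneg h.deriv_eq_zero hg
  have hc : g =ᶠ[nhds t] fun _ ↦ g t := by
    filter_upwards [h, hmax] with s h1 h2 using le_antisymm h2 h1
  have : deriv (deriv g) t = 0 := by
    rw [hc.deriv.deriv_eq]; simp
  linarith

lemma hessian_nonneg_of_isLocalMin {v : EuclideanSpace ℝ (Fin n) → ℝ}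
    {x : EuclideanSpace ℝ (Fin n)} (hv : ContDiffAt ℝ 2 v x) (h : IsLocalMin v x)
    (ξ : EuclideanSpace ℝ (Fin n)) : 0 ≤ fderiv ℝ (fderiv ℝ v) x ξ ξ := by
  have hd : DifferentiableAt ℝ (fderiv ℝ v) x :=
    (hv.fderiv_right (m := 1) (by norm_num)).differentiableAt (by norm_num)
  let l : ℝ → EuclideanSpace ℝ (Fin n) := fun t ↦ x + t • ξ
  have hl (t : ℝ) : HasDerivAt l ξ t := by
    have := ((hasDerivAt_id t).smul_const ξ).const_add x
    rwa [one_smul] at this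
  have hl0 : l 0 = x := by simp [l]
  have hlc : ContinuousAt l 0 := (hl 0).continuousAt
  have hlt : Filter.Tendsto l (nhds 0) (nhds x) := by
    have := hlc.tendsto; rwa [hl0] at this
  have hcd : ∀ᶠ y in nhds x, DifferentiableAt ℝ v y :=
    (hv.eventually (by norm_num)).mono fun y hy ↦ hy.differentiableAt (by norm_num)
  have hder : deriv (v ∘ l) =ᶠ[nhds 0] fun t ↦ fderiv ℝ v (l t) ξ := by
    filter_upwards [hlt.eventually hcd] with t ht
    exact (ht.hasFDerivAt.comp_hasDerivAt t (hl t)).deriv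
  have h2 : deriv (deriv (v ∘ l)) 0 = fderiv ℝ (fderiv ℝ v) x ξ ξ := by
    rw [hder.deriv_eq]
    have : HasDerivAt (fun t ↦ fderiv ℝ v (l t)) (fderiv ℝ (fderiv ℝ v) x ξ) 0 := by
      have := hd.hasFDerivAt
      rw [← hl0] at this
      have := this.comp_hasDerivAt 0 (hl 0)
      rwa [hl0] at this
    have := this.clm_apply (hasDerivAt_const (0 : ℝ) ξ)
    simpa using this.deriv
  rw [← h2]
  apply deriv_deriv_nonneg_of_isLocalMin
  · refine ContinuousAt.comp ?_ hlc
    rw [hl0]; exact hv.continuousAt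
  · have : IsLocalMin v (l 0) := by rwa [hl0]
    exact this.comp_continuous hlc

/-- The gradient vanishes at a minimum, so only second derivatives remain. Writing `A` as a sum of
rank one matrices `C_k C_kᵀ` turns them into the sum of the Hessian values on the vectors `C_k`,
each nonnegative. -/
lemma nondivOp_nonneg_of_isLocalMin {A : EuclideanSpace ℝ (Fin n) → Matrix (Fin n) (Fin n) ℝ}
    {B : EuclideanSpace ℝ (Fin n) → Fin n → ℝ} {v : EuclideanSpace ℝ (Fin n) → ℝ}
    {x : EuclideanSpace ℝ (Fin n)} (hA : (A x).PosSemidef) (hv : ContDiffAt ℝ 2 v x)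
    (h : IsLocalMin v x) : 0 ≤ nondivOp A B v x := by
  have h0 (j : Fin n) : partialDeriv j v x = 0 := by simp [partialDeriv, h.fderiv_eq_zero]
  obtain ⟨m, C, hC⟩ := Matrix.posSemidef_iff_eq_sum_vecMulVec.1 hA
  have hAij (i j : Fin n) : A x i j = ∑ k, C k i * C k j := by
    rw [hC]; simp [Matrix.sum_apply, Matrix.vecMulVec_apply]
  have key : nondivOp A B v x = ∑ k, fderiv ℝ (fderiv ℝ v) x (∑ i, C k i • stdVec i)
      (∑ j, C k j • stdVec j) := by
    unfold nondivOp
    simp only [h0, mul_zero, Finset.sum_const_zero, add_zero, partialDeriv_partialDeriv hv, hAij,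
      map_sum, map_smul, _root_.sum_apply, _root_.smul_apply,
      smul_eq_mul, Finset.sum_mul, Finset.mul_sum]
    rw [Finset.sum_congr rfl fun i _ ↦ Finset.sum_comm]
    rw [Finset.sum_comm]
    refine Finset.sum_congr rfl fun k _ ↦ ?_
    rw [Finset.sum_comm]
    refine Finset.sum_congr rfl fun i _ ↦ Finset.sum_congr rfl fun j _ ↦ ?_
    ring
  rw [key]
  exact Finset.sum_nonneg fun k _ ↦ hessian_nonneg_of_isLocalMin hv h _

lemma nondivOp_sub_const_mul {A : EuclideanSpace ℝ (Fin n) → Matrix (Fin n) (Fin n) ℝ}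
    {B : EuclideanSpace ℝ (Fin n) → Fin n → ℝ} {v w : EuclideanSpace ℝ (Fin n) → ℝ}
    {x : EuclideanSpace ℝ (Fin n)} (m : ℝ) (hv : ContDiffAt ℝ 2 v x) (hw : ContDiffAt ℝ 2 w x) :
    nondivOp A B (fun y ↦ v y - m * w y) x = nondivOp A B v x - m * nondivOp A B w x := by
  have h1 (j : Fin n) : partialDeriv j (fun y ↦ v y - m * w y) =ᶠ[nhds x]
      fun y ↦ partialDeriv j v y - m * partialDeriv j w y := by
    filter_upwards [hv.eventually (by norm_num), hw.eventually (by norm_num)] with y h1 h2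
    have h1' := h1.differentiableAt (by norm_num)
    have h2' := h2.differentiableAt (by norm_num)
    simp only [partialDeriv]
    rw [fderiv_fun_sub h1' (h2'.const_mul m), fderiv_const_mul h2']
    simp
  have h2 (i j : Fin n) : partialDeriv i (partialDeriv j (fun y ↦ v y - m * w y)) x =
      partialDeriv i (partialDeriv j v) x - m * partialDeriv i (partialDeriv j w) x := by
    rw [partialDeriv_congr (h1 j)]
    have h1' := differentiableAt_partialDeriv hv j
    have h2' := differentiableAt_partialDeriv hw j
    conv_lhs => unfold partialDeriv
    rw [show (fun y ↦ (fderiv ℝ v y) (stdVec j) - m * (fderiv ℝ w y) (stdVec j)) =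
      fun y ↦ partialDeriv j v y - m * partialDeriv j w y from rfl]
    rw [fderiv_fun_sub h1' (h2'.const_mul m), fderiv_const_mul h2']
    simp [partialDeriv]
  unfold nondivOp
  simp only [h2, (h1 _).eq_of_nhds, mul_sub, Finset.sum_sub_distrib, mul_add, Finset.mul_sum]
  simp only [mul_left_comm]
  ring

/-- Bounds for the coefficients of the operator `∑ Aᵢⱼ ∂ᵢ∂ⱼ + ∑ Bⱼ ∂ⱼ - k` on the set `U`. -/
structure EllipticBounds (A : EuclideanSpace ℝ (Fin n) → Matrix (Fin n) (Fin n) ℝ)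
    (B : EuclideanSpace ℝ (Fin n) → Fin n → ℝ) (k : EuclideanSpace ℝ (Fin n) → ℝ)
    (U : Set (EuclideanSpace ℝ (Fin n))) (lam Lam bet kap : ℝ) : Prop where
  posSemidef : ∀ x ∈ U, (A x).PosSemidef
  elliptic : ∀ x ∈ U, ∀ ξ : EuclideanSpace ℝ (Fin n),
    lam * ‖ξ‖ ^ 2 ≤ ∑ i, ∑ j, A x i j * (ξ i * ξ j)
  trace_le : ∀ x ∈ U, (A x).trace ≤ Lam
  drift_le : ∀ x ∈ U, ∀ ξ : EuclideanSpace ℝ (Fin n), ∑ j, B x j * ξ j ≤ bet * ‖ξ‖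
  potential_nonneg : ∀ x ∈ U, 0 ≤ k x
  potential_le : ∀ x ∈ U, k x ≤ kap

lemma EllipticBounds.mono {A : EuclideanSpace ℝ (Fin n) → Matrix (Fin n) (Fin n) ℝ}
    {B : EuclideanSpace ℝ (Fin n) → Fin n → ℝ} {k : EuclideanSpace ℝ (Fin n) → ℝ}
    {U V : Set (EuclideanSpace ℝ (Fin n))} {lam Lam bet kap : ℝ}
    (h : EllipticBounds A B k U lam Lam bet kap) (hV : V ⊆ U) :
    EllipticBounds A B k V lam Lam bet kap :=
  ⟨fun x hx ↦ h.1 x (hV hx), fun x hx ↦ h.2 x (hV hx), fun x hx ↦ h.3 x (hV hx),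
    fun x hx ↦ h.4 x (hV hx), fun x hx ↦ h.5 x (hV hx), fun x hx ↦ h.6 x (hV hx)⟩

/-- The barrier `exp(-α|x-y|²) - exp(-αr²)` of the Hopf lemma. -/
def hopfBarrier (α r : ℝ) (y x : EuclideanSpace ℝ (Fin n)) : ℝ :=
  Real.exp (-α * ‖x - y‖ ^ 2) - Real.exp (-α * r ^ 2)

lemma contDiff_hopfBarrier (α r : ℝ) (y : EuclideanSpace ℝ (Fin n)) {m : ℕ∞} :
    ContDiff ℝ m (hopfBarrier α r y) := by
  unfold hopfBarrier
  have : ContDiff ℝ m fun x : EuclideanSpace ℝ (Fin n) ↦ ‖x - y‖ ^ 2 :=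
    (contDiff_id.sub contDiff_const).norm_sq ℝ
  exact ((contDiff_const.mul this).exp).sub contDiff_const

lemma hasFDerivAt_exp_normSq (α : ℝ) (y x : EuclideanSpace ℝ (Fin n)) :
    HasFDerivAt (fun x ↦ Real.exp (-α * ‖x - y‖ ^ 2))
      ((-2 * α * Real.exp (-α * ‖x - y‖ ^ 2)) • innerSL ℝ (x - y)) x := by
  have h1 : HasFDerivAt (fun x : EuclideanSpace ℝ (Fin n) ↦ ‖x - y‖ ^ 2)
      (2 • innerSL ℝ (x - y)) x := by
    have := (((hasFDerivAt_id x).sub_const y)).norm_sq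
    simpa using this
  have h2 := (h1.const_mul (-α)).exp
  have h3 : Real.exp (-α * ‖x - y‖ ^ 2) • -α • (2 • innerSL ℝ (x - y)) =
      (-2 * α * Real.exp (-α * ‖x - y‖ ^ 2)) • innerSL ℝ (x - y) := by
    module
  rwa [h3] at h2

lemma inner_stdVec (x : EuclideanSpace ℝ (Fin n)) (i : Fin n) :
    inner ℝ x (stdVec i) = x i := by
  simp [stdVec, EuclideanSpace.inner_single_right]

lemma partialDeriv_hopfBarrier (α r : ℝ) (y x : EuclideanSpace ℝ (Fin n)) (j : Fin n) :
    partialDeriv j (hopfBarrier α r y) x =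
      -2 * α * (Real.exp (-α * ‖x - y‖ ^ 2) * (x - y) j) := by
  have h : HasFDerivAt (hopfBarrier α r y)
      ((-2 * α * Real.exp (-α * ‖x - y‖ ^ 2)) • innerSL ℝ (x - y)) x :=
    (hasFDerivAt_exp_normSq α y x).sub_const (Real.exp (-α * r ^ 2))
  rw [partialDeriv, h.fderiv]
  simp only [_root_.smul_apply, innerSL_apply_apply, inner_stdVec, smul_eq_mul]
  ring

lemma partialDeriv_partialDeriv_hopfBarrier (α r : ℝ) (y x : EuclideanSpace ℝ (Fin n))
    (i j : Fin n) :
    partialDeriv i (partialDeriv j (hopfBarrier α r y)) x =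
      Real.exp (-α * ‖x - y‖ ^ 2) *
        (4 * α ^ 2 * ((x - y) i * (x - y) j) - 2 * α * (if i = j then 1 else 0)) := by
  have h0 : partialDeriv j (hopfBarrier α r y) = fun x ↦
      -2 * α * (Real.exp (-α * ‖x - y‖ ^ 2) * (x - y) j) :=
    funext fun x ↦ partialDeriv_hopfBarrier α r y x j
  have h1 : HasFDerivAt (fun x : EuclideanSpace ℝ (Fin n) ↦ (x - y) j)
      (EuclideanSpace.proj j : EuclideanSpace ℝ (Fin n) →L[ℝ] ℝ) x := by
    have := (EuclideanSpace.proj j : EuclideanSpace ℝ (Fin n) →L[ℝ] ℝ).hasFDerivAt (x := x)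
    simpa using this.sub_const (y j)
  rw [h0]
  unfold partialDeriv
  have h2 := ((hasFDerivAt_exp_normSq α y x).mul h1).const_mul (-2 * α)
  simp only [Pi.mul_apply] at h2
  rw [h2.fderiv]
  simp only [_root_.smul_apply, _root_.add_apply, innerSL_apply_apply,
    inner_stdVec, smul_eq_mul]
  have : (EuclideanSpace.proj j : EuclideanSpace ℝ (Fin n) →L[ℝ] ℝ) (stdVec i) =
      if i = j then 1 else 0 := by
    simp [stdVec, eq_comm]
  rw [this]
  ring

lemma nondivOp_hopfBarrier (A : EuclideanSpace ℝ (Fin n) → Matrix (Fin n) (Fin n) ℝ)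
    (B : EuclideanSpace ℝ (Fin n) → Fin n → ℝ) (α r : ℝ) (y x : EuclideanSpace ℝ (Fin n)) :
    nondivOp A B (hopfBarrier α r y) x = Real.exp (-α * ‖x - y‖ ^ 2) *
      (4 * α ^ 2 * ∑ i, ∑ j, A x i j * ((x - y) i * (x - y) j) - 2 * α * (A x).trace
        - 2 * α * ∑ j, B x j * (x - y) j) := by
  unfold nondivOp
  simp only [partialDeriv_hopfBarrier, partialDeriv_partialDeriv_hopfBarrier]
  have h1 : ∑ i, ∑ j, A x i j * (Real.exp (-α * ‖x - y‖ ^ 2) *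
        (4 * α ^ 2 * ((x - y) i * (x - y) j) - 2 * α * (if i = j then 1 else 0))) =
      Real.exp (-α * ‖x - y‖ ^ 2) * (4 * α ^ 2 * ∑ i, ∑ j, A x i j * ((x - y) i * (x - y) j)
        - 2 * α * (A x).trace) := by
    have : (A x).trace = ∑ i, ∑ j, A x i j * (if i = j then 1 else 0) := by
      simp [Matrix.trace]
    rw [this]
    simp only [Finset.mul_sum, ← Finset.sum_sub_distrib]
    refine Finset.sum_congr rfl fun i _ ↦ Finset.sum_congr rfl fun j _ ↦ ?_
    ring
  rw [h1]
  have h2 : ∑ j, B x j * (-2 * α * (Real.exp (-α * ‖x - y‖ ^ 2) * (x - y) j)) =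
      Real.exp (-α * ‖x - y‖ ^ 2) * (-2 * α * ∑ j, B x j * (x - y) j) := by
    simp only [Finset.mul_sum]
    exact Finset.sum_congr rfl fun j _ ↦ by ring
  rw [h2]
  ring

/-- The quadratic term in `α` dominates. The factor `α² lam r²` is `4 α² lam (r / 2)²`, the
ellipticity bound for the barrier at distance at least `r / 2` from the centre. -/
lemma exists_hopf_exponent {lam Lam bet kap r : ℝ} (hlam : 0 < lam) (hr : 0 < r) :
    ∃ α > 0, 0 < α ^ 2 * lam * r ^ 2 - 2 * α * (Lam + bet * r) - kap := by
  have h : Filter.Tendsto (fun α : ℝ ↦ α * (α * (lam * r ^ 2) + - (2 * (Lam + bet * r))))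
      Filter.atTop Filter.atTop := by
    apply Filter.Tendsto.atTop_mul_atTop₀ Filter.tendsto_id
    apply Filter.tendsto_atTop_add_const_right
    exact Filter.tendsto_id.atTop_mul_const (by positivity)
  obtain ⟨α, h1, h2⟩ := ((h.eventually_gt_atTop kap).and (Filter.eventually_gt_atTop 0)).exists
  exact ⟨α, h2, by nlinarith⟩

/-- Quantitative Hopf lemma: the constant depends only on the bounds of the coefficients and on the
radius of the ball. -/
lemma exists_hopf_constant {lam Lam bet kap r : ℝ} (hlam : 0 < lam) (hbet : 0 ≤ bet) (hr : 0 < r) :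
    ∃ c > 0, ∀ (A : EuclideanSpace ℝ (Fin n) → Matrix (Fin n) (Fin n) ℝ)
      (B : EuclideanSpace ℝ (Fin n) → Fin n → ℝ) (k v : EuclideanSpace ℝ (Fin n) → ℝ)
      (y : EuclideanSpace ℝ (Fin n)) (m : ℝ), 0 < m →
      EllipticBounds A B k (ball y r) lam Lam bet kap →
      ContinuousOn v (closedBall y r) → (∀ x ∈ ball y r, ContDiffAt ℝ 2 v x) →
      (∀ x ∈ ball y r, nondivOp A B v x - k x * v x ≤ 0) →
      (∀ x ∈ closedBall y r, 0 ≤ v x) → (∀ x ∈ closedBall y (r / 2), m ≤ v x) →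
      ∀ x ∈ closedBall y r, c * m * (r - ‖x - y‖) ≤ v x := by
  obtain ⟨α, hα, hpos⟩ := exists_hopf_exponent (Lam := Lam) (bet := bet) (kap := kap) hlam hr
  set c₀ := α * Real.exp (-α * r ^ 2) * r with hc₀
  have hc₀pos : 0 < c₀ := by positivity
  -- The value `c₀` serves the annulus, where the barrier is bounded below by `c₀ (r - |x - y|)`.
  -- The value `r⁻¹` serves the inner ball, where `v ≥ m` already suffices.
  refine ⟨min c₀ r⁻¹, by positivity, ?_⟩
  intro A B k v y m hm hE hvc hvd hL hv0 hvm
  -- Comparison on the closed annulus. A negative minimum of `v - m * hopfBarrier` cannot lie on the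
  -- outer sphere, where the barrier is `0`, nor on the inner one, where the barrier is at most `1`
  -- and `v ≥ m`. In the open annulus it contradicts the strict inequality `h3` for the barrier.
  have hann : ∀ x ∈ closedBall y r, r / 2 ≤ ‖x - y‖ → m * hopfBarrier α r y x ≤ v x := by
    set K := closedBall y r ∩ {x | r / 2 ≤ ‖x - y‖} with hK
    have hKc : IsCompact K := (isCompact_closedBall y r).inter_right
      (isClosed_le continuous_const (by fun_prop))
    intro x hx hx2
    set z := fun x ↦ v x - m * hopfBarrier α r y x with hz
    have hzc : ContinuousOn z K := by
      apply (hvc.mono inter_subset_left).sub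
      exact (((contDiff_hopfBarrier (m := 0) α r y).continuous).const_mul m).continuousOn
    obtain ⟨p, hpK, hpmin⟩ := hKc.exists_isMinOn ⟨x, hx, hx2⟩ hzc
    suffices 0 ≤ z p by
      have h2 : z p ≤ z x := hpmin ⟨hx, hx2⟩
      simp only [hz] at this h2; linarith
    by_contra! hneg
    have hpn : ‖p - y‖ ≤ r := by simpa [dist_eq_norm] using hpK.1
    have hpl : r / 2 ≤ ‖p - y‖ := hpK.2
    have hplt : ‖p - y‖ < r := by
      rcases hpn.lt_or_eq with h | h
      · exact h
      · exfalso
        have h1 := hv0 p hpK.1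
        simp only [hz, hopfBarrier, h, sub_self, mul_zero, sub_zero] at hneg
        linarith
    have hpgt : r / 2 < ‖p - y‖ := by
      rcases hpl.lt_or_eq with h | h
      · exact h
      · exfalso
        have h1 := hvm p (by simp [dist_eq_norm, ← h])
        have h2 : hopfBarrier α r y p ≤ 1 := by
          unfold hopfBarrier
          have h3 : Real.exp (-α * ‖p - y‖ ^ 2) ≤ 1 := by
            apply Real.exp_le_one_iff.2
            have : 0 ≤ α * ‖p - y‖ ^ 2 := by positivity
            linarith
          have h4 := Real.exp_pos (-α * r ^ 2)
          linarith
        have h3 : m * hopfBarrier α r y p ≤ m * 1 := by gcongr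
        simp only [hz] at hneg
        linarith
    have hpb : p ∈ ball y r := by simpa [dist_eq_norm] using hplt
    have hloc : IsLocalMin z p := by
      apply hpmin.isLocalMin
      have : ball y r ∩ {x | r / 2 < ‖x - y‖} ∈ nhds p :=
        (isOpen_ball.inter (isOpen_lt continuous_const (by fun_prop))).mem_nhds ⟨hpb, hpgt⟩
      exact Filter.mem_of_superset this
        (inter_subset_inter ball_subset_closedBall fun x hx ↦ le_of_lt (mem_ofPred_eq ▸ hx))
    have hbd : ContDiffAt ℝ 2 (hopfBarrier α r y) p :=
      (contDiff_hopfBarrier (m := 2) α r y).contDiffAt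
    have h1 : 0 ≤ nondivOp A B z p :=
      nondivOp_nonneg_of_isLocalMin (hE.posSemidef p hpb)
        ((hvd p hpb).sub (contDiffAt_const.mul hbd)) hloc
    rw [hz, nondivOp_sub_const_mul m (hvd p hpb) hbd] at h1
    have h2 := hL p hpb
    have hk0 := hE.potential_nonneg p hpb
    have hkz : k p * z p ≤ 0 := mul_nonpos_of_nonneg_of_nonpos hk0 hneg.le
    have h3 : k p * hopfBarrier α r y p < nondivOp A B (hopfBarrier α r y) p := by
      rw [nondivOp_hopfBarrier]
      set e := Real.exp (-α * ‖p - y‖ ^ 2) with he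
      have hepos : 0 < e := Real.exp_pos _
      have h4 : k p * hopfBarrier α r y p ≤ kap * e := by
        calc k p * hopfBarrier α r y p ≤ k p * e := by
              gcongr
              unfold hopfBarrier
              have h4 := Real.exp_pos (-α * r ^ 2)
              linarith
          _ ≤ kap * e := by gcongr; exact hE.potential_le p hpb
      have h5 := hE.elliptic p hpb (p - y)
      have h6 := hE.trace_le p hpb
      have h7 := hE.drift_le p hpb (p - y)
      have h8 : lam * (r / 2) ^ 2 ≤ lam * ‖p - y‖ ^ 2 := by gcongr
      have h9 : bet * ‖p - y‖ ≤ bet * r := by gcongr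
      have h10 : kap < 4 * α ^ 2 * ∑ i, ∑ j, A p i j * ((p - y) i * (p - y) j)
          - 2 * α * (A p).trace - 2 * α * ∑ j, B p j * (p - y) j := by
        have e1 : 4 * α ^ 2 * (lam * (r / 2) ^ 2) ≤
            4 * α ^ 2 * ∑ i, ∑ j, A p i j * ((p - y) i * (p - y) j) := by
          gcongr; linarith
        have e2 : 2 * α * (A p).trace ≤ 2 * α * Lam := by gcongr
        have e3 : 2 * α * ∑ j, B p j * (p - y) j ≤ 2 * α * (bet * r) := by
          gcongr; linarith
        nlinarith
      calc _ ≤ kap * e := h4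
        _ = e * kap := mul_comm _ _
        _ < _ := by gcongr
    have h4 : m * (k p * hopfBarrier α r y p) < m * nondivOp A B (hopfBarrier α r y) p := by
      gcongr
    simp only [hz] at hkz
    nlinarith
  intro x hx
  have hxn : ‖x - y‖ ≤ r := by simpa [dist_eq_norm] using hx
  rcases le_total ‖x - y‖ (r / 2) with h | h
  · have h1 := hvm x (by simpa [dist_eq_norm] using h)
    calc min c₀ r⁻¹ * m * (r - ‖x - y‖) ≤ r⁻¹ * m * r := by
          have := sub_nonneg.2 hxn
          gcongr
          · exact min_le_right _ _
          · linarith [norm_nonneg (x - y)]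
      _ = m := by field_simp
      _ ≤ v x := h1
  · refine le_trans ?_ (hann x hx h)
    have h1 : c₀ * (r - ‖x - y‖) ≤ hopfBarrier α r y x := by
      unfold hopfBarrier
      have e1 : Real.exp (-α * ‖x - y‖ ^ 2) =
          Real.exp (-α * r ^ 2) * Real.exp (α * (r ^ 2 - ‖x - y‖ ^ 2)) := by
        rw [← Real.exp_add]; ring_nf
      have e2 := Real.add_one_le_exp (α * (r ^ 2 - ‖x - y‖ ^ 2))
      have e3 : Real.exp (-α * r ^ 2) * (α * (r ^ 2 - ‖x - y‖ ^ 2) + 1) ≤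
          Real.exp (-α * ‖x - y‖ ^ 2) := by
        rw [e1]; gcongr
      have e4 : α * Real.exp (-α * r ^ 2) * (r * (r - ‖x - y‖)) ≤
          α * Real.exp (-α * r ^ 2) * (r ^ 2 - ‖x - y‖ ^ 2) := by
        gcongr
        nlinarith [norm_nonneg (x - y)]
      nlinarith
    calc min c₀ r⁻¹ * m * (r - ‖x - y‖) ≤ c₀ * m * (r - ‖x - y‖) := by
          have := sub_nonneg.2 hxn
          gcongr
          exact min_le_left _ _
      _ = m * (c₀ * (r - ‖x - y‖)) := by ring
      _ ≤ _ := by gcongr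

/-- Strong maximum principle for nonnegative supersolutions. -/
lemma eq_zero_of_supersolution {A : EuclideanSpace ℝ (Fin n) → Matrix (Fin n) (Fin n) ℝ}
    {B : EuclideanSpace ℝ (Fin n) → Fin n → ℝ} {k v : EuclideanSpace ℝ (Fin n) → ℝ}
    {U : Set (EuclideanSpace ℝ (Fin n))} (hU : IsOpen U) (hUc : IsPreconnected U)
    (hE : ∀ x ∈ U, ∃ V ∈ nhds x, ∃ lam > 0, ∃ Lam, ∃ bet ≥ 0, ∃ kap,
      EllipticBounds A B k V lam Lam bet kap)
    (hv : ContDiffOn ℝ 2 v U) (hv0 : ∀ x ∈ U, 0 ≤ v x)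
    (hL : ∀ x ∈ U, nondivOp A B v x - k x * v x ≤ 0) {x₀ : EuclideanSpace ℝ (Fin n)}
    (hx₀ : x₀ ∈ U) (hvx₀ : v x₀ = 0) : ∀ x ∈ U, v x = 0 := by
  have hvc : ContinuousOn v U := hv.continuousOn
  have hlocal : ∀ x ∈ U, v x = 0 → ∀ᶠ y in nhds x, v y = 0 := by
    intro x₁ hx₁ hvx₁
    obtain ⟨V, hV, lam, hlam, Lam, bet, hbet, kap, hEV⟩ := hE x₁ hx₁
    obtain ⟨R, hR, hRV⟩ := Metric.mem_nhds_iff.1 (Filter.inter_mem hV (hU.mem_nhds hx₁))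
    have hRU : ball x₁ R ⊆ U := hRV.trans inter_subset_right
    have hRE := hEV.mono (hRV.trans inter_subset_left)
    rw [Metric.eventually_nhds_iff]
    refine ⟨R / 4, by positivity, fun y hy ↦ ?_⟩
    by_contra hne
    -- Take a zero `z` closest to the nonzero point `y`. The factor `1 / 4` in the choice of `y`
    -- keeps the ball around `y` through `z` inside the ball of radius `R / 2`, so the open ball
    -- contains no zeros.
    set Z := closedBall x₁ (R / 2) ∩ v ⁻¹' {0} with hZ
    have hZc : IsCompact Z := by
      apply (isCompact_closedBall x₁ (R / 2)).of_isClosed_subset _ inter_subset_left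
      apply (hvc.mono ((closedBall_subset_ball (by linarith)).trans hRU)).preimage_isClosed_of_isClosed
        isClosed_closedBall isClosed_singleton
    have hx₁Z : x₁ ∈ Z := ⟨mem_closedBall_self (by positivity), hvx₁⟩
    obtain ⟨z, hzZ, hzd⟩ := hZc.exists_infDist_eq_dist ⟨x₁, hx₁Z⟩ y
    set r := dist y z with hr
    have hr1 : r ≤ dist y x₁ := by rw [← hzd]; exact Metric.infDist_le_dist_of_mem hx₁Z
    have hrpos : 0 < r := by
      rw [hr, dist_pos]
      rintro rfl
      exact hne hzZ.2
    have hsub : closedBall y r ⊆ ball x₁ (R / 2) := by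
      intro x hx
      have := dist_triangle x y x₁
      simp only [mem_closedBall, mem_ball] at hx ⊢
      linarith
    have hsub' : ball x₁ (R / 2) ⊆ ball x₁ R := ball_subset_ball (by linarith)
    have hpos : ∀ x ∈ ball y r, 0 < v x := by
      intro x hx
      refine lt_of_le_of_ne (hv0 x (hRU (hsub' (hsub (ball_subset_closedBall hx))))) fun h ↦ ?_
      have : x ∈ Z := ⟨ball_subset_closedBall (hsub (ball_subset_closedBall hx)), h.symm⟩
      have h2 := Metric.infDist_le_dist_of_mem (x := y) this
      rw [hzd, dist_comm y x] at h2
      exact absurd hx (by simpa using h2)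
    have hcb : closedBall y (r / 2) ⊆ ball y r := closedBall_subset_ball (by linarith)
    obtain ⟨p, hp, hpmin⟩ := (isCompact_closedBall y (r / 2)).exists_isMinOn
      ⟨y, mem_closedBall_self (by positivity)⟩
      (hvc.mono (hcb.trans (ball_subset_closedBall.trans (hsub.trans (hsub'.trans hRU)))))
    have hm := hpos p (hcb hp)
    obtain ⟨c, hc, hhopf⟩ := exists_hopf_constant (n := n) (Lam := Lam) (kap := kap) hlam hbet hrpos
    have key := hhopf A B k v y (v p) hm
      (hRE.mono (ball_subset_closedBall.trans (hsub.trans hsub')))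
      (hvc.mono (hsub.trans (hsub'.trans hRU)))
      (fun x hx ↦ hv.contDiffAt
        (hU.mem_nhds (hRU (hsub' (hsub (ball_subset_closedBall hx))))))
      (fun x hx ↦ hL x (hRU (hsub' (hsub (ball_subset_closedBall hx)))))
      (fun x hx ↦ hv0 x (hRU (hsub' (hsub hx)))) (fun x hx ↦ hpmin hx)
    have hzr : z ∈ closedBall y r := by simp [hr, dist_comm]
    have hzU : z ∈ U := hRU (hsub' (hsub hzr))
    have hvz : v z = 0 := hzZ.2
    have hdz : DifferentiableAt ℝ v z :=
      (hv.contDiffAt (hU.mem_nhds hzU)).differentiableAt (by norm_num)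
    -- As a zero of a nonnegative function, `z` is an interior minimum, so the derivative there is
    -- zero. Hopf's bound makes `v` grow linearly along the segment from `z` to `y`.
    have hmin : IsLocalMin v z := by
      filter_upwards [hU.mem_nhds hzU] with x hx
      rw [hvz]; exact hv0 x hx
    have hf0 : HasFDerivAt v (0 : EuclideanSpace ℝ (Fin n) →L[ℝ] ℝ) z := by
      rw [← hmin.fderiv_eq_zero]; exact hdz.hasFDerivAt
    have hl : HasDerivAt (fun t : ℝ ↦ z + t • (y - z)) (y - z) 0 := by
      simpa using ((hasDerivAt_id (0 : ℝ)).smul_const (y - z)).const_add z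
    have hf1 : HasDerivAt (fun t : ℝ ↦ v (z + t • (y - z))) 0 0 := by
      have h0 : HasFDerivAt v (0 : EuclideanSpace ℝ (Fin n) →L[ℝ] ℝ) (z + (0 : ℝ) • (y - z)) := by
        simpa using hf0
      have := h0.comp_hasDerivAt (0 : ℝ) hl
      rwa [_root_.zero_apply] at this
    -- `c * v p * r` is the slope that Hopf's bound guarantees along `t ↦ z + t (y - z)`. The
    -- derivative zero makes some small difference quotient smaller.
    have hd : 0 < c * v p * r := by positivity
    have hev := (hasDerivWithinAt_iff_tendsto_slope' (s := Ioi 0) (by simp)).1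
      hf1.hasDerivWithinAt
    have h1 := hev.eventually_lt_const hd
    have h2 : ∀ᶠ t : ℝ in nhdsWithin 0 (Ioi 0), t ∈ Ioo (0 : ℝ) 1 :=
      Ioo_mem_nhdsGT one_pos
    obtain ⟨t, h1, h2⟩ := (h1.and h2).exists
    have hn : ‖z + t • (y - z) - y‖ = (1 - t) * r := by
      have : z + t • (y - z) - y = (1 - t) • (z - y) := by module
      rw [this, norm_smul, Real.norm_of_nonneg (by linarith [h2.2]), hr, dist_eq_norm,
        norm_sub_rev y z]
    have h3 := key (z + t • (y - z)) (by
      rw [mem_closedBall, dist_eq_norm, hn]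
      nlinarith [h2.1])
    rw [hn] at h3
    rw [slope_def_field] at h1
    simp only [zero_smul, add_zero, hvz, sub_zero] at h1
    rw [div_lt_iff₀ h2.1] at h1
    nlinarith
  have hopen : ∀ x ∈ U, (v x = 0 → ∀ᶠ y in nhds x, v y = 0) ∧ (v x ≠ 0 → ∀ᶠ y in nhds x, v y ≠ 0) :=
    fun x hx ↦ ⟨hlocal x hx, fun h ↦ (hvc.continuousAt (hU.mem_nhds hx)).eventually_ne h⟩
  by_contra! hcon
  obtain ⟨x₂, hx₂, hvx₂⟩ := hcon
  set S := {x | x ∈ U ∧ v x = 0} with hS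
  set S' := {x | x ∈ U ∧ v x ≠ 0} with hS'
  have hSo : IsOpen S := isOpen_iff_mem_nhds.2 fun x hx ↦
    Filter.inter_mem (hU.mem_nhds hx.1) ((hopen x hx.1).1 hx.2)
  have hSo' : IsOpen S' := isOpen_iff_mem_nhds.2 fun x hx ↦
    Filter.inter_mem (hU.mem_nhds hx.1) ((hopen x hx.1).2 hx.2)
  obtain ⟨y, -, hy1, hy2⟩ := hUc S S' hSo hSo'
    (fun x hx ↦ by by_cases h : v x = 0 <;> [left; right] <;> exact ⟨hx, h⟩)
    ⟨x₀, hx₀, hx₀, hvx₀⟩ ⟨x₂, hx₂, hx₂, hvx₂⟩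
  exact hy2.2 hy1.2

end MaximumPrinciple

/-! ### Smooth dependence of determinants and inverse matrices. -/

section MatrixSmoothness

variable {E : Type*} [NormedAddCommGroup E] [NormedSpace ℝ E] {ι : Type*} [Fintype ι]
  [DecidableEq ι] {G : E → Matrix ι ι ℝ} {s : Set E} {m : ℕ∞}

lemma contDiffOn_det (hG : ∀ i j, ContDiffOn ℝ m (fun x ↦ G x i j) s) :
    ContDiffOn ℝ m (fun x ↦ (G x).det) s := by
  simp only [Matrix.det_apply]
  refine ContDiffOn.sum fun σ _ ↦ ?_
  simp only [Units.smul_def, zsmul_eq_mul]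
  exact contDiffOn_const.mul (contDiffOn_prod fun i _ ↦ hG _ _)

/-- Cramer's rule expresses the entries of the inverse as quotients of determinants. -/
lemma contDiffOn_matrix_inv (hG : ∀ i j, ContDiffOn ℝ m (fun x ↦ G x i j) s)
    (h0 : ∀ x ∈ s, (G x).det ≠ 0) (i j : ι) :
    ContDiffOn ℝ m (fun x ↦ (G x)⁻¹ i j) s := by
  have h (x : E) : (G x)⁻¹ i j =
      ((G x).det)⁻¹ * ((G x).updateRow j (Pi.single i 1)).det := by
    rw [Matrix.inv_def, Matrix.smul_apply, Matrix.adjugate_apply, Ring.inverse_eq_inv',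
      smul_eq_mul]
  simp only [h]
  refine ((contDiffOn_det hG).inv h0).mul (contDiffOn_det fun k l ↦ ?_)
  by_cases hk : k = j
  · subst hk; simpa [Matrix.updateRow_self] using contDiffOn_const
  · simpa [Matrix.updateRow_ne hk] using hG k l

lemma contDiffOn_sqrt_det (hG : ∀ i j, ContDiffOn ℝ m (fun x ↦ G x i j) s)
    (h0 : ∀ x ∈ s, (G x).PosDef) : ContDiffOn ℝ m (fun x ↦ √(G x).det) s :=
  (contDiffOn_det hG).sqrt fun x hx ↦ (h0 x hx).det_pos.ne'

end MatrixSmoothness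

/-! ### The operator in divergence form and its invariance under coordinate changes. -/

section DivergenceForm

variable {n : ℕ}

/-- The operator `(det G)^{-1/2} ∂ᵢ ((det G)^{1/2} G^{ij} ∂ⱼ w)` on `ℝⁿ`. -/
def divOp (G : EuclideanSpace ℝ (Fin n) → Matrix (Fin n) (Fin n) ℝ)
    (w : EuclideanSpace ℝ (Fin n) → ℝ) (x : EuclideanSpace ℝ (Fin n)) : ℝ :=
  (√(G x).det)⁻¹ * ∑ i, partialDeriv i
    (fun y ↦ √(G y).det * ∑ j, (G y)⁻¹ i j * partialDeriv j w y) x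

lemma contDiffOn_partialDeriv {Ω : Set (EuclideanSpace ℝ (Fin n))} (hΩ : IsOpen Ω) {m k : ℕ∞}
    {w : EuclideanSpace ℝ (Fin n) → ℝ} (hw : ContDiffOn ℝ k w Ω) (hk : m + 1 ≤ k) (j : Fin n) :
    ContDiffOn ℝ m (partialDeriv j w) Ω :=
  (hw.fderiv_of_isOpen hΩ (by exact_mod_cast hk)).clm_apply contDiffOn_const

lemma contDiffOn_flux {Ω : Set (EuclideanSpace ℝ (Fin n))} (hΩ : IsOpen Ω)
    {G : EuclideanSpace ℝ (Fin n) → Matrix (Fin n) (Fin n) ℝ}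
    (hG : ∀ i j, ContDiffOn ℝ 1 (fun x ↦ G x i j) Ω) (hpos : ∀ x ∈ Ω, (G x).PosDef)
    {w : EuclideanSpace ℝ (Fin n) → ℝ} (hw : ContDiffOn ℝ 2 w Ω) (i : Fin n) :
    ContDiffOn ℝ 1 (fun y ↦ √(G y).det * ∑ j, (G y)⁻¹ i j * partialDeriv j w y) Ω :=
  (contDiffOn_sqrt_det (m := 1) hG hpos).mul <| ContDiffOn.sum fun j _ ↦
    (contDiffOn_matrix_inv (m := 1) hG (fun x hx ↦ (hpos x hx).det_pos.ne') i j).mul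
      (contDiffOn_partialDeriv (m := 1) (k := 2) hΩ hw (by norm_num) j)

lemma continuousOn_divOp {Ω : Set (EuclideanSpace ℝ (Fin n))} (hΩ : IsOpen Ω)
    {G : EuclideanSpace ℝ (Fin n) → Matrix (Fin n) (Fin n) ℝ}
    (hG : ∀ i j, ContDiffOn ℝ 1 (fun x ↦ G x i j) Ω) (hpos : ∀ x ∈ Ω, (G x).PosDef)
    {w : EuclideanSpace ℝ (Fin n) → ℝ} (hw : ContDiffOn ℝ 2 w Ω) :
    ContinuousOn (divOp G w) Ω := by
  refine ContinuousOn.mul (ContinuousOn.inv₀ ?_ fun x hx ↦ ?_) ?_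
  · exact (contDiffOn_sqrt_det (m := 1) hG hpos).continuousOn
  · exact (Real.sqrt_pos.2 (hpos x hx).det_pos).ne'
  · exact continuousOn_finsetSum _ fun i _ ↦ (contDiffOn_partialDeriv (m := 0) (k := 1) hΩ
      (contDiffOn_flux hΩ hG hpos hw i) (by norm_num) i).continuousOn

lemma integrable_mul_of_tsupport_subset {Ω : Set (EuclideanSpace ℝ (Fin n))} (hΩ : IsOpen Ω)
    {φ F : EuclideanSpace ℝ (Fin n) → ℝ} (hφ : Continuous φ) (hc : HasCompactSupport φ)
    (hs : tsupport φ ⊆ Ω) (hF : ContinuousOn F Ω) : Integrable (fun x ↦ φ x * F x) := by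
  refine Continuous.integrable_of_hasCompactSupport ?_ hc.mul_right
  exact (hφ.continuousOn.mul hF).continuous_of_tsupport_subset hΩ
    ((tsupport_mul_subset_left).trans hs)

lemma tsupport_partialDeriv_subset (φ : EuclideanSpace ℝ (Fin n) → ℝ) (i : Fin n) :
    tsupport (partialDeriv i φ) ⊆ tsupport φ :=
  (closure_mono fun x hx ↦ by
    rw [Function.mem_support] at hx ⊢
    intro h
    exact hx (by rw [partialDeriv, h]; rfl)).trans (tsupport_fderiv_subset ℝ)

lemma hasCompactSupport_partialDeriv {φ : EuclideanSpace ℝ (Fin n) → ℝ}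
    (hφ : HasCompactSupport φ) (i : Fin n) : HasCompactSupport (partialDeriv i φ) :=
  hφ.of_isClosed_subset (isClosed_tsupport _) (tsupport_partialDeriv_subset φ i)

lemma continuous_partialDeriv {φ : EuclideanSpace ℝ (Fin n) → ℝ} (hφ : ContDiff ℝ 1 φ)
    (i : Fin n) : Continuous (partialDeriv i φ) :=
  (hφ.continuous_fderiv (by norm_num)).clm_apply continuous_const

lemma integral_mul_partialDeriv {Ω : Set (EuclideanSpace ℝ (Fin n))} (hΩ : IsOpen Ω)
    {φ F : EuclideanSpace ℝ (Fin n) → ℝ} (hφ : ContDiff ℝ 1 φ) (hc : HasCompactSupport φ)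
    (hs : tsupport φ ⊆ Ω) (hF : ContDiffOn ℝ 1 F Ω) (i : Fin n) :
    ∫ x, φ x * partialDeriv i F x = - ∫ x, partialDeriv i φ x * F x := by
  apply integral_mul_fderiv_eq_neg_fderiv_mul_of_integrable
  · exact integrable_mul_of_tsupport_subset hΩ (continuous_partialDeriv hφ i)
      (hasCompactSupport_partialDeriv hc i) ((tsupport_partialDeriv_subset φ i).trans hs)
      hF.continuousOn
  · exact integrable_mul_of_tsupport_subset hΩ hφ.continuous hc hs
      (contDiffOn_partialDeriv (m := 0) (k := 1) hΩ hF (by norm_num) i).continuousOn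
  · exact integrable_mul_of_tsupport_subset hΩ hφ.continuous hc hs hF.continuousOn
  · exact fun x _ ↦ (hφ.differentiable (by norm_num)).differentiableAt
  · exact fun x hx ↦ (hF.contDiffAt (hΩ.mem_nhds (hs hx))).differentiableAt (by norm_num)

/-- The weak form of the operator `divOp G`. -/
lemma integral_mul_divOp {Ω : Set (EuclideanSpace ℝ (Fin n))} (hΩ : IsOpen Ω)
    {G : EuclideanSpace ℝ (Fin n) → Matrix (Fin n) (Fin n) ℝ}
    (hG : ∀ i j, ContDiffOn ℝ 1 (fun x ↦ G x i j) Ω) (hpos : ∀ x ∈ Ω, (G x).PosDef)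
    {w : EuclideanSpace ℝ (Fin n) → ℝ} (hw : ContDiffOn ℝ 2 w Ω)
    {φ : EuclideanSpace ℝ (Fin n) → ℝ} (hφ : ContDiff ℝ 1 φ) (hc : HasCompactSupport φ)
    (hs : tsupport φ ⊆ Ω) :
    ∫ x, φ x * (√(G x).det * divOp G w x) =
      - ∫ x, √(G x).det * ((fun i ↦ partialDeriv i φ x) ⬝ᵥ
        (G x)⁻¹.mulVec fun j ↦ partialDeriv j w x) := by
  have h1 : ∀ x, φ x * (√(G x).det * divOp G w x) = ∑ i, φ x * partialDeriv i
      (fun y ↦ √(G y).det * ∑ j, (G y)⁻¹ i j * partialDeriv j w y) x := by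
    intro x
    by_cases hx : x ∈ Ω
    · have : √(G x).det ≠ 0 := (Real.sqrt_pos.2 (hpos x hx).det_pos).ne'
      rw [divOp, mul_inv_cancel_left₀ this, Finset.mul_sum]
    · have : φ x = 0 := image_eq_zero_of_notMem_tsupport fun h ↦ hx (hs h)
      simp [this]
  have h2 : ∀ x, √(G x).det * ((fun i ↦ partialDeriv i φ x) ⬝ᵥ
        (G x)⁻¹.mulVec fun j ↦ partialDeriv j w x) = ∑ i, partialDeriv i φ x *
        (√(G x).det * ∑ j, (G x)⁻¹ i j * partialDeriv j w x) := by
    intro x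
    simp only [dotProduct, Matrix.mulVec, Finset.mul_sum]
    refine Finset.sum_congr rfl fun i _ ↦ Finset.sum_congr rfl fun j _ ↦ ?_
    ring
  simp only [h1, h2]
  have hfl := fun i ↦ contDiffOn_flux hΩ hG hpos hw i
  rw [integral_finsetSum, integral_finsetSum, ← Finset.sum_neg_distrib]
  · exact Finset.sum_congr rfl fun i _ ↦ integral_mul_partialDeriv hΩ hφ hc hs (hfl i) i
  · exact fun i _ ↦ integrable_mul_of_tsupport_subset hΩ (continuous_partialDeriv hφ i)
      (hasCompactSupport_partialDeriv hc i) ((tsupport_partialDeriv_subset φ i).trans hs)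
      (hfl i).continuousOn
  · exact fun i _ ↦ integrable_mul_of_tsupport_subset hΩ hφ.continuous hc hs
      (contDiffOn_partialDeriv (m := 0) (k := 1) hΩ (hfl i) (by norm_num) i).continuousOn

/-- The Jacobian matrix of a linear map `ℝⁿ → ℝⁿ`. -/
def jacobian (L : EuclideanSpace ℝ (Fin n) →L[ℝ] EuclideanSpace ℝ (Fin n)) :
    Matrix (Fin n) (Fin n) ℝ :=
  Matrix.of fun k i ↦ L (stdVec i) k

lemma sum_smul_stdVec (v : EuclideanSpace ℝ (Fin n)) : ∑ i, v i • stdVec i = v := by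
  ext k
  simp [stdVec, Pi.single_apply]

lemma det_jacobian (L : EuclideanSpace ℝ (Fin n) →L[ℝ] EuclideanSpace ℝ (Fin n)) :
    (jacobian L).det = L.det := by
  have : jacobian L = LinearMap.toMatrix (EuclideanSpace.basisFun (Fin n) ℝ).toBasis
      (EuclideanSpace.basisFun (Fin n) ℝ).toBasis
      (L : EuclideanSpace ℝ (Fin n) →ₗ[ℝ] EuclideanSpace ℝ (Fin n)) := by
    ext k i
    simp [jacobian, LinearMap.toMatrix_apply, stdVec]
  rw [this, LinearMap.det_toMatrix, ContinuousLinearMap.det]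

lemma partialDeriv_comp {ψ : EuclideanSpace ℝ (Fin n) → ℝ}
    {τ : EuclideanSpace ℝ (Fin n) → EuclideanSpace ℝ (Fin n)} {x : EuclideanSpace ℝ (Fin n)}
    (hψ : DifferentiableAt ℝ ψ (τ x)) (hτ : DifferentiableAt ℝ τ x) :
    (fun i ↦ partialDeriv i (fun y ↦ ψ (τ y)) x) =
      (jacobian (fderiv ℝ τ x)).transpose.mulVec fun k ↦ partialDeriv k ψ (τ x) := by
  ext i
  have := (hψ.hasFDerivAt.comp x hτ.hasFDerivAt).fderiv
  simp only [Function.comp_def] at this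
  rw [partialDeriv, this, ContinuousLinearMap.comp_apply,
    ← sum_smul_stdVec (fderiv ℝ τ x (stdVec i)), map_sum]
  simp [Matrix.mulVec, dotProduct, jacobian, partialDeriv]

lemma sqrt_det_transform {J G₂ : Matrix (Fin n) (Fin n) ℝ} :
    √(J.transpose * G₂ * J).det = |J.det| * √G₂.det := by
  rw [Matrix.det_mul, Matrix.det_mul, Matrix.det_transpose,
    show J.det * G₂.det * J.det = J.det ^ 2 * G₂.det by ring, Real.sqrt_mul (sq_nonneg _),
    Real.sqrt_sq_eq_abs]

/-- This is the invariance of the cotangent inner product: differentials pull back by `Jᵀ`, the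
metric by `Jᵀ G₂ J`. -/
lemma dotProduct_inv_transform {J G₂ : Matrix (Fin n) (Fin n) ℝ} (hJ : J.det ≠ 0)
    (a b : Fin n → ℝ) :
    J.transpose.mulVec a ⬝ᵥ (J.transpose * G₂ * J)⁻¹.mulVec (J.transpose.mulVec b) =
      a ⬝ᵥ G₂⁻¹.mulVec b := by
  have hu : IsUnit J.det := isUnit_iff_ne_zero.2 hJ
  have hut : IsUnit J.transpose.det := by rwa [Matrix.det_transpose]
  rw [Matrix.mul_inv_rev, Matrix.mul_inv_rev, Matrix.mulVec_mulVec,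
    Matrix.mulVec_transpose, ← Matrix.dotProduct_mulVec, Matrix.mulVec_mulVec]
  congr 2
  rw [← Matrix.mul_assoc J, ← Matrix.mul_assoc J, Matrix.mul_nonsing_inv J hu, Matrix.one_mul,
    Matrix.mul_assoc, Matrix.nonsing_inv_mul _ hut, Matrix.mul_one]

/-- The operator `divOp G` does not depend on the coordinates. -/
theorem divOp_comp {Ω₁ Ω₂ : Set (EuclideanSpace ℝ (Fin n))} (hΩ₁ : IsOpen Ω₁) (hΩ₂ : IsOpen Ω₂)
    {τ σ : EuclideanSpace ℝ (Fin n) → EuclideanSpace ℝ (Fin n)}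
    (hτ : ContDiffOn ℝ 2 τ Ω₁) (hσ : ContinuousOn σ Ω₂)
    (hτm : MapsTo τ Ω₁ Ω₂) (hσm : MapsTo σ Ω₂ Ω₁) (hστ : ∀ x ∈ Ω₁, σ (τ x) = x)
    (hτσ : ∀ y ∈ Ω₂, τ (σ y) = y)
    {G₁ G₂ : EuclideanSpace ℝ (Fin n) → Matrix (Fin n) (Fin n) ℝ}
    (hG₁ : ∀ i j, ContDiffOn ℝ 1 (fun x ↦ G₁ x i j) Ω₁)
    (hG₂ : ∀ i j, ContDiffOn ℝ 1 (fun x ↦ G₂ x i j) Ω₂)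
    (hpos₁ : ∀ x ∈ Ω₁, (G₁ x).PosDef) (hpos₂ : ∀ x ∈ Ω₂, (G₂ x).PosDef)
    (hG : ∀ x ∈ Ω₁, G₁ x =
      (jacobian (fderiv ℝ τ x)).transpose * G₂ (τ x) * jacobian (fderiv ℝ τ x))
    {w₁ w₂ : EuclideanSpace ℝ (Fin n) → ℝ} (hw₂ : ContDiffOn ℝ 2 w₂ Ω₂)
    (hw : ∀ x ∈ Ω₁, w₁ x = w₂ (τ x)) :
    ∀ x ∈ Ω₁, divOp G₁ w₁ x = divOp G₂ w₂ (τ x) := by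
  have hw₁ : ContDiffOn ℝ 2 w₁ Ω₁ := (hw₂.comp hτ hτm).congr hw
  have hτd : ∀ x ∈ Ω₁, DifferentiableAt ℝ τ x := fun x hx ↦
    (hτ.contDiffAt (hΩ₁.mem_nhds hx)).differentiableAt (by norm_num)
  have hJ : ∀ x ∈ Ω₁, (jacobian (fderiv ℝ τ x)).det ≠ 0 := fun x hx h ↦ by
    have h1 := (hpos₁ x hx).det_pos.ne'
    rw [hG x hx, Matrix.det_mul, h, mul_zero] at h1
    exact h1 rfl
  have himg : τ '' Ω₁ = Ω₂ := Subset.antisymm hτm.image_subset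
    fun y hy ↦ ⟨σ y, hσm hy, hτσ y hy⟩
  have hinj : InjOn τ Ω₁ := fun x hx y hy h ↦ by rw [← hστ x hx, h, hστ y hy]
  have hchange (g : EuclideanSpace ℝ (Fin n) → ℝ) : ∫ y in Ω₂, g y =
      ∫ x in Ω₁, |(jacobian (fderiv ℝ τ x)).det| * g (τ x) := by
    rw [← himg, integral_image_eq_integral_abs_det_fderiv_smul volume hΩ₁.measurableSet
      (fun x hx ↦ (hτd x hx).hasFDerivAt.hasFDerivWithinAt) hinj]
    simp only [det_jacobian, smul_eq_mul]
  -- `h` is the defect of invariance, weighted by the density. It is shown to integrate to zero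
  -- against all test functions, hence to vanish almost everywhere, hence everywhere by continuity.
  -- No second derivatives of `τ` are computed.
  set h : EuclideanSpace ℝ (Fin n) → ℝ :=
    fun y ↦ √(G₂ y).det * (divOp G₂ w₂ y - divOp G₁ w₁ (σ y)) with hh
  have hc₁ := continuousOn_divOp hΩ₁ hG₁ hpos₁ hw₁
  have hc₂ := continuousOn_divOp hΩ₂ hG₂ hpos₂ hw₂
  have hρ₂ := (contDiffOn_sqrt_det (m := 1) hG₂ hpos₂).continuousOn
  have hcont : ContinuousOn h Ω₂ := hρ₂.mul (hc₂.sub (hc₁.comp hσ hσm))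
  have hzero : ∀ᵐ y, y ∈ Ω₂ → h y = 0 := by
    refine hΩ₂.ae_eq_zero_of_integral_contDiff_smul_eq_zero
      (hcont.locallyIntegrableOn hΩ₂.measurableSet) fun ψ hψ hψc hψs ↦ ?_
    -- The test function `ψ`, transported to `Ω₁` and extended by zero. As `τ` is only `C²`, `φ` is
    -- not smooth in general; the weak form of the operator accepts `C¹` test functions.
    set φ : EuclideanSpace ℝ (Fin n) → ℝ := Ω₁.indicator fun x ↦ ψ (τ x) with hφ
    have hφeq : ∀ x ∈ Ω₁, φ x = ψ (τ x) := fun x hx ↦ indicator_of_mem hx _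
    have hK : IsCompact (σ '' tsupport ψ) := hψc.isCompact.image_of_continuousOn (hσ.mono hψs)
    have hφsupp : tsupport φ ⊆ σ '' tsupport ψ := by
      refine closure_minimal (fun x hx ↦ ?_) hK.isClosed
      have hx1 : x ∈ Ω₁ := by
        by_contra hx1
        exact hx (indicator_of_notMem hx1 _)
      refine ⟨τ x, subset_tsupport _ ?_, hστ x hx1⟩
      rw [Function.mem_support, hφeq x hx1] at hx
      exact hx
    have hφs : tsupport φ ⊆ Ω₁ := hφsupp.trans (by
      rintro _ ⟨y, hy, rfl⟩; exact hσm (hψs hy))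
    have hφc : HasCompactSupport φ := hK.of_isClosed_subset (isClosed_tsupport _) hφsupp
    have hφd : ContDiff ℝ 1 φ := by
      rw [contDiff_iff_contDiffAt]
      intro x
      by_cases hx : x ∈ tsupport φ
      swap
      · exact contDiffAt_const.congr_of_eventuallyEq (notMem_tsupport_iff_eventuallyEq.1 hx)
      have hx1 := hφs hx
      have : ContDiffAt ℝ 1 (fun x ↦ ψ (τ x)) x :=
        (hψ.of_le (by norm_num)).contDiffAt.comp x
          ((hτ.contDiffAt (hΩ₁.mem_nhds hx1)).of_le (by norm_num))
      refine this.congr_of_eventuallyEq ?_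
      filter_upwards [hΩ₁.mem_nhds hx1] with z hz using hφeq z hz
    have e₁ := integral_mul_divOp hΩ₁ hG₁ hpos₁ hw₁ hφd hφc hφs
    have e₂ := integral_mul_divOp hΩ₂ hG₂ hpos₂ hw₂ (hψ.of_le (by norm_num)) hψc hψs
    have hψ0 : ∀ y ∉ Ω₂, ψ y = 0 := fun y hy ↦
      image_eq_zero_of_notMem_tsupport fun h ↦ hy (hψs h)
    have hφ0 : ∀ y ∉ Ω₁, φ y = 0 := fun y hy ↦ indicator_of_notMem hy _
    have hdψ0 : ∀ y ∉ Ω₂, (fun i ↦ partialDeriv i ψ y) = 0 := fun y hy ↦ by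
      ext i
      exact image_eq_zero_of_notMem_tsupport fun h ↦ hy (hψs (tsupport_partialDeriv_subset ψ i h))
    have hdφ0 : ∀ y ∉ Ω₁, (fun i ↦ partialDeriv i φ y) = 0 := fun y hy ↦ by
      ext i
      exact image_eq_zero_of_notMem_tsupport fun h ↦ hy (hφs (tsupport_partialDeriv_subset φ i h))
    have eA : ∫ y, ψ y * (√(G₂ y).det * divOp G₁ w₁ (σ y)) =
        ∫ x, φ x * (√(G₁ x).det * divOp G₁ w₁ x) := by
      have s₂ := setIntegral_eq_integral_of_forall_compl_eq_zero (s := Ω₂) (μ := volume)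
        (f := fun y ↦ ψ y * (√(G₂ y).det * divOp G₁ w₁ (σ y))) fun y hy ↦ by simp [hψ0 y hy]
      have s₁ := setIntegral_eq_integral_of_forall_compl_eq_zero (s := Ω₁) (μ := volume)
        (f := fun x ↦ φ x * (√(G₁ x).det * divOp G₁ w₁ x)) fun y hy ↦ by simp [hφ0 y hy]
      rw [← s₂, ← s₁, hchange]
      refine setIntegral_congr_fun hΩ₁.measurableSet fun x hx ↦ ?_
      simp only [hστ x hx, hφeq x hx]
      rw [hG x hx, sqrt_det_transform]
      ring
    have eB : ∫ y, √(G₂ y).det * ((fun i ↦ partialDeriv i ψ y) ⬝ᵥ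
        (G₂ y)⁻¹.mulVec fun j ↦ partialDeriv j w₂ y) =
        ∫ x, √(G₁ x).det * ((fun i ↦ partialDeriv i φ x) ⬝ᵥ
        (G₁ x)⁻¹.mulVec fun j ↦ partialDeriv j w₁ x) := by
      have s₂ := setIntegral_eq_integral_of_forall_compl_eq_zero (s := Ω₂) (μ := volume)
        (f := fun y ↦ √(G₂ y).det * ((fun i ↦ partialDeriv i ψ y) ⬝ᵥ
          (G₂ y)⁻¹.mulVec fun j ↦ partialDeriv j w₂ y)) fun y hy ↦ by simp [hdψ0 y hy]
      have s₁ := setIntegral_eq_integral_of_forall_compl_eq_zero (s := Ω₁) (μ := volume)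
        (f := fun x ↦ √(G₁ x).det * ((fun i ↦ partialDeriv i φ x) ⬝ᵥ
          (G₁ x)⁻¹.mulVec fun j ↦ partialDeriv j w₁ x)) fun y hy ↦ by simp [hdφ0 y hy]
      rw [← s₂, ← s₁, hchange]
      refine setIntegral_congr_fun hΩ₁.measurableSet fun x hx ↦ ?_
      have d1 : (fun i ↦ partialDeriv i φ x) =
          (jacobian (fderiv ℝ τ x)).transpose.mulVec fun k ↦ partialDeriv k ψ (τ x) := by
        rw [← partialDeriv_comp (hψ.differentiable (by norm_num)).differentiableAt (hτd x hx)]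
        ext i
        exact partialDeriv_congr
          (by filter_upwards [hΩ₁.mem_nhds hx] with z hz using hφeq z hz)
      have d2 : (fun i ↦ partialDeriv i w₁ x) =
          (jacobian (fderiv ℝ τ x)).transpose.mulVec fun k ↦ partialDeriv k w₂ (τ x) := by
        rw [← partialDeriv_comp ((hw₂.contDiffAt
          (hΩ₂.mem_nhds (hτm hx))).differentiableAt (by norm_num)) (hτd x hx)]
        ext i
        exact partialDeriv_congr
          (by filter_upwards [hΩ₁.mem_nhds hx] with z hz using hw z hz)
      simp only [d1, d2]
      rw [hG x hx, sqrt_det_transform, dotProduct_inv_transform (hJ x hx)]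
      ring
    have i₁ : Integrable fun y ↦ ψ y * (√(G₂ y).det * divOp G₂ w₂ y) :=
      integrable_mul_of_tsupport_subset hΩ₂ hψ.continuous hψc hψs (hρ₂.mul hc₂)
    have i₂ : Integrable fun y ↦ ψ y * (√(G₂ y).det * divOp G₁ w₁ (σ y)) :=
      integrable_mul_of_tsupport_subset hΩ₂ hψ.continuous hψc hψs (hρ₂.mul (hc₁.comp hσ hσm))
    simp only [hh, smul_eq_mul, mul_sub]
    rw [integral_sub i₁ i₂, e₂, eA, e₁, eB, sub_self]
  have hall : ∀ y ∈ Ω₂, h y = 0 := by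
    have h1 : h =ᵐ[volume.restrict Ω₂] fun _ ↦ 0 :=
      (ae_restrict_iff' hΩ₂.measurableSet).2 hzero
    exact Measure.eqOn_open_of_ae_eq h1 hΩ₂ hcont continuousOn_const
  intro x hx
  have h1 := hall (τ x) (hτm hx)
  simp only [hh, hστ x hx] at h1
  have h2 : √(G₂ (τ x)).det ≠ 0 := (Real.sqrt_pos.2 (hpos₂ _ (hτm hx)).det_pos).ne'
  have h3 := (mul_eq_zero.1 h1).resolve_left h2
  linarith

/-- The product rule moves the derivative off the flux; the derivatives of the coefficients become
the drift. This form is the one to which the maximum principle applies. -/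
lemma divOp_eq_nondivOp {Ω : Set (EuclideanSpace ℝ (Fin n))} (hΩ : IsOpen Ω)
    {G : EuclideanSpace ℝ (Fin n) → Matrix (Fin n) (Fin n) ℝ}
    (hG : ∀ i j, ContDiffOn ℝ 1 (fun x ↦ G x i j) Ω) (hpos : ∀ x ∈ Ω, (G x).PosDef)
    {w : EuclideanSpace ℝ (Fin n) → ℝ} (hw : ContDiffOn ℝ 2 w Ω)
    {x : EuclideanSpace ℝ (Fin n)} (hx : x ∈ Ω) :
    divOp G w x = nondivOp (fun y ↦ (G y)⁻¹) (fun y j ↦ (√(G y).det)⁻¹ *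
      ∑ i, partialDeriv i (fun z ↦ √(G z).det * (G z)⁻¹ i j) y) w x := by
  have hρ : √(G x).det ≠ 0 := (Real.sqrt_pos.2 (hpos x hx).det_pos).ne'
  have hd1 (i j : Fin n) : DifferentiableAt ℝ (fun z ↦ √(G z).det * (G z)⁻¹ i j) x :=
    (((contDiffOn_sqrt_det (m := 1) hG hpos).mul (contDiffOn_matrix_inv (m := 1) hG
      (fun x hx ↦ (hpos x hx).det_pos.ne') i j)).contDiffAt
        (hΩ.mem_nhds hx)).differentiableAt (by norm_num)
  have hd2 (j : Fin n) : DifferentiableAt ℝ (partialDeriv j w) x :=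
    differentiableAt_partialDeriv (hw.contDiffAt (hΩ.mem_nhds hx)) j
  have h1 (i : Fin n) : partialDeriv i
      (fun y ↦ √(G y).det * ∑ j, (G y)⁻¹ i j * partialDeriv j w y) x =
      ∑ j, (√(G x).det * (G x)⁻¹ i j * partialDeriv i (partialDeriv j w) x +
        partialDeriv j w x * partialDeriv i (fun z ↦ √(G z).det * (G z)⁻¹ i j) x) := by
    have : (fun y ↦ √(G y).det * ∑ j, (G y)⁻¹ i j * partialDeriv j w y) =
        fun y ↦ ∑ j, (√(G y).det * (G y)⁻¹ i j) * partialDeriv j w y := by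
      ext y; simp only [Finset.mul_sum, mul_assoc]
    have h2 := fderiv_fun_sum (u := Finset.univ)
      (A := fun j y ↦ (√(G y).det * (G y)⁻¹ i j) * partialDeriv j w y) (x := x) (𝕜 := ℝ)
      fun j _ ↦ (hd1 i j).mul (hd2 j)
    rw [this, partialDeriv, h2, _root_.sum_apply]
    refine Finset.sum_congr rfl fun j _ ↦ ?_
    rw [fderiv_fun_mul (hd1 i j) (hd2 j)]
    simp [partialDeriv]
  unfold divOp nondivOp
  simp only [h1, Finset.sum_add_distrib, mul_add]
  congr 1
  · rw [Finset.mul_sum]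
    refine Finset.sum_congr rfl fun i _ ↦ ?_
    rw [Finset.mul_sum]
    refine Finset.sum_congr rfl fun j _ ↦ ?_
    field_simp
  · rw [Finset.sum_comm, Finset.mul_sum]
    refine Finset.sum_congr rfl fun j _ ↦ ?_
    rw [mul_assoc, Finset.sum_mul]
    congr 1
    exact Finset.sum_congr rfl fun i _ ↦ mul_comm _ _

end DivergenceForm

/-! ### Cauchy-Schwarz and Jensen inequalities for lower integrals. -/

section SquareIntegrable

variable {X : Type*} [MeasurableSpace X] {μ : Measure X}

lemma eLpNorm_two_sq {F : Type*} [NormedAddCommGroup F] (f : X → F) (μ : Measure X) :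
    eLpNorm f 2 μ ^ 2 = ∫⁻ x, ‖f x‖ₑ ^ 2 ∂μ := by
  have h := eLpNorm_nnreal_pow_eq_lintegral (f := f) (μ := μ) (p := 2) (by norm_num)
  simpa using h

/-- The Cauchy-Schwarz inequality. -/
lemma sq_lintegral_mul_le {f g : X → ℝ≥0∞} (hf : AEMeasurable f μ) (hg : AEMeasurable g μ) :
    (∫⁻ x, f x * g x ∂μ) ^ 2 ≤ (∫⁻ x, f x ^ 2 ∂μ) * ∫⁻ x, g x ^ 2 ∂μ := by
  have h := ENNReal.lintegral_mul_le_Lp_mul_Lq μ Real.HolderConjugate.two_two hf hg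
  simp only [Pi.mul_apply, ENNReal.rpow_two] at h
  have h2 := pow_le_pow_left₀ zero_le h 2
  rw [mul_pow, ← ENNReal.rpow_two, ← ENNReal.rpow_two, ← ENNReal.rpow_two, ← ENNReal.rpow_mul,
    ← ENNReal.rpow_mul] at h2
  simpa using h2

/-- Jensen's inequality for the probability density `k`, by Cauchy-Schwarz after writing `k =
k^{1/2} k^{1/2}`. -/
lemma sq_lintegral_mul_le_of_lintegral_eq_one {k g : X → ℝ≥0∞} (hk : Measurable k)
    (hk1 : ∫⁻ x, k x ∂μ = 1) (hg : AEMeasurable g μ) :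
    (∫⁻ x, k x * g x ∂μ) ^ 2 ≤ ∫⁻ x, k x * g x ^ 2 ∂μ := by
  have hs (x : X) : (k x ^ (1 / 2 : ℝ)) ^ 2 = k x := by
    rw [← ENNReal.rpow_two, ← ENNReal.rpow_mul]; simp
  have hm : Measurable fun x ↦ k x ^ (1 / 2 : ℝ) := hk.pow_const _
  have h := sq_lintegral_mul_le (μ := μ) hm.aemeasurable (hm.aemeasurable.mul hg)
  simp only [← mul_assoc, Pi.mul_apply, mul_pow, hs, ← pow_two] at h
  simpa [hk1] using h

end SquareIntegrable

/-! ### Mollification in `L²(ℝⁿ)`. -/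

section Mollification

open Filter Topology

variable {n : ℕ}

/-- Translations preserve Lebesgue measure and depend continuously on `h`, so they act continuously
on `L²`. -/
lemma tendsto_eLpNorm_translate_sub {g : EuclideanSpace ℝ (Fin n) → ℝ} (hg : MemLp g 2) :
    Tendsto (fun h ↦ eLpNorm (fun x ↦ g (x - h) - g x) 2) (𝓝 0) (𝓝 0) := by
  let T : EuclideanSpace ℝ (Fin n) → C(EuclideanSpace ℝ (Fin n), EuclideanSpace ℝ (Fin n)) :=
    fun h ↦ ⟨fun x ↦ x - h, by fun_prop⟩
  have hT : Continuous T := ContinuousMap.continuous_of_continuous_uncurry _ (by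
    simp only [T, Function.uncurry_def, ContinuousMap.coe_mk]; fun_prop)
  have hTm (h) : MeasurePreserving (T h) := measurePreserving_sub_right volume h
  have : Fact ((1 : ℝ≥0∞) ≤ 2) := ⟨by norm_num⟩
  have hc : Continuous fun h ↦ Lp.compMeasurePreserving (T h) (hTm h) (hg.toLp g) :=
    continuous_const.compMeasurePreservingLp hT hTm (by norm_num)
  have h0 : Lp.compMeasurePreserving (T 0) (hTm 0) (hg.toLp g) = hg.toLp g := by
    rw [Lp.toLp_compMeasurePreserving]
    congr 1
    ext x; simp [T]
  have h1 := hc.tendsto 0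
  rw [h0, tendsto_iff_edist_tendsto_0] at h1
  refine h1.congr fun h ↦ ?_
  rw [Lp.toLp_compMeasurePreserving, Lp.edist_toLp_toLp]
  rfl

/-- The mollification error is an average of `g (x - y) - g x` with a probability density in `y`.
Jensen's inequality and Tonelli bound its `L²` norm by the largest translation error over the
support. -/
lemma eLpNorm_mollify_sub_le {g : EuclideanSpace ℝ (Fin n) → ℝ} (hg : MemLp g 2)
    (φ : ContDiffBump (0 : EuclideanSpace ℝ (Fin n))) {η : ℝ≥0∞}
    (hη : ∀ y ∈ Metric.ball (0 : EuclideanSpace ℝ (Fin n)) φ.rOut,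
      eLpNorm (fun x ↦ g (x - y) - g x) 2 ≤ η) :
    eLpNorm (fun x ↦ (∫ y, φ.normed volume y * g (x - y)) - g x) 2 ≤ η := by
  set k := φ.normed volume with hk
  have hkc : Continuous k := φ.continuous_normed
  have hki : Integrable k := φ.integrable_normed
  have hgl : LocallyIntegrable g := hg.locallyIntegrable (by norm_num)
  have hint (x : EuclideanSpace ℝ (Fin n)) : Integrable fun y ↦ k y * g (x - y) :=
    (φ.hasCompactSupport_normed.convolutionExists_left (ContinuousLinearMap.lsmul ℝ ℝ) hkc hgl x :)
  have hk1 : ∫⁻ y, ENNReal.ofReal (k y) = 1 := by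
    rw [← ofReal_integral_eq_lintegral_ofReal φ.integrable_normed
      (Eventually.of_forall φ.nonneg_normed), φ.integral_normed, ENNReal.ofReal_one]
  have hkm : Measurable fun y ↦ ENNReal.ofReal (k y) := hkc.measurable.ennreal_ofReal
  have hpt (x : EuclideanSpace ℝ (Fin n)) : ‖(∫ y, k y * g (x - y)) - g x‖ₑ ≤
      ∫⁻ y, ENNReal.ofReal (k y) * ‖g (x - y) - g x‖ₑ := by
    have : (∫ y, k y * g (x - y)) - g x = ∫ y, k y * (g (x - y) - g x) := by
      have h1 : g x = ∫ y, k y * g x := by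
        rw [integral_mul_const, hk, φ.integral_normed, one_mul]
      conv_lhs => rw [h1]
      rw [← integral_sub (hint x) (hki.mul_const _)]
      simp only [mul_sub]
    rw [this]
    refine (enorm_integral_le_lintegral_enorm _).trans_eq ?_
    refine lintegral_congr fun y ↦ ?_
    rw [enorm_mul, Real.enorm_of_nonneg (φ.nonneg_normed y)]
  have hm2 : AEStronglyMeasurable (fun p : EuclideanSpace ℝ (Fin n) × EuclideanSpace ℝ (Fin n) ↦
      g (p.1 - p.2) - g p.1) (volume.prod volume) :=
    (hg.1.comp_quasiMeasurePreserving (quasiMeasurePreserving_sub_of_right_invariant _ _)).sub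
      hg.1.comp_fst
  have hm1 (x : EuclideanSpace ℝ (Fin n)) : AEMeasurable fun y ↦ ‖g (x - y) - g x‖ₑ :=
    ((hg.1.comp_quasiMeasurePreserving
      (quasiMeasurePreserving_sub_left_of_right_invariant _ x)).sub
        aestronglyMeasurable_const).enorm
  rw [← ENNReal.pow_le_pow_left_iff (n := 2) two_ne_zero, eLpNorm_two_sq]
  calc ∫⁻ x, ‖(∫ y, k y * g (x - y)) - g x‖ₑ ^ 2
      ≤ ∫⁻ x, ∫⁻ y, ENNReal.ofReal (k y) * ‖g (x - y) - g x‖ₑ ^ 2 := by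
        refine lintegral_mono fun x ↦ (pow_le_pow_left₀ zero_le (hpt x) 2).trans ?_
        exact sq_lintegral_mul_le_of_lintegral_eq_one hkm hk1 (hm1 x)
    _ = ∫⁻ y, ∫⁻ x, ENNReal.ofReal (k y) * ‖g (x - y) - g x‖ₑ ^ 2 := by
        refine lintegral_lintegral_swap ?_
        exact ((hkm.comp measurable_snd).aemeasurable).mul (hm2.enorm.pow_const 2)
    _ ≤ ∫⁻ y, ENNReal.ofReal (k y) * η ^ 2 := by
        refine lintegral_mono fun y ↦ ?_
        rw [lintegral_const_mul' _ _ ENNReal.ofReal_ne_top, ← eLpNorm_two_sq]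
        by_cases hy : y ∈ Metric.ball (0 : EuclideanSpace ℝ (Fin n)) φ.rOut
        · gcongr; exact hη y hy
        · have : k y = 0 := by
            rw [← φ.support_normed_eq (μ := volume)] at hy
            exact Function.notMem_support.1 hy
          simp [this]
    _ = η ^ 2 := by
        rw [lintegral_mul_const _ hkm, hk1, one_mul]

/-- Bump functions with radii tending to zero. -/
def shrinkingBump (n : ℕ) (N : ℕ) : ContDiffBump (0 : EuclideanSpace ℝ (Fin n)) where
  rIn := ((N : ℝ) + 1)⁻¹
  rOut := 2 * ((N : ℝ) + 1)⁻¹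
  rIn_pos := by positivity
  rIn_lt_rOut := by
    have : (0 : ℝ) < ((N : ℝ) + 1)⁻¹ := by positivity
    linarith

/-- Mollification of `g` at scale `1 / (N + 1)`. -/
def mollify (N : ℕ) (g : EuclideanSpace ℝ (Fin n) → ℝ) (x : EuclideanSpace ℝ (Fin n)) : ℝ :=
  ∫ y, (shrinkingBump n N).normed volume y * g (x - y)

lemma tendsto_eLpNorm_mollify_sub {g : EuclideanSpace ℝ (Fin n) → ℝ} (hg : MemLp g 2) :
    Tendsto (fun N ↦ eLpNorm (fun x ↦ mollify N g x - g x) 2) atTop (𝓝 0) := by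
  rw [ENNReal.tendsto_nhds_zero]
  intro η hη
  have h1 := (ENNReal.tendsto_nhds_zero.1 (tendsto_eLpNorm_translate_sub hg)) η hη
  obtain ⟨r, hr, hball⟩ := Metric.eventually_nhds_iff_ball.1 h1
  have h2 : Tendsto (fun N : ℕ ↦ 2 * ((N : ℝ) + 1)⁻¹) atTop (𝓝 0) := by
    have := (tendsto_one_div_add_atTop_nhds_zero_nat (𝕜 := ℝ)).const_mul 2
    simpa using this
  filter_upwards [h2.eventually_lt_const hr] with N hN
  refine eLpNorm_mollify_sub_le hg _ fun y hy ↦ hball y ?_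
  exact Metric.ball_subset_ball hN.le hy

lemma mollify_eq_convolution (N : ℕ) (g : EuclideanSpace ℝ (Fin n) → ℝ) :
    mollify N g =
      convolution ((shrinkingBump n N).normed volume) g (ContinuousLinearMap.lsmul ℝ ℝ) volume :=
  rfl

lemma contDiff_mollify (N : ℕ) {g : EuclideanSpace ℝ (Fin n) → ℝ} (hg : LocallyIntegrable g) :
    ContDiff ℝ ∞ (mollify N g) := by
  rw [mollify_eq_convolution]
  exact (shrinkingBump n N).hasCompactSupport_normed.contDiff_convolution_left _
    (shrinkingBump n N).contDiff_normed hg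

lemma mollify_eq (N : ℕ) (g : EuclideanSpace ℝ (Fin n) → ℝ) (x : EuclideanSpace ℝ (Fin n)) :
    mollify N g x = ∫ y, (shrinkingBump n N).normed volume (x - y) * g y := by
  rw [mollify, ← integral_sub_left_eq_self _ volume x]
  simp

/-- The derivative of the mollification is the mollification of the weak derivative. -/
lemma partialDeriv_mollify (N : ℕ) {i : Fin n} {g Dg : EuclideanSpace ℝ (Fin n) → ℝ}
    (hg : LocallyIntegrable g)
    (hD : ∀ ψ : EuclideanSpace ℝ (Fin n) → ℝ, ContDiff ℝ ∞ ψ → HasCompactSupport ψ →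
      ∫ y, partialDeriv i ψ y * g y = - ∫ y, ψ y * Dg y) (x : EuclideanSpace ℝ (Fin n)) :
    partialDeriv i (mollify N g) x = mollify N Dg x := by
  set k := (shrinkingBump n N).normed (volume : Measure (EuclideanSpace ℝ (Fin n))) with hk
  have hkd : ContDiff ℝ ∞ k := (shrinkingBump n N).contDiff_normed
  have hks : HasCompactSupport k := (shrinkingBump n N).hasCompactSupport_normed
  have h1 := hks.hasFDerivAt_convolution_left (ContinuousLinearMap.lsmul ℝ ℝ)
    (hkd.of_le (by norm_num)) hg x
  have hd (y : EuclideanSpace ℝ (Fin n)) : partialDeriv i (fun y ↦ k (x - y)) y =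
      - partialDeriv i k (x - y) := by
    have h2 : HasFDerivAt (fun y ↦ x - y)
        (-ContinuousLinearMap.id ℝ (EuclideanSpace ℝ (Fin n))) y := (hasFDerivAt_id y).const_sub x
    have h3 := ((hkd.differentiable (by norm_num)).differentiableAt (x := x - y)).hasFDerivAt.comp y h2
    have h4 : fderiv ℝ (fun y ↦ k (x - y)) y = _ := h3.fderiv
    rw [partialDeriv, h4]
    simp [partialDeriv]
  have hex : ConvolutionExistsAt (fderiv ℝ k) g x
      ((ContinuousLinearMap.lsmul ℝ ℝ).precompL (EuclideanSpace ℝ (Fin n))) volume :=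
    (hks.fderiv ℝ).convolutionExists_left _ (hkd.continuous_fderiv (by norm_num)) hg x
  have h5 : partialDeriv i (mollify N g) x = ∫ y, partialDeriv i k y * g (x - y) := by
    rw [partialDeriv, mollify_eq_convolution, h1.fderiv, convolution_def,
      ContinuousLinearMap.integral_apply hex]
    rfl
  have h6 := hD (fun y ↦ k (x - y)) (hkd.comp (contDiff_const.sub contDiff_id))
    (hks.comp_homeomorph (Homeomorph.subLeft x))
  rw [h5, mollify_eq, ← integral_sub_left_eq_self _ volume x]
  simp only [sub_sub_cancel]
  simp only [hd, neg_mul, integral_neg, neg_inj] at h6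
  rw [h6]

/-- By Hölder, convergence in `L²` becomes convergence in `L¹` after multiplication by a fixed `L²`
function. -/
lemma tendsto_integral_mul_of_tendsto_eLpNorm {h a : EuclideanSpace ℝ (Fin n) → ℝ}
    {b : ℕ → EuclideanSpace ℝ (Fin n) → ℝ} (hh : MemLp h 2) (ha : MemLp a 2)
    (hb : ∀ N, AEStronglyMeasurable (b N))
    (hlim : Tendsto (fun N ↦ eLpNorm (fun x ↦ b N x - a x) 2) atTop (𝓝 0)) :
    Tendsto (fun N ↦ ∫ x, h x * b N x) atTop (𝓝 (∫ x, h x * a x)) := by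
  have hle (N : ℕ) : eLpNorm (fun x ↦ h x * b N x - h x * a x) 1 ≤
      eLpNorm h 2 * eLpNorm (fun x ↦ b N x - a x) 2 := by
    have h1 : (fun x ↦ h x * b N x - h x * a x) = h • fun x ↦ b N x - a x := by
      ext x; simp [mul_sub]
    have h2 : AEStronglyMeasurable (fun x ↦ b N x - a x) :=
      (hb N).sub ha.aestronglyMeasurable
    rw [h1]
    exact eLpNorm_smul_le_mul_eLpNorm h2 hh.aestronglyMeasurable
  have h0 : Tendsto (fun N ↦ eLpNorm h 2 * eLpNorm (fun x ↦ b N x - a x) 2) atTop (𝓝 0) := by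
    have hfin : eLpNorm h 2 ≠ ⊤ := hh.eLpNorm_lt_top.ne
    have := ENNReal.Tendsto.const_mul (b := 0) hlim (Or.inr hfin)
    rwa [mul_zero] at this
  have hlim1 := tendsto_of_tendsto_of_tendsto_of_le_of_le tendsto_const_nhds h0
    (fun _ ↦ zero_le) hle
  have hia : Integrable fun x ↦ h x * a x := hh.integrable_mul ha
  refine tendsto_integral_of_L1' _ hia.aestronglyMeasurable ?_ hlim1
  filter_upwards [hlim1.eventually_lt_const ENNReal.zero_lt_top] with N hN
  have h2 : Integrable fun x ↦ h x * b N x - h x * a x :=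
    memLp_one_iff_integrable.1 ⟨(hh.aestronglyMeasurable.mul (hb N)).sub hia.aestronglyMeasurable, hN⟩
  refine (h2.add hia).congr (Eventually.of_forall fun x ↦ ?_)
  simp

end Mollification

/-! ### Product rule for `|f|²` when `f` has a weak derivative. -/

section WeakSquare

open Filter Topology

variable {n : ℕ}

/-- `f` is square integrable on the compact subsets of `Ω`. -/
def LocSqIntegrableOn {F : Type*} [NormedAddCommGroup F] (f : EuclideanSpace ℝ (Fin n) → F)
    (Ω : Set (EuclideanSpace ℝ (Fin n))) : Prop :=
  ∀ K ⊆ Ω, IsCompact K → MemLp f 2 (volume.restrict K)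

lemma exists_smooth_cutoff {K Ω : Set (EuclideanSpace ℝ (Fin n))} (hK : IsCompact K)
    (hΩ : IsOpen Ω) (hKΩ : K ⊆ Ω) :
    ∃ ζ : EuclideanSpace ℝ (Fin n) → ℝ, ContDiff ℝ ∞ ζ ∧ HasCompactSupport ζ ∧ tsupport ζ ⊆ Ω ∧
      (∀ x, 0 ≤ ζ x) ∧ ∃ U, IsOpen U ∧ K ⊆ U ∧ ∀ x ∈ U, ζ x = 1 := by
  obtain ⟨L, hL, hKL, hLΩ⟩ := exists_compact_between hK hΩ hKΩ
  obtain ⟨L', hL', hKL', hLL'⟩ := exists_compact_between hK isOpen_interior hKL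
  obtain ⟨ζ, hζ, hr, hs, h1⟩ := exists_contMDiff_support_eq_eq_one_iff (n := (⊤ : ℕ∞))
    (modelWithCornersSelf ℝ (EuclideanSpace ℝ (Fin n))) isOpen_interior hL'.isClosed hLL'
  have ht : tsupport ζ ⊆ L := by
    rw [tsupport, hs]; exact closure_minimal interior_subset hL.isClosed
  exact ⟨ζ, hζ.contDiff, hL.of_isClosed_subset (isClosed_tsupport _) ht, ht.trans hLΩ,
    fun x ↦ (hr (mem_range_self x)).1, interior L', isOpen_interior, hKL',
    fun x hx ↦ (h1 x).1 (interior_subset hx)⟩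

lemma LocSqIntegrableOn.memLp_mul {f : EuclideanSpace ℝ (Fin n) → ℝ}
    {Ω : Set (EuclideanSpace ℝ (Fin n))} (hf : LocSqIntegrableOn f Ω)
    {ψ : EuclideanSpace ℝ (Fin n) → ℝ} (hψ : Continuous ψ) (hc : HasCompactSupport ψ)
    (hs : tsupport ψ ⊆ Ω) : MemLp (fun x ↦ ψ x * f x) 2 := by
  obtain ⟨C, hC⟩ := hc.exists_bound_of_continuous hψ
  have hi : (fun x ↦ ψ x * f x) = (tsupport ψ).indicator fun x ↦ ψ x * f x := by
    ext x
    by_cases hx : x ∈ tsupport ψ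
    · rw [indicator_of_mem hx]
    · rw [indicator_of_notMem hx, image_eq_zero_of_notMem_tsupport hx, zero_mul]
  rw [hi, memLp_indicator_iff_restrict (isClosed_tsupport ψ).measurableSet]
  have hm := hf _ hs hc
  refine hm.of_le_mul (c := C) (hψ.aestronglyMeasurable.mul hm.aestronglyMeasurable)
    (Eventually.of_forall fun x ↦ ?_)
  rw [norm_mul]
  gcongr
  exact hC x

lemma integrable_smul_of_integrableOn_tsupport {F : Type*} [NormedAddCommGroup F]
    [NormedSpace ℝ F] {f : EuclideanSpace ℝ (Fin n) → F} {ψ : EuclideanSpace ℝ (Fin n) → ℝ}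
    (hf : IntegrableOn f (tsupport ψ)) (hψ : Continuous ψ) (hc : HasCompactSupport ψ) :
    Integrable fun x ↦ ψ x • f x := by
  have h2 : Function.support (fun x ↦ ψ x • f x) ⊆ tsupport ψ :=
    (Function.support_smul_subset_left ψ f).trans (subset_tsupport ψ)
  rw [← integrableOn_iff_integrable_of_support_subset h2]
  exact hf.continuousOn_smul hψ.continuousOn hc

lemma integrable_smul_of_tsupport_subset {F : Type*} [NormedAddCommGroup F] [NormedSpace ℝ F]
    {f : EuclideanSpace ℝ (Fin n) → F}
    {Ω : Set (EuclideanSpace ℝ (Fin n))} (hf : LocallyIntegrableOn f Ω)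
    {ψ : EuclideanSpace ℝ (Fin n) → ℝ} (hψ : Continuous ψ) (hc : HasCompactSupport ψ)
    (hs : tsupport ψ ⊆ Ω) : Integrable fun x ↦ ψ x • f x :=
  integrable_smul_of_integrableOn_tsupport (hf.integrableOn_compact_subset hs hc) hψ hc

/-- The square of a real function with a weak partial derivative. -/
lemma integral_partialDeriv_mul_sq {Ω : Set (EuclideanSpace ℝ (Fin n))} (hΩ : IsOpen Ω) {i : Fin n}
    {f D : EuclideanSpace ℝ (Fin n) → ℝ} (h : HasWeakPartial Ω i f D)
    (hf : LocSqIntegrableOn f Ω) (hD : LocSqIntegrableOn D Ω)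
    {ψ : EuclideanSpace ℝ (Fin n) → ℝ} (hψ : ContDiff ℝ ∞ ψ) (hc : HasCompactSupport ψ)
    (hs : tsupport ψ ⊆ Ω) :
    ∫ x, partialDeriv i ψ x * f x ^ 2 = - ∫ x, ψ x * (2 * f x * D x) := by
  -- The formula would follow by testing the weak derivative with `ψ f`, which is not smooth.
  -- Cutting `f` off by `ζ`, which is `1` near the support of `ψ`, gives a global `L²` function `g`
  -- that can be mollified.
  obtain ⟨ζ, hζ, hζc, hζs, -, U, hU, hKU, hζ1⟩ := exists_smooth_cutoff hc.isCompact hΩ hs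
  have hζ' := contDiff_infty.1 hζ 1
  have hψ' := contDiff_infty.1 hψ 1
  have hdd (η θ : EuclideanSpace ℝ (Fin n) → ℝ) (hη : ContDiff ℝ ∞ η) (hθ : ContDiff ℝ ∞ θ)
      (x : EuclideanSpace ℝ (Fin n)) : partialDeriv i (fun y ↦ η y * θ y) x =
        partialDeriv i η x * θ x + η x * partialDeriv i θ x := by
    rw [partialDeriv, fderiv_fun_mul (hη.differentiable (by norm_num)).differentiableAt
      (hθ.differentiable (by norm_num)).differentiableAt]
    simp [partialDeriv]; ring
  set g : EuclideanSpace ℝ (Fin n) → ℝ := fun x ↦ ζ x * f x with hg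
  set Dg : EuclideanSpace ℝ (Fin n) → ℝ := fun x ↦ ζ x * D x + partialDeriv i ζ x * f x with hDg
  have hdζc := continuous_partialDeriv hζ' i
  have hdζs := (tsupport_partialDeriv_subset ζ i).trans hζs
  have hdζcs := hasCompactSupport_partialDeriv hζc i
  have hgm : MemLp g 2 := hf.memLp_mul hζ.continuous hζc hζs
  have hDgm : MemLp Dg 2 := (hD.memLp_mul hζ.continuous hζc hζs).add
    (hf.memLp_mul hdζc hdζcs hdζs)
  have hgl : LocallyIntegrable g := hgm.locallyIntegrable (by norm_num)
  have hDgl : LocallyIntegrable Dg := hDgm.locallyIntegrable (by norm_num)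
  have hweak : ∀ η : EuclideanSpace ℝ (Fin n) → ℝ, ContDiff ℝ ∞ η → HasCompactSupport η →
      ∫ y, partialDeriv i η y * g y = - ∫ y, η y * Dg y := by
    intro η hη hηc
    have h1 : ∫ y, partialDeriv i (fun y ↦ η y * ζ y) y • f y = - ∫ y, (η y * ζ y) • D y :=
      h.2.2 (fun y ↦ η y * ζ y) (hη.mul hζ) hηc.mul_right (tsupport_mul_subset_right.trans hζs)
    simp only [hdd η ζ hη hζ, smul_eq_mul, add_mul] at h1
    have i1 : Integrable fun y ↦ (partialDeriv i η y * ζ y) * f y :=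
      integrable_smul_of_tsupport_subset h.1
        ((continuous_partialDeriv (hη.of_le (by norm_num)) i).mul hζ.continuous) hζc.mul_left
        (tsupport_mul_subset_right.trans hζs)
    have i2 : Integrable fun y ↦ (η y * partialDeriv i ζ y) * f y :=
      integrable_smul_of_tsupport_subset h.1 (hη.continuous.mul hdζc) hdζcs.mul_left
        (tsupport_mul_subset_right.trans hdζs)
    have i3 : Integrable fun y ↦ (η y * ζ y) * D y :=
      integrable_smul_of_tsupport_subset h.2.1 (hη.continuous.mul hζ.continuous) hζc.mul_left
        (tsupport_mul_subset_right.trans hζs)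
    rw [integral_add i1 i2] at h1
    have e1 : ∫ y, partialDeriv i η y * g y = ∫ y, (partialDeriv i η y * ζ y) * f y := by
      simp only [hg, mul_assoc]
    have e2 : ∫ y, η y * Dg y =
        (∫ y, (η y * ζ y) * D y) + ∫ y, (η y * partialDeriv i ζ y) * f y := by
      rw [← integral_add i3 i2]
      simp only [hDg, mul_add, mul_assoc]
    rw [e1, e2]; linarith
  have hdψc := continuous_partialDeriv hψ' i
  have hdψs := (tsupport_partialDeriv_subset ψ i).trans hs
  have hdψcs := hasCompactSupport_partialDeriv hc i
  -- The weak derivative of `f` tested with the smooth function `ψ * mollify N g`. As `N` grows all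
  -- three integrals converge, and on the support of `ψ` the limits `g` and `Dg` are `f` and `D`.
  have hN (N : ℕ) : (∫ x, (partialDeriv i ψ x * f x) * mollify N g x) +
      (∫ x, (ψ x * f x) * mollify N Dg x) = - ∫ x, (ψ x * D x) * mollify N g x := by
    have hm := contDiff_mollify N hgl
    have hm' := contDiff_mollify N hDgl
    have h1 : ∫ y, partialDeriv i (fun y ↦ ψ y * mollify N g y) y • f y =
        - ∫ y, (ψ y * mollify N g y) • D y :=
      h.2.2 (fun y ↦ ψ y * mollify N g y) (hψ.mul hm) hc.mul_right
        (tsupport_mul_subset_left.trans hs)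
    simp only [hdd _ _ hψ hm, partialDeriv_mollify N hgl hweak, smul_eq_mul, add_mul] at h1
    have i1 : Integrable fun y ↦ (partialDeriv i ψ y * mollify N g y) * f y :=
      integrable_smul_of_tsupport_subset h.1 (hdψc.mul hm.continuous) hdψcs.mul_right
        (tsupport_mul_subset_left.trans hdψs)
    have i2 : Integrable fun y ↦ (ψ y * mollify N Dg y) * f y :=
      integrable_smul_of_tsupport_subset h.1 (hψ.continuous.mul hm'.continuous) hc.mul_right
        (tsupport_mul_subset_left.trans hs)
    rw [integral_add i1 i2] at h1
    simpa only [mul_right_comm] using h1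
  have l1 := tendsto_integral_mul_of_tendsto_eLpNorm (hf.memLp_mul hdψc hdψcs hdψs) hgm
    (fun N ↦ (contDiff_mollify N hgl).continuous.aestronglyMeasurable)
    (tendsto_eLpNorm_mollify_sub hgm)
  have l2 := tendsto_integral_mul_of_tendsto_eLpNorm (hf.memLp_mul hψ.continuous hc hs) hDgm
    (fun N ↦ (contDiff_mollify N hDgl).continuous.aestronglyMeasurable)
    (tendsto_eLpNorm_mollify_sub hDgm)
  have l3 := tendsto_integral_mul_of_tendsto_eLpNorm (hD.memLp_mul hψ.continuous hc hs) hgm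
    (fun N ↦ (contDiff_mollify N hgl).continuous.aestronglyMeasurable)
    (tendsto_eLpNorm_mollify_sub hgm)
  have hlim := tendsto_nhds_unique (l1.add l2) ((l3.neg).congr fun N ↦ (hN N).symm)
  have hζU : ∀ x ∈ tsupport ψ, ζ x = 1 ∧ partialDeriv i ζ x = 0 := fun x hx ↦ by
    refine ⟨hζ1 x (hKU hx), ?_⟩
    have : ζ =ᶠ[𝓝 x] fun _ ↦ 1 := by
      filter_upwards [hU.mem_nhds (hKU hx)] with y hy using hζ1 y hy
    rw [partialDeriv_congr this, partialDeriv]; simp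
  have e1 : ∫ x, (partialDeriv i ψ x * f x) * g x = ∫ x, partialDeriv i ψ x * f x ^ 2 := by
    congr 1; ext x
    by_cases hx : x ∈ tsupport ψ
    · simp only [hg, (hζU x hx).1]; ring
    · simp [image_eq_zero_of_notMem_tsupport fun h ↦ hx (tsupport_partialDeriv_subset ψ i h)]
  have e2 : ∫ x, (ψ x * f x) * Dg x = ∫ x, ψ x * (f x * D x) := by
    congr 1; ext x
    by_cases hx : x ∈ tsupport ψ
    · simp only [hDg, (hζU x hx).1, (hζU x hx).2]; ring
    · simp [image_eq_zero_of_notMem_tsupport hx]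
  have e3 : ∫ x, (ψ x * D x) * g x = ∫ x, ψ x * (f x * D x) := by
    congr 1; ext x
    by_cases hx : x ∈ tsupport ψ
    · simp only [hg, (hζU x hx).1]; ring
    · simp [image_eq_zero_of_notMem_tsupport hx]
  have e4 : ∫ x, ψ x * (2 * f x * D x) = 2 * ∫ x, ψ x * (f x * D x) := by
    rw [← integral_const_mul]
    congr 1; ext x; ring
  rw [e1, e2, e3] at hlim
  rw [e4]; linarith

/-- The squared modulus of a real or complex function with a weak partial derivative. -/
lemma integral_partialDeriv_mul_normSq {𝕜 : Type*} [RCLike 𝕜]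
    {Ω : Set (EuclideanSpace ℝ (Fin n))} (hΩ : IsOpen Ω) {i : Fin n}
    {f D : EuclideanSpace ℝ (Fin n) → 𝕜} (h : HasWeakPartial Ω i f D)
    (hf : LocSqIntegrableOn f Ω) (hD : LocSqIntegrableOn D Ω)
    {ψ : EuclideanSpace ℝ (Fin n) → ℝ} (hψ : ContDiff ℝ ∞ ψ) (hc : HasCompactSupport ψ)
    (hs : tsupport ψ ⊆ Ω) :
    ∫ x, partialDeriv i ψ x * ‖f x‖ ^ 2 = - ∫ x, ψ x * (2 * (RCLike.re (f x) * RCLike.re (D x) +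
      RCLike.im (f x) * RCLike.im (D x))) := by
  -- Real and imaginary parts inherit the weak derivative, since real linear functionals commute
  -- with the integral.
  have hcomp (L : 𝕜 →L[ℝ] ℝ) : HasWeakPartial Ω i (fun x ↦ L (f x)) (fun x ↦ L (D x)) := by
    refine ⟨fun x hx ↦ ?_, fun x hx ↦ ?_, fun η hη hηc hηs ↦ ?_⟩
    · obtain ⟨U, hU, hi⟩ := h.1 x hx
      exact ⟨U, hU, L.integrable_comp hi⟩
    · obtain ⟨U, hU, hi⟩ := h.2.1 x hx
      exact ⟨U, hU, L.integrable_comp hi⟩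
    · have i1 : Integrable fun y ↦ partialDeriv i η y • f y :=
        integrable_smul_of_tsupport_subset h.1 (continuous_partialDeriv (hη.of_le (by norm_num)) i)
        (hasCompactSupport_partialDeriv hηc i) ((tsupport_partialDeriv_subset η i).trans hηs)
      have i2 := integrable_smul_of_tsupport_subset h.2.1 hη.continuous hηc hηs
      have h1 := congrArg L (h.2.2 η hη hηc hηs)
      rw [map_neg, ← L.integral_comp_comm i2] at h1
      have h2 := L.integral_comp_comm i1
      simp only [partialDeriv] at h2
      rw [← h2] at h1
      simpa only [map_smul] using h1
  have hsq (L : 𝕜 →L[ℝ] ℝ) {f : EuclideanSpace ℝ (Fin n) → 𝕜} (hf : LocSqIntegrableOn f Ω) :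
      LocSqIntegrableOn (fun x ↦ L (f x)) Ω := fun K hK hKc ↦ L.comp_memLp' (hf K hK hKc)
  have hre := integral_partialDeriv_mul_sq hΩ (hcomp RCLike.reCLM) (hsq _ hf) (hsq _ hD) hψ hc hs
  have him := integral_partialDeriv_mul_sq hΩ (hcomp RCLike.imCLM) (hsq _ hf) (hsq _ hD) hψ hc hs
  have hψ' := contDiff_infty.1 hψ 1
  -- The cutoff `ζ` is inserted only to write the integrand as a product of two global `L²`
  -- functions.
  have hi1 (L : 𝕜 →L[ℝ] ℝ) : Integrable fun x ↦ partialDeriv i ψ x * L (f x) ^ 2 := by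
    obtain ⟨ζ, hζ, hζc, hζs, -, U, hU, hKU, hζ1⟩ := exists_smooth_cutoff hc.isCompact hΩ hs
    have h1 := ((hsq L hf).memLp_mul (continuous_partialDeriv hψ' i)
      (hasCompactSupport_partialDeriv hc i)
      ((tsupport_partialDeriv_subset ψ i).trans hs)).integrable_mul
      ((hsq L hf).memLp_mul hζ.continuous hζc hζs)
    refine h1.congr (Eventually.of_forall fun x ↦ ?_)
    by_cases hx : x ∈ tsupport ψ
    · simp only [Pi.mul_apply, hζ1 x (hKU hx)]; ring
    · simp [image_eq_zero_of_notMem_tsupport fun h ↦ hx (tsupport_partialDeriv_subset ψ i h)]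
  have hi2 (L : 𝕜 →L[ℝ] ℝ) : Integrable fun x ↦ ψ x * (2 * L (f x) * L (D x)) := by
    obtain ⟨ζ, hζ, hζc, hζs, -, U, hU, hKU, hζ1⟩ := exists_smooth_cutoff hc.isCompact hΩ hs
    have h1 := (((hsq L hf).memLp_mul hψ.continuous hc hs).integrable_mul
      ((hsq L hD).memLp_mul hζ.continuous hζc hζs)).const_mul 2
    refine h1.congr (Eventually.of_forall fun x ↦ ?_)
    by_cases hx : x ∈ tsupport ψ
    · simp only [Pi.mul_apply, hζ1 x (hKU hx)]; ring
    · simp [image_eq_zero_of_notMem_tsupport hx]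
  calc ∫ x, partialDeriv i ψ x * ‖f x‖ ^ 2
      = ∫ x, (partialDeriv i ψ x * RCLike.reCLM (f x) ^ 2 +
          partialDeriv i ψ x * RCLike.imCLM (f x) ^ 2) := by
        congr 1; ext x
        rw [← RCLike.normSq_eq_def', RCLike.normSq_apply]
        simp only [RCLike.reCLM_apply, RCLike.imCLM_apply]; ring
    _ = - (∫ x, ψ x * (2 * RCLike.reCLM (f x) * RCLike.reCLM (D x)) +
          ψ x * (2 * RCLike.imCLM (f x) * RCLike.imCLM (D x))) := by
        rw [integral_add (hi1 _) (hi1 _), integral_add (hi2 _) (hi2 _), hre, him]; ring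
    _ = _ := by
        congr 2; ext x
        simp only [RCLike.reCLM_apply, RCLike.imCLM_apply]; ring

end WeakSquare

/-! ### Integration by parts in the normal direction of a half-space. -/

section HalfSpaceEstimate

open Filter Topology

/-- The function `t ↦ t` cut off smoothly near `t ≤ 1 / k`. -/
def cutoffId (k t : ℝ) : ℝ := t * Real.smoothTransition (k * t - 1)

lemma contDiff_cutoffId (k : ℝ) : ContDiff ℝ ∞ (cutoffId k) := by
  unfold cutoffId
  have h : ContDiff ℝ ∞ Real.smoothTransition := Real.smoothTransition.contDiff (n := ⊤)
  exact contDiff_id.mul (h.comp ((contDiff_const.mul contDiff_id).sub contDiff_const))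

lemma cutoffId_eq_zero {k t : ℝ} (h : k * t ≤ 1) : cutoffId k t = 0 := by
  rw [cutoffId, Real.smoothTransition.zero_of_nonpos (by linarith), mul_zero]

lemma cutoffId_nonneg {k t : ℝ} (ht : 0 ≤ t) : 0 ≤ cutoffId k t :=
  mul_nonneg ht (Real.smoothTransition.nonneg _)

lemma cutoffId_le {k t : ℝ} (ht : 0 ≤ t) : cutoffId k t ≤ t := by
  have := mul_le_mul_of_nonneg_left (Real.smoothTransition.le_one (k * t - 1)) ht
  simpa [cutoffId] using this

lemma deriv_cutoffId (k t : ℝ) : deriv (cutoffId k) t =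
    Real.smoothTransition (k * t - 1) + t * (k * deriv Real.smoothTransition (k * t - 1)) := by
  have h0 : HasDerivAt (fun t : ℝ ↦ k * t - 1) k t := by
    have := ((hasDerivAt_id t).const_mul k).sub_const 1
    rwa [mul_one] at this
  have h1 : HasDerivAt Real.smoothTransition (deriv Real.smoothTransition (k * t - 1))
      (k * t - 1) :=
    ((Real.smoothTransition.contDiff (n := 1)).differentiable (by norm_num)).differentiableAt.hasDerivAt
  have h2 := (hasDerivAt_id t).mul (h1.comp t h0)
  have h3 : deriv (cutoffId k) t = _ := h2.deriv
  rw [h3]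
  simp only [id_eq, Function.comp_apply]
  ring

/-- The remaining term of the derivative is `t` times a nonnegative factor that vanishes for `t <
0`. Only this lower bound on the derivative is needed, so its size as `k` grows is irrelevant. -/
lemma smoothTransition_le_deriv_cutoffId {k t : ℝ} (hk : 0 < k) :
    Real.smoothTransition (k * t - 1) ≤ deriv (cutoffId k) t := by
  rw [deriv_cutoffId]
  have h1 : 0 ≤ deriv Real.smoothTransition (k * t - 1) := Real.smoothTransition.monotone.deriv_nonneg
  rcases le_or_gt 0 t with ht | ht
  · have : 0 ≤ t * (k * deriv Real.smoothTransition (k * t - 1)) := by positivity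
    linarith
  · have h2 : Real.smoothTransition =ᶠ[𝓝 (k * t - 1)] fun _ ↦ 0 := by
      have : k * t - 1 < 0 := by nlinarith
      filter_upwards [Iio_mem_nhds this] with s hs
      exact Real.smoothTransition.zero_of_nonpos (le_of_lt hs)
    rw [h2.deriv_eq]
    simp

variable {n : ℕ} {𝕜 : Type*} [RCLike 𝕜]

lemma abs_re_mul_re_add_im_mul_im_le (z w : 𝕜) :
    |RCLike.re z * RCLike.re w + RCLike.im z * RCLike.im w| ≤ ‖z‖ * ‖w‖ := by
  have h : RCLike.re z * RCLike.re w + RCLike.im z * RCLike.im w =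
      RCLike.re ((starRingEnd 𝕜) z * w) := by
    simp [RCLike.mul_re]
  rw [h]
  refine (RCLike.abs_re_le_norm _).trans ?_
  rw [norm_mul, RCLike.norm_conj]

lemma LocSqIntegrableOn.integrableOn_normSq {f : EuclideanSpace ℝ (Fin n) → 𝕜}
    {Ω K : Set (EuclideanSpace ℝ (Fin n))} (hf : LocSqIntegrableOn f Ω) (hK : K ⊆ Ω)
    (hc : IsCompact K) : IntegrableOn (fun x ↦ ‖f x‖ ^ 2) K :=
  (hf K hK hc).norm.integrable_sq

lemma LocSqIntegrableOn.integrableOn_re_mul {f D : EuclideanSpace ℝ (Fin n) → 𝕜}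
    {Ω K : Set (EuclideanSpace ℝ (Fin n))} (hf : LocSqIntegrableOn f Ω)
    (hD : LocSqIntegrableOn D Ω) (hK : K ⊆ Ω) (hc : IsCompact K) :
    IntegrableOn (fun x ↦ 2 * (RCLike.re (f x) * RCLike.re (D x) +
      RCLike.im (f x) * RCLike.im (D x))) K := by
  have h1 := ((hf K hK hc).re).integrable_mul ((hD K hK hc).re)
  have h2 := ((hf K hK hc).im).integrable_mul ((hD K hK hc).im)
  exact (h1.add h2).const_mul 2

variable [NeZero n]

lemma partialDeriv_zero_mul_cutoffId {χ : EuclideanSpace ℝ (Fin n) → ℝ} (hχ : ContDiff ℝ ∞ χ)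
    (k : ℝ) (x : EuclideanSpace ℝ (Fin n)) :
    partialDeriv 0 (fun x ↦ χ x * cutoffId k (x 0)) x =
      partialDeriv 0 χ x * cutoffId k (x 0) + χ x * deriv (cutoffId k) (x 0) := by
  have h1 : HasFDerivAt (fun x : EuclideanSpace ℝ (Fin n) ↦ x 0)
      (EuclideanSpace.proj 0 : EuclideanSpace ℝ (Fin n) →L[ℝ] ℝ) x :=
    (EuclideanSpace.proj 0 : EuclideanSpace ℝ (Fin n) →L[ℝ] ℝ).hasFDerivAt
  have h2 : HasDerivAt (cutoffId k) (deriv (cutoffId k) (x 0)) (x 0) :=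
    ((contDiff_cutoffId k).differentiable (by norm_num)).differentiableAt.hasDerivAt
  have h3 := h2.comp_hasFDerivAt x h1
  have h4 := (hχ.differentiable (by norm_num)).differentiableAt.hasFDerivAt (x := x).mul h3
  have h5 : fderiv ℝ (fun x ↦ χ x * cutoffId k (x 0)) x = _ := h4.fderiv
  rw [partialDeriv, h5]
  simp [partialDeriv, stdVec]
  ring

/-- Weighted estimate in a half-space: `∫ χ |f|²` is controlled by `∫ x₀ |f| (|f| + |∂₀ f|)`. -/
theorem exists_lintegral_normSq_le {χ : EuclideanSpace ℝ (Fin n) → ℝ} (hχ : ContDiff ℝ ∞ χ)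
    (hχc : HasCompactSupport χ) (hχ0 : ∀ x, 0 ≤ χ x) :
    ∃ C : ℝ≥0, ∀ (Ω : Set (EuclideanSpace ℝ (Fin n))) (f D : EuclideanSpace ℝ (Fin n) → 𝕜),
      IsOpen Ω → (∀ x ∈ tsupport χ, 0 < x 0 → x ∈ Ω) → HasWeakPartial Ω 0 f D →
      LocSqIntegrableOn f Ω → LocSqIntegrableOn D Ω →
      ∫⁻ x in {x | 0 < x 0}, ENNReal.ofReal (χ x) * ‖f x‖ₑ ^ 2 ≤
        C * ∫⁻ x in tsupport χ ∩ {x | 0 < x 0},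
          ENNReal.ofReal (x 0) * (‖f x‖ₑ * (‖f x‖ₑ + ‖D x‖ₑ)) := by
  have hχ' := contDiff_infty.1 hχ 1
  obtain ⟨C₁, hC₁⟩ := hχc.exists_bound_of_continuous hχ.continuous
  obtain ⟨C₂, hC₂⟩ := (hasCompactSupport_partialDeriv hχc 0).exists_bound_of_continuous
    (continuous_partialDeriv hχ' 0)
  have hC₁0 : 0 ≤ C₁ := (norm_nonneg _).trans (hC₁ 0)
  have hC₂0 : 0 ≤ C₂ := (norm_nonneg _).trans (hC₂ 0)
  refine ⟨(2 * C₁ + C₂).toNNReal, fun Ω f D hΩ hsupp h hf hD ↦ ?_⟩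
  set R := ∫⁻ x in tsupport χ ∩ {x | 0 < x 0},
    ENNReal.ofReal (x 0) * (‖f x‖ₑ * (‖f x‖ₑ + ‖D x‖ₑ)) with hR
  have hpos : MeasurableSet {x : EuclideanSpace ℝ (Fin n) | 0 < x 0} :=
    (isOpen_lt continuous_const (by fun_prop)).measurableSet
  -- The weight `x₀` is replaced by `cutoffId k x₀`, which vanishes near the boundary, so `ψ` is an
  -- admissible test function. The constant does not depend on `k` because the cutoff weight is at
  -- most `x₀`.
  have key (k : ℕ) (hk : 0 < k) : ∫⁻ x in {x | 2 ≤ (k : ℝ) * x 0},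
      ENNReal.ofReal (χ x) * ‖f x‖ₑ ^ 2 ≤ (2 * C₁ + C₂).toNNReal * R := by
    have hk' : (0 : ℝ) < k := by exact_mod_cast hk
    set β : EuclideanSpace ℝ (Fin n) → ℝ := fun x ↦ cutoffId k (x 0) with hβ
    have hβd : ContDiff ℝ ∞ β := (contDiff_cutoffId k).comp
      ((EuclideanSpace.proj 0 : EuclideanSpace ℝ (Fin n) →L[ℝ] ℝ).contDiff)
    set ψ : EuclideanSpace ℝ (Fin n) → ℝ := fun x ↦ χ x * β x with hψ
    have hψd : ContDiff ℝ ∞ ψ := hχ.mul hβd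
    have hβs : tsupport β ⊆ {x | 1 ≤ (k : ℝ) * x 0} := by
      refine closure_minimal (fun x hx ↦ ?_) (isClosed_le continuous_const (by fun_prop))
      by_contra hlt
      exact hx (cutoffId_eq_zero (le_of_lt (not_le.1 hlt)))
    have hin : ∀ x ∈ tsupport χ ∩ tsupport β, x ∈ Ω := fun x hx ↦ by
      refine hsupp x hx.1 ?_
      have h1 : 1 ≤ (k : ℝ) * x 0 := hβs hx.2
      by_contra hle
      nlinarith [not_lt.1 hle]
    have hψs : tsupport ψ ⊆ Ω := fun x hx ↦
      hin x ⟨tsupport_mul_subset_left hx, tsupport_mul_subset_right hx⟩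
    have hψc : HasCompactSupport ψ := hχc.mul_right
    have hmain := integral_partialDeriv_mul_normSq hΩ h hf hD hψd hψc hψs
    set η : EuclideanSpace ℝ (Fin n) → ℝ := fun x ↦ partialDeriv 0 χ x * β x with hη
    set θ : EuclideanSpace ℝ (Fin n) → ℝ := fun x ↦ χ x * deriv (cutoffId k) (x 0) with hθ
    have hηcont : Continuous η := (continuous_partialDeriv hχ' 0).mul hβd.continuous
    have hηc : HasCompactSupport η := (hasCompactSupport_partialDeriv hχc 0).mul_right
    have hηs : tsupport η ⊆ Ω := fun x hx ↦ hin x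
      ⟨tsupport_partialDeriv_subset χ 0 (tsupport_mul_subset_left hx),
        tsupport_mul_subset_right hx⟩
    have hd : partialDeriv 0 ψ = fun x ↦ η x + θ x :=
      funext fun x ↦ partialDeriv_zero_mul_cutoffId hχ k x
    have hi1 : Integrable fun x ↦ partialDeriv 0 ψ x * ‖f x‖ ^ 2 :=
      integrable_smul_of_integrableOn_tsupport (hf.integrableOn_normSq
        ((tsupport_partialDeriv_subset ψ 0).trans hψs) (hasCompactSupport_partialDeriv hψc 0))
        (continuous_partialDeriv (contDiff_infty.1 hψd 1) 0) (hasCompactSupport_partialDeriv hψc 0)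
    have hi2 : Integrable fun x ↦ η x * ‖f x‖ ^ 2 :=
      integrable_smul_of_integrableOn_tsupport (hf.integrableOn_normSq hηs hηc) hηcont hηc
    have hi3 : Integrable fun x ↦ ψ x * (2 * (RCLike.re (f x) * RCLike.re (D x) +
        RCLike.im (f x) * RCLike.im (D x))) :=
      integrable_smul_of_integrableOn_tsupport (hf.integrableOn_re_mul hD hψs hψc)
        hψd.continuous hψc
    have hi4 : Integrable fun x ↦ θ x * ‖f x‖ ^ 2 := by
      refine (hi1.sub hi2).congr (Eventually.of_forall fun x ↦ ?_)
      simp only [Pi.sub_apply, hd]; ring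
    have hθ0 (x : EuclideanSpace ℝ (Fin n)) : χ x * Real.smoothTransition (k * x 0 - 1) ≤ θ x :=
      mul_le_mul_of_nonneg_left (smoothTransition_le_deriv_cutoffId hk') (hχ0 x)
    have hθ1 (x : EuclideanSpace ℝ (Fin n)) : 0 ≤ θ x :=
      (mul_nonneg (hχ0 x) (Real.smoothTransition.nonneg _)).trans (hθ0 x)
    -- Product rule `∂₀ ψ = η + θ`: `θ` carries the derivative of the weight and stays on the left,
    -- where it is nonnegative; `η` carries the derivative of `χ`.
    have heq : ∫ x, θ x * ‖f x‖ ^ 2 = - ∫ x, (η x * ‖f x‖ ^ 2 +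
        ψ x * (2 * (RCLike.re (f x) * RCLike.re (D x) + RCLike.im (f x) * RCLike.im (D x)))) := by
      rw [integral_add hi2 hi3]
      have h1 : ∫ x, partialDeriv 0 ψ x * ‖f x‖ ^ 2 =
          (∫ x, η x * ‖f x‖ ^ 2) + ∫ x, θ x * ‖f x‖ ^ 2 := by
        rw [← integral_add hi2 hi4]
        simp only [hd, add_mul]
      linarith
    have hpt (x : EuclideanSpace ℝ (Fin n)) : ‖η x * ‖f x‖ ^ 2 +
        ψ x * (2 * (RCLike.re (f x) * RCLike.re (D x) + RCLike.im (f x) * RCLike.im (D x)))‖ₑ ≤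
        (tsupport χ ∩ {x | 0 < x 0}).indicator (fun x ↦ ((2 * C₁ + C₂).toNNReal : ℝ≥0∞) *
          (ENNReal.ofReal (x 0) * (‖f x‖ₑ * (‖f x‖ₑ + ‖D x‖ₑ)))) x := by
      by_cases hx : x ∈ tsupport χ ∩ {x | 0 < x 0}
      · rw [indicator_of_mem hx]
        have hx0 : 0 < x 0 := hx.2
        have hb0 : 0 ≤ β x := cutoffId_nonneg hx0.le
        have hb1 : β x ≤ x 0 := cutoffId_le hx0.le
        have h1 : ‖η x * ‖f x‖ ^ 2 + ψ x * (2 * (RCLike.re (f x) * RCLike.re (D x) +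
            RCLike.im (f x) * RCLike.im (D x)))‖ ≤
            (2 * C₁ + C₂) * (x 0 * (‖f x‖ * (‖f x‖ + ‖D x‖))) := by
          have e1 : ‖η x * ‖f x‖ ^ 2‖ ≤ C₂ * x 0 * ‖f x‖ ^ 2 := by
            rw [norm_mul, hη, norm_mul, norm_pow, norm_norm, Real.norm_of_nonneg hb0]
            gcongr
            exact hC₂ x
          have e2 : ‖ψ x * (2 * (RCLike.re (f x) * RCLike.re (D x) +
              RCLike.im (f x) * RCLike.im (D x)))‖ ≤ C₁ * x 0 * (2 * (‖f x‖ * ‖D x‖)) := by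
            rw [norm_mul, hψ, norm_mul, norm_mul, Real.norm_of_nonneg hb0, Real.norm_ofNat]
            gcongr
            · exact hC₁ x
            · exact abs_re_mul_re_add_im_mul_im_le _ _
          refine (norm_add_le _ _).trans ((add_le_add e1 e2).trans ?_)
          have e3 : 0 ≤ C₁ * x 0 * ‖f x‖ ^ 2 := by positivity
          have e4 : 0 ≤ C₂ * x 0 * (‖f x‖ * ‖D x‖) := by positivity
          nlinarith
        rw [← ofReal_norm, ← ofReal_norm (f x), ← ofReal_norm (D x),
          ← ENNReal.ofReal_add (norm_nonneg _) (norm_nonneg _),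
          ← ENNReal.ofReal_mul (norm_nonneg _), ← ENNReal.ofReal_mul hx0.le,
          show (((2 * C₁ + C₂).toNNReal : ℝ≥0) : ℝ≥0∞) = ENNReal.ofReal (2 * C₁ + C₂) from rfl,
          ← ENNReal.ofReal_mul (by positivity)]
        exact ENNReal.ofReal_le_ofReal h1
      · rw [indicator_of_notMem hx]
        have : η x = 0 ∧ ψ x = 0 := by
          by_cases hx1 : x ∈ tsupport χ
          · have hx2 : x 0 ≤ 0 := not_lt.1 fun h ↦ hx ⟨hx1, h⟩
            have : β x = 0 := cutoffId_eq_zero (by nlinarith)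
            simp [hη, hψ, this]
          · have h1 : χ x = 0 := image_eq_zero_of_notMem_tsupport hx1
            have h2 : partialDeriv 0 χ x = 0 :=
              image_eq_zero_of_notMem_tsupport fun h ↦ hx1 (tsupport_partialDeriv_subset χ 0 h)
            simp [hη, hψ, h1, h2]
        simp [this.1, this.2]
    calc ∫⁻ x in {x | 2 ≤ (k : ℝ) * x 0}, ENNReal.ofReal (χ x) * ‖f x‖ₑ ^ 2
        ≤ ∫⁻ x in {x | 2 ≤ (k : ℝ) * x 0}, ENNReal.ofReal (θ x * ‖f x‖ ^ 2) := by
          refine setLIntegral_mono' (isClosed_le continuous_const (by fun_prop)).measurableSet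
            fun x hx ↦ ?_
          rw [← ofReal_norm, ← ENNReal.ofReal_pow (norm_nonneg _),
            ← ENNReal.ofReal_mul (hχ0 x)]
          apply ENNReal.ofReal_le_ofReal
          gcongr
          have h1 := hθ0 x
          rwa [Real.smoothTransition.one_of_one_le (by
            have : 2 ≤ (k : ℝ) * x 0 := hx
            linarith), mul_one] at h1
      _ ≤ ∫⁻ x, ENNReal.ofReal (θ x * ‖f x‖ ^ 2) := setLIntegral_le_lintegral _ _
      _ = ENNReal.ofReal (∫ x, θ x * ‖f x‖ ^ 2) :=
          (ofReal_integral_eq_lintegral_ofReal hi4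
            (Eventually.of_forall fun x ↦ mul_nonneg (hθ1 x) (by positivity))).symm
      _ ≤ ‖∫ x, θ x * ‖f x‖ ^ 2‖ₑ := Real.ofReal_le_enorm _
      _ ≤ ∫⁻ x, ‖η x * ‖f x‖ ^ 2 + ψ x * (2 * (RCLike.re (f x) * RCLike.re (D x) +
            RCLike.im (f x) * RCLike.im (D x)))‖ₑ := by
          rw [heq, enorm_neg]; exact enorm_integral_le_lintegral_enorm _
      _ ≤ _ := lintegral_mono hpt
      _ = _ := by
          rw [lintegral_indicator ((isClosed_tsupport χ).measurableSet.inter hpos),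
            lintegral_const_mul' _ _ ENNReal.coe_ne_top]
  -- Exhaust the open half-space by the sets on which the derivative of the weight is at least `1`,
  -- and use monotone convergence.
  have hU : {x : EuclideanSpace ℝ (Fin n) | 0 < x 0} =
      ⋃ k : ℕ, {x | 2 ≤ ((k + 1 : ℕ) : ℝ) * x 0} := by
    ext x
    simp only [mem_ofPred_eq, mem_iUnion]
    constructor
    · intro hx
      obtain ⟨k, hk⟩ := exists_nat_gt (2 / x 0)
      refine ⟨k, ?_⟩
      rw [div_lt_iff₀ hx] at hk
      push_cast; nlinarith
    · rintro ⟨k, hk⟩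
      by_contra hle
      push_cast at hk
      nlinarith [not_lt.1 hle, (Nat.cast_nonneg k : (0 : ℝ) ≤ k)]
  have hmono : Monotone fun k : ℕ ↦ {x : EuclideanSpace ℝ (Fin n) | 2 ≤ ((k + 1 : ℕ) : ℝ) * x 0} := by
    intro k l hkl x hx
    have h1 : 2 ≤ ((k + 1 : ℕ) : ℝ) * x 0 := hx
    have h2 : ((k + 1 : ℕ) : ℝ) ≤ ((l + 1 : ℕ) : ℝ) := by exact_mod_cast Nat.succ_le_succ hkl
    have h3 : 0 ≤ x 0 := by
      by_contra hlt
      have : (0 : ℝ) ≤ ((k + 1 : ℕ) : ℝ) := Nat.cast_nonneg _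
      nlinarith [not_le.1 hlt]
    exact h1.trans (mul_le_mul_of_nonneg_right h2 h3)
  rw [hU, setLIntegral_iUnion_of_directed _ hmono.directed_le]
  exact iSup_le fun k ↦ key (k + 1) k.succ_pos

end HalfSpaceEstimate

/-! ### Charts of the manifold with boundary, coordinate vectors and the Gram matrix. -/

section Charts

variable {n : ℕ} [NeZero n] {M : Type*} [MetricSpace M] [ChartedSpace (EuclideanHalfSpace n) M]

lemma extChartAt_target_eq (a : M) : (extChartAt (𝓡∂ n) a).target =
    (𝓡∂ n).symm ⁻¹' (chartAt (EuclideanHalfSpace n) a).target ∩ {y | 0 ≤ y 0} := by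
  rw [extChartAt_target, range_modelWithCornersEuclideanHalfSpace]

lemma isOpen_symm_preimage_target (a : M) :
    IsOpen ((𝓡∂ n).symm ⁻¹' (chartAt (EuclideanHalfSpace n) a).target) :=
  (chartAt (EuclideanHalfSpace n) a).open_target.preimage (𝓡∂ n).continuous_symm

lemma interior_halfSpace_eq : interior {y : EuclideanSpace ℝ (Fin n) | 0 ≤ y 0} = {y | 0 < y 0} := by
  rw [← range_modelWithCornersEuclideanHalfSpace, interior_range_modelWithCornersEuclideanHalfSpace]

lemma chartDomain_eq (a : M) : chartDomain (n := n) a =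
    (𝓡∂ n).symm ⁻¹' (chartAt (EuclideanHalfSpace n) a).target ∩ {y | 0 < y 0} := by
  rw [chartDomain, extChartAt_target_eq, interior_inter, (isOpen_symm_preimage_target a).interior_eq,
    interior_halfSpace_eq]

lemma mem_chartDomain_iff {a : M} {y : EuclideanSpace ℝ (Fin n)} :
    y ∈ chartDomain a ↔ y ∈ (extChartAt (𝓡∂ n) a).target ∧ 0 < y 0 := by
  rw [chartDomain_eq, extChartAt_target_eq]
  constructor
  · rintro ⟨h1, h2⟩; exact ⟨⟨h1, le_of_lt (α := ℝ) h2⟩, h2⟩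
  · rintro ⟨⟨h1, _⟩, h2⟩; exact ⟨h1, h2⟩

lemma isOpen_chartDomain (a : M) : IsOpen (chartDomain (n := n) a) := isOpen_interior

lemma chartDomain_subset (a : M) : chartDomain (n := n) a ⊆ (extChartAt (𝓡∂ n) a).target :=
  interior_subset

lemma nonneg_of_mem_target {a : M} {y : EuclideanSpace ℝ (Fin n)}
    (hy : y ∈ (extChartAt (𝓡∂ n) a).target) : 0 ≤ y 0 := by
  rw [extChartAt_target_eq] at hy; exact hy.2

lemma extChartAt_apply_zero_nonneg (a p : M) : 0 ≤ extChartAt (𝓡∂ n) a p 0 := by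
  have : extChartAt (𝓡∂ n) a p ∈ range (𝓡∂ n) := ⟨_, rfl⟩
  rwa [range_modelWithCornersEuclideanHalfSpace] at this

lemma measurableSet_extChartAt_target (a : M) : MeasurableSet (extChartAt (𝓡∂ n) a).target := by
  rw [extChartAt_target_eq]
  refine (isOpen_symm_preimage_target a).measurableSet.inter (IsClosed.measurableSet ?_)
  exact isClosed_le continuous_const (by fun_prop)

lemma uniqueDiffWithinAt_target {a : M} {y : EuclideanSpace ℝ (Fin n)}
    (hy : y ∈ (extChartAt (𝓡∂ n) a).target) : UniqueDiffWithinAt ℝ (range (𝓡∂ n)) y :=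
  (𝓡∂ n).uniqueDiffOn y (extChartAt_target_subset_range a hy)

lemma range_mem_nhds {y : EuclideanSpace ℝ (Fin n)} (hy : 0 < y 0) : range (𝓡∂ n) ∈ nhds y := by
  rw [← mem_interior_iff_mem_nhds, interior_range_modelWithCornersEuclideanHalfSpace]
  exact hy

lemma coordDeriv_eq_partialDeriv {y : EuclideanSpace ℝ (Fin n)} (hy : 0 < y 0) (i : Fin n)
    (F : EuclideanSpace ℝ (Fin n) → ℝ) : coordDeriv i F y = partialDeriv i F y := by
  rw [coordDeriv, partialDeriv, fderivWithin_of_mem_nhds (range_mem_nhds hy)]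

/-- One-sided derivatives are taken within the whole half-space, while smoothness is known on the
chart target. This identifies the two near points of the target, boundary points included. -/
lemma target_eventuallyEq_range {a : M} {y : EuclideanSpace ℝ (Fin n)}
    (hy : y ∈ (extChartAt (𝓡∂ n) a).target) :
    (extChartAt (𝓡∂ n) a).target =ᶠ[nhds y] range (𝓡∂ n) := by
  rw [extChartAt_target] at hy ⊢
  filter_upwards [(isOpen_symm_preimage_target a).mem_nhds hy.1] with z hz
  exact propext ⟨fun h ↦ h.2, fun h ↦ ⟨hz, h⟩⟩

lemma contDiffOn_coordDeriv {a : M} {F : EuclideanSpace ℝ (Fin n) → ℝ} {m k : ℕ∞}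
    (hF : ContDiffOn ℝ k F (extChartAt (𝓡∂ n) a).target) (hk : m + 1 ≤ k) (i : Fin n) :
    ContDiffOn ℝ m (coordDeriv i F) (extChartAt (𝓡∂ n) a).target := by
  have h := hF.fderivWithin (uniqueDiffOn_extChartAt_target a) (m := m) (by exact_mod_cast hk)
  refine (h.clm_apply (contDiffOn_const (c := stdVec i))).congr fun y hy ↦ ?_
  rw [coordDeriv, fderivWithin_congr_set (target_eventuallyEq_range hy)]

/-- The coordinate vector `∂ᵢ`, as a vector of the model space. -/
def coordVector (a : M) (y : EuclideanSpace ℝ (Fin n)) (i : Fin n) : EuclideanSpace ℝ (Fin n) :=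
  coordVec a y i

section MetricForm

variable [RiemannianBundle (fun x : M ↦ TangentSpace (𝓡∂ n) x)]

/-- The metric at `p`, as a function on pairs of vectors of the model space. -/
def metricForm (p : M) (v w : EuclideanSpace ℝ (Fin n)) : ℝ :=
  @inner ℝ (TangentSpace (𝓡∂ n) p) _ v w

lemma gram_apply (a : M) (y : EuclideanSpace ℝ (Fin n)) (i j : Fin n) :
    gram a y i j = metricForm (chartInv a y) (coordVector a y i) (coordVector a y j) := rfl

lemma metricForm_sum_sum (p : M) (c d : Fin n → ℝ) (v w : Fin n → EuclideanSpace ℝ (Fin n)) :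
    metricForm p (∑ k, c k • v k) (∑ l, d l • w l) =
      ∑ k, ∑ l, c k * metricForm p (v k) (w l) * d l := by
  have h := sum_inner (𝕜 := ℝ) (E := TangentSpace (𝓡∂ n) p) Finset.univ (fun k ↦ c k • v k)
    (∑ l, d l • w l)
  refine h.trans (Finset.sum_congr rfl fun k _ ↦ ?_)
  have h := inner_sum (𝕜 := ℝ) (E := TangentSpace (𝓡∂ n) p) Finset.univ (fun k ↦ d k • w k)
    (c k • v k)
  refine h.trans (Finset.sum_congr rfl fun l _ ↦ ?_)
  have h1 : metricForm p (c k • v k) (d l • w l) = c k * metricForm p (v k) (d l • w l) :=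
    real_inner_smul_left (F := TangentSpace (𝓡∂ n) p) (v k) (d l • w l) (c k)
  have h2 : metricForm p (v k) (d l • w l) = d l * metricForm p (v k) (w l) :=
    real_inner_smul_right (F := TangentSpace (𝓡∂ n) p) (v k) (w l) (d l)
  refine h1.trans ?_
  rw [h2]; ring

end MetricForm

variable [IsManifold (𝓡∂ n) ∞ M]

/-- Being an interior point can be tested in any chart containing the point, by smoothness of the
coordinate changes; in the half-space model it is the sign of `x₀`. -/
lemma interior_iff (a : M) {p : M} (hp : p ∈ (extChartAt (𝓡∂ n) a).source) :
    p ∈ (𝓡∂ n).interior M ↔ 0 < extChartAt (𝓡∂ n) a p 0 := by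
  have hp' : p ∈ (chartAt (EuclideanHalfSpace n) a).source := by rwa [← extChartAt_source (𝓡∂ n)]
  have := ModelWithCorners.isInteriorPoint_iff_of_mem_atlas (I := 𝓡∂ n) (n := (∞ : WithTop ℕ∞))
    (by simp) (chart_mem_atlas (EuclideanHalfSpace n) a) hp'
  have h2 := mem_chartDomain_iff (a := a) (y := extChartAt (𝓡∂ n) a p)
  rw [ModelWithCorners.interior, mem_ofPred_eq, this]
  exact h2.trans (and_iff_right ((extChartAt (𝓡∂ n) a).map_source hp))

lemma mem_boundary_iff (a : M) {p : M} (hp : p ∈ (extChartAt (𝓡∂ n) a).source) :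
    p ∈ (𝓡∂ n).boundary M ↔ extChartAt (𝓡∂ n) a p 0 = 0 := by
  rw [← ModelWithCorners.compl_interior, mem_compl_iff, interior_iff a hp, not_lt]
  exact ⟨fun h ↦ le_antisymm h (extChartAt_apply_zero_nonneg a p), fun h ↦ h.le⟩


/-- Chain rule for `chartInv a ∘ τ = chartInv b`, which holds near `y` within the half-space.
Derivatives are one-sided so that boundary points are allowed. -/
lemma coordVec_change (a b : M) {y : EuclideanSpace ℝ (Fin n)}
    (hy : y ∈ (extChartAt (𝓡∂ n) b).target) (hya : chartInv b y ∈ (extChartAt (𝓡∂ n) a).source)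
    (i : Fin n) :
    coordVector b y i =
      ∑ k, jacobian (fderivWithin ℝ (extChartAt (𝓡∂ n) a ∘ chartInv b) (range (𝓡∂ n)) y) k i •
        coordVector a (extChartAt (𝓡∂ n) a (chartInv b y)) k := by
  have : IsManifold (𝓡∂ n) 1 M := IsManifold.of_le (n := ∞) (by exact_mod_cast le_top)
  set τ := extChartAt (𝓡∂ n) a ∘ chartInv (n := n) b
  have hτ : DifferentiableWithinAt ℝ τ (range (𝓡∂ n)) y :=
    (contDiffWithinAt_ext_coord_change (n := 1) a b (y := y) (by
      rw [PartialEquiv.trans_source]; exact ⟨hy, hya⟩)).differentiableWithinAt (by simp)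
  have hτy : τ y ∈ (extChartAt (𝓡∂ n) a).target := (extChartAt (𝓡∂ n) a).map_source hya
  have hcomp := mfderivWithin_comp (I := 𝓘(ℝ, EuclideanSpace ℝ (Fin n)))
    (I' := 𝓘(ℝ, EuclideanSpace ℝ (Fin n))) (I'' := 𝓡∂ n) (f := τ) y
    (s := range (𝓡∂ n)) (u := range (𝓡∂ n)) (g := chartInv a)
    (mdifferentiableWithinAt_extChartAt_symm hτy) hτ.mdifferentiableWithinAt
    (fun z _ ↦ ⟨chartAt (EuclideanHalfSpace n) a (chartInv b z), rfl⟩) (uniqueDiffWithinAt_target hy).uniqueMDiffWithinAt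
  have hev : chartInv a ∘ τ =ᶠ[nhdsWithin y (range (𝓡∂ n))] chartInv b := by
    have hc : ContinuousWithinAt (chartInv b) (range (𝓡∂ n)) y :=
      (mdifferentiableWithinAt_extChartAt_symm hy).continuousWithinAt
    filter_upwards [hc.preimage_mem_nhdsWithin ((isOpen_extChartAt_source a).mem_nhds hya)]
      with z hz
    exact (extChartAt (𝓡∂ n) a).left_inv hz
  rw [hev.mfderivWithin_eq ((extChartAt (𝓡∂ n) a).left_inv hya)] at hcomp
  have h2 := DFunLike.congr_fun hcomp (stdVec i)
  refine Eq.trans h2 ?_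
  rw [mfderivWithin_eq_fderivWithin]
  refine (congrArg (mfderivWithin 𝓘(ℝ, EuclideanSpace ℝ (Fin n)) (𝓡∂ n) (chartInv (n := n) a)
    (range (𝓡∂ n)) (τ y)) (sum_smul_stdVec (fderivWithin ℝ τ (range (𝓡∂ n)) y (stdVec i)))).symm.trans ?_
  refine (map_sum _ _ _).trans (Finset.sum_congr rfl fun k _ ↦ ?_)
  exact map_smul _ _ _

lemma linearIndependent_coordVec {a : M} {y : EuclideanSpace ℝ (Fin n)}
    (hy : y ∈ (extChartAt (𝓡∂ n) a).target) : LinearIndependent ℝ (coordVec a y) := by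
  have : IsManifold (𝓡∂ n) 1 M := IsManifold.of_le (n := ∞) (by exact_mod_cast le_top)
  obtain ⟨e, he⟩ := isInvertible_mfderivWithin_extChartAt_symm hy
  have h1 : LinearIndependent ℝ (stdVec : Fin n → EuclideanSpace ℝ (Fin n)) := by
    have := (EuclideanSpace.basisFun (Fin n) ℝ).toBasis.linearIndependent
    rwa [show ⇑(EuclideanSpace.basisFun (Fin n) ℝ).toBasis = stdVec by
      funext i; ext j; simp [stdVec]] at this
  have := h1.map' e.toLinearEquiv.toLinearMap e.toLinearEquiv.ker
  have h2 : coordVec a y = e.toLinearEquiv.toLinearMap ∘ stdVec := by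
    funext i
    rw [coordVec, ← he]
    rfl
  rw [h2]; exact this

variable [RiemannianBundle (fun x : M ↦ TangentSpace (𝓡∂ n) x)]

lemma posDef_gram {a : M} {y : EuclideanSpace ℝ (Fin n)}
    (hy : y ∈ (extChartAt (𝓡∂ n) a).target) : (gram a y).PosDef :=
  Matrix.posDef_gram_iff_linearIndependent.2 (linearIndependent_coordVec hy)

lemma gram_change (a b : M) {y : EuclideanSpace ℝ (Fin n)}
    (hy : y ∈ (extChartAt (𝓡∂ n) b).target) (hya : chartInv b y ∈ (extChartAt (𝓡∂ n) a).source) :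
    gram b y =
      (jacobian (fderivWithin ℝ (extChartAt (𝓡∂ n) a ∘ chartInv b) (range (𝓡∂ n)) y)).transpose *
        gram a (extChartAt (𝓡∂ n) a (chartInv b y)) *
        jacobian (fderivWithin ℝ (extChartAt (𝓡∂ n) a ∘ chartInv b) (range (𝓡∂ n)) y) := by
  ext i j
  rw [gram_apply, coordVec_change a b hy hya, coordVec_change a b hy hya, metricForm_sum_sum,
    Matrix.mul_apply, Finset.sum_comm]
  refine Finset.sum_congr rfl fun l _ ↦ ?_
  rw [Matrix.mul_apply, Finset.sum_mul]
  refine Finset.sum_congr rfl fun k _ ↦ ?_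
  have h : chartInv a (extChartAt (𝓡∂ n) a (chartInv b y)) = chartInv b y :=
    (extChartAt (𝓡∂ n) a).left_inv hya
  rw [gram_apply, h, Matrix.transpose_apply]

variable [IsContMDiffRiemannianBundle (𝓡∂ n) ∞ (EuclideanSpace ℝ (Fin n))
      (fun x : M ↦ TangentSpace (𝓡∂ n) x)]

lemma contDiffOn_gram (a : M) (i j : Fin n) :
    ContDiffOn ℝ ∞ (fun y ↦ gram a y i j) (extChartAt (𝓡∂ n) a).target := by
  rw [← contMDiffOn_iff_contDiffOn]
  -- The coordinate field is the tangent map of the inverse chart applied to a constant field, hence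
  -- smooth.
  have key : ∀ i, ContMDiffOn 𝓘(ℝ, EuclideanSpace ℝ (Fin n)) (𝓡∂ n).tangent ∞
      (fun y ↦ (⟨chartInv a y, coordVec a y i⟩ : TangentBundle (𝓡∂ n) M))
      (extChartAt (𝓡∂ n) a).target := by
    intro i
    have h1 := (contMDiffOn_extChartAt_symm (n := ∞) (I := 𝓡∂ n) a).contMDiffOn_tangentMapWithin
      (m := ∞) le_rfl (uniqueDiffOn_extChartAt_target a).uniqueMDiffOn
    have h2 : ContMDiffOn 𝓘(ℝ, EuclideanSpace ℝ (Fin n)) 𝓘(ℝ, EuclideanSpace ℝ (Fin n)).tangent ∞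
      (fun y ↦ (⟨y, stdVec i⟩ : TangentBundle 𝓘(ℝ, EuclideanSpace ℝ (Fin n))
        (EuclideanSpace ℝ (Fin n)))) (extChartAt (𝓡∂ n) a).target :=
      contMDiffOn_vectorSpace_iff_contDiffOn.2 contDiffOn_const
    refine (h1.comp h2 fun y hy ↦ hy).congr fun y hy ↦ ?_
    simp only [Function.comp, tangentMapWithin, coordVec]
    rw [mfderivWithin_congr_set (target_eventuallyEq_range hy)]
  exact (key i).inner_bundle (key j)

end Charts

/-! ### The Laplace–Beltrami operator in a fixed chart. -/

section LaplaceBeltrami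

variable {n : ℕ} [NeZero n] {M : Type*} [MetricSpace M] [ChartedSpace (EuclideanHalfSpace n) M]

/-- The points of `chartDomain b` that also lie in the chart centred at `a`. -/
def overlap (a b : M) : Set (EuclideanSpace ℝ (Fin n)) :=
  chartDomain b ∩ chartInv b ⁻¹' (extChartAt (𝓡∂ n) a).source

lemma isOpen_overlap (a b : M) : IsOpen (overlap (n := n) a b) :=
  ((continuousOn_extChartAt_symm b).mono (chartDomain_subset b)).isOpen_inter_preimage
    (isOpen_chartDomain b) (isOpen_extChartAt_source a)

/-- The change of coordinates from the chart centred at `b` to the chart centred at `a`. -/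
def coordChange (a b : M) : EuclideanSpace ℝ (Fin n) → EuclideanSpace ℝ (Fin n) :=
  extChartAt (𝓡∂ n) a ∘ chartInv b

lemma chartInv_coordChange {a b : M} {y : EuclideanSpace ℝ (Fin n)}
    (hy : chartInv b y ∈ (extChartAt (𝓡∂ n) a).source) :
    chartInv a (coordChange a b y) = chartInv b y :=
  (extChartAt (𝓡∂ n) a).left_inv hy

lemma coordChange_coordChange (a b : M) {y : EuclideanSpace ℝ (Fin n)} (hy : y ∈ overlap a b) :
    coordChange b a (coordChange a b y) = y := by
  have h := chartInv_coordChange hy.2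
  rw [coordChange, Function.comp, h]
  exact (extChartAt (𝓡∂ n) b).right_inv (chartDomain_subset b hy.1)

variable [IsManifold (𝓡∂ n) ∞ M]

lemma contDiffOn_comp_chartInv {u : M → ℝ} {k : ℕ∞} (hu : ContMDiff (𝓡∂ n) 𝓘(ℝ, ℝ) k u) (a : M) :
    ContDiffOn ℝ k (fun y ↦ u (chartInv a y)) (extChartAt (𝓡∂ n) a).target := by
  have : IsManifold (𝓡∂ n) k M := IsManifold.of_le (n := ∞) (by exact_mod_cast le_top)
  rw [← contMDiffOn_iff_contDiffOn]
  exact hu.comp_contMDiffOn (contMDiffOn_extChartAt_symm a)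

lemma chartInv_mem_interior {a : M} {y : EuclideanSpace ℝ (Fin n)} (hy : y ∈ chartDomain a) :
    chartInv a y ∈ (𝓡∂ n).interior M := by
  rw [mem_chartDomain_iff] at hy
  rw [interior_iff a ((extChartAt (𝓡∂ n) a).map_target hy.1), (extChartAt (𝓡∂ n) a).right_inv hy.1]
  exact hy.2

lemma extChartAt_mem_chartDomain {a p : M} (hp : p ∈ (extChartAt (𝓡∂ n) a).source)
    (hi : p ∈ (𝓡∂ n).interior M) : extChartAt (𝓡∂ n) a p ∈ chartDomain a :=
  mem_chartDomain_iff.2 ⟨(extChartAt (𝓡∂ n) a).map_source hp, (interior_iff a hp).1 hi⟩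

lemma mapsTo_coordChange (a b : M) : MapsTo (coordChange (n := n) a b) (overlap a b) (overlap b a) := by
  rintro y ⟨hy, hya⟩
  refine ⟨extChartAt_mem_chartDomain hya (chartInv_mem_interior hy), ?_⟩
  rw [mem_preimage, chartInv_coordChange hya]
  exact (extChartAt (𝓡∂ n) b).map_target (chartDomain_subset b hy)

lemma contDiffOn_coordChange (a b : M) : ContDiffOn ℝ ∞ (coordChange (n := n) a b) (overlap a b) :=
  (contDiffOn_ext_coord_change a b).mono fun y hy ↦ by
    rw [PartialEquiv.trans_source]; exact ⟨chartDomain_subset b hy.1, hy.2⟩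

variable [RiemannianBundle (fun x : M ↦ TangentSpace (𝓡∂ n) x)]

lemma volDensity_pos {a : M} {y : EuclideanSpace ℝ (Fin n)}
    (hy : y ∈ (extChartAt (𝓡∂ n) a).target) : 0 < volDensity a y :=
  Real.sqrt_pos.2 (posDef_gram hy).det_pos

variable  [IsContMDiffRiemannianBundle (𝓡∂ n) ∞ (EuclideanSpace ℝ (Fin n))
      (fun x : M ↦ TangentSpace (𝓡∂ n) x)]

lemma divOp_gram_coordChange {u : M → ℝ} (hu : ContMDiff (𝓡∂ n) 𝓘(ℝ, ℝ) 2 u) (a b : M)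
    {y : EuclideanSpace ℝ (Fin n)} (hy : y ∈ overlap a b) :
    divOp (gram b) (fun z ↦ u (chartInv b z)) y =
      divOp (gram a) (fun z ↦ u (chartInv a z)) (coordChange a b y) := by
  have hsub (a b : M) : overlap a b ⊆ (extChartAt (𝓡∂ n) b).target :=
    inter_subset_left.trans (chartDomain_subset b)
  refine divOp_comp (isOpen_overlap a b) (isOpen_overlap b a)
    ((contDiffOn_coordChange a b).of_le (WithTop.coe_le_coe.2 (le_top (a := (2 : ℕ∞)))))
    (contDiffOn_coordChange b a).continuousOn (mapsTo_coordChange a b) (mapsTo_coordChange b a)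
    (fun y hy ↦ coordChange_coordChange a b hy) (fun y hy ↦ coordChange_coordChange b a hy)
    (fun i j ↦ ((contDiffOn_gram b i j).mono (hsub a b)).of_le (by exact_mod_cast le_top))
    (fun i j ↦ ((contDiffOn_gram a i j).mono (hsub b a)).of_le (by exact_mod_cast le_top))
    (fun x hx ↦ posDef_gram (hsub a b hx)) (fun x hx ↦ posDef_gram (hsub b a hx)) ?_
    ((contDiffOn_comp_chartInv hu a).mono (hsub b a)) (fun x hx ↦ ?_) y hy
  · intro x hx
    rw [gram_change a b (hsub a b hx) hx.2, fderivWithin_of_mem_nhds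
      (range_mem_nhds (mem_chartDomain_iff.1 hx.1).2)]
    rfl
  · rw [chartInv_coordChange hx.2]

/-- The definition uses a different chart at every point. Invariance of the divergence form
expresses all values in the single chart at `a`, as differential inequalities on open sets require.
-/
lemma laplaceBeltrami_eq_divOp {u : M → ℝ} (hu : ContMDiff (𝓡∂ n) 𝓘(ℝ, ℝ) 2 u) (a : M)
    {y : EuclideanSpace ℝ (Fin n)} (hy : y ∈ chartDomain a) :
    laplaceBeltrami (n := n) u (chartInv a y) = divOp (gram a) (fun z ↦ u (chartInv a z)) y := by
  set p := chartInv a y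
  have hp : p ∈ (𝓡∂ n).interior M := chartInv_mem_interior hy
  have hpp : p ∈ (extChartAt (𝓡∂ n) p).source := mem_extChartAt_source p
  rw [divOp_gram_coordChange hu p a ⟨hy, hpp⟩]
  have hz : extChartAt (𝓡∂ n) p p ∈ chartDomain p := extChartAt_mem_chartDomain hpp hp
  change laplaceBeltrami (n := n) u p = divOp (gram p) (fun z ↦ u (chartInv p z))
    (extChartAt (𝓡∂ n) p p)
  unfold laplaceBeltrami divOp
  congr 1
  refine Finset.sum_congr rfl fun i _ ↦ ?_
  rw [coordDeriv_eq_partialDeriv (mem_chartDomain_iff.1 hz).2]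
  refine partialDeriv_congr ?_
  filter_upwards [(isOpen_chartDomain p).mem_nhds hz] with x hx
  simp_rw [coordDeriv_eq_partialDeriv (mem_chartDomain_iff.1 hx).2]
  rfl

/-- The first-order coefficients of the Laplace–Beltrami operator in the chart centred at `a`. -/
def laplaceDrift (a : M) (y : EuclideanSpace ℝ (Fin n)) (j : Fin n) : ℝ :=
  (volDensity a y)⁻¹ * ∑ i, coordDeriv i (fun z ↦ volDensity a z * (gram a z)⁻¹ i j) y

lemma laplaceBeltrami_eq_nondivOp {u : M → ℝ} (hu : ContMDiff (𝓡∂ n) 𝓘(ℝ, ℝ) 2 u) (a : M)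
    {y : EuclideanSpace ℝ (Fin n)} (hy : y ∈ chartDomain a) :
    laplaceBeltrami (n := n) u (chartInv a y) =
      nondivOp (fun y ↦ (gram a y)⁻¹) (laplaceDrift a) (fun z ↦ u (chartInv a z)) y := by
  rw [laplaceBeltrami_eq_divOp hu a hy, divOp_eq_nondivOp (isOpen_chartDomain a)
    (fun i j ↦ ((contDiffOn_gram a i j).mono (chartDomain_subset a)).of_le (by exact_mod_cast le_top))
    (fun x hx ↦ posDef_gram (chartDomain_subset a hx))
    ((contDiffOn_comp_chartInv hu a).mono (chartDomain_subset a)) hy]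
  unfold nondivOp laplaceDrift
  simp_rw [coordDeriv_eq_partialDeriv (mem_chartDomain_iff.1 hy).2]
  rfl

lemma contDiffOn_gram_inv (a : M) (i j : Fin n) :
    ContDiffOn ℝ (⊤ : ℕ∞) (fun y ↦ (gram a y)⁻¹ i j) (extChartAt (𝓡∂ n) a).target :=
  contDiffOn_matrix_inv (contDiffOn_gram a) (fun _ hx ↦ (posDef_gram hx).det_pos.ne') i j

lemma contDiffOn_volDensity (a : M) :
    ContDiffOn ℝ (⊤ : ℕ∞) (volDensity a) (extChartAt (𝓡∂ n) a).target :=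
  contDiffOn_sqrt_det (contDiffOn_gram a) (fun _ hx ↦ posDef_gram hx)

/-- Continuity holds up to the boundary of the half-space, thanks to one-sided derivatives. This
makes the coefficient bounds uniform in the balls of Hopf's lemma that touch the boundary. -/
lemma continuousOn_laplaceDrift (a : M) (j : Fin n) :
    ContinuousOn (fun y ↦ laplaceDrift a y j) (extChartAt (𝓡∂ n) a).target := by
  refine ((contDiffOn_volDensity a).continuousOn.inv₀ fun y hy ↦ (volDensity_pos hy).ne').mul ?_
  refine continuousOn_finsetSum _ fun i _ ↦ ?_
  exact (contDiffOn_coordDeriv (m := 0) (((contDiffOn_volDensity a).mul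
    (contDiffOn_gram_inv a i j))) le_top i).continuousOn

/-- The ellipticity constant is the minimum of the quadratic form over `K` times the unit sphere,
extended to all vectors by homogeneity. The other bounds are maxima of continuous functions on `K`.
-/
lemma exists_ellipticBounds (a : M) {k : EuclideanSpace ℝ (Fin n) → ℝ}
    {K : Set (EuclideanSpace ℝ (Fin n))} (hK : IsCompact K)
    (hKT : K ⊆ (extChartAt (𝓡∂ n) a).target) (hk : ContinuousOn k K) (hk0 : ∀ y ∈ K, 0 ≤ k y) :
    ∃ lam > 0, ∃ Lam, ∃ bet ≥ 0, ∃ kap,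
      EllipticBounds (fun y ↦ (gram a y)⁻¹) (laplaceDrift a) k K lam Lam bet kap := by
  have hcA (i j : Fin n) : ContinuousOn (fun y ↦ (gram a y)⁻¹ i j) K :=
    (contDiffOn_gram_inv a i j).continuousOn.mono hKT
  have hpos : ∀ y ∈ K, ((gram a y)⁻¹).PosDef := fun y hy ↦ (posDef_gram (hKT hy)).inv
  obtain ⟨lam, hlam, h1⟩ : ∃ lam > 0, ∀ x ∈ K, ∀ ξ : EuclideanSpace ℝ (Fin n),
      lam * ‖ξ‖ ^ 2 ≤ ∑ i, ∑ j, (gram a x)⁻¹ i j * (ξ i * ξ j) := by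
    set Q : EuclideanSpace ℝ (Fin n) × EuclideanSpace ℝ (Fin n) → ℝ :=
      fun z ↦ ∑ i, ∑ j, (gram a z.1)⁻¹ i j * (z.2 i * z.2 j)
    have hQc : ContinuousOn Q (K ×ˢ Metric.sphere 0 1) := by
      refine continuousOn_finsetSum _ fun i _ ↦ continuousOn_finsetSum _ fun j _ ↦ ?_
      refine ((hcA i j).comp continuousOn_fst fun z hz ↦ hz.1).mul (Continuous.continuousOn ?_)
      fun_prop
    have hQpos : ∀ z ∈ K ×ˢ Metric.sphere (0 : EuclideanSpace ℝ (Fin n)) 1, 0 < Q z := by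
      rintro ⟨x, ξ⟩ ⟨hx, hξ⟩
      have hξ0 : (fun i ↦ ξ i) ≠ 0 := by
        rintro h
        have : ξ = 0 := by ext i; exact congrFun h i
        simp [this] at hξ
      have := (hpos x hx).dotProduct_mulVec_pos hξ0
      refine this.trans_eq ?_
      simp only [dotProduct, Matrix.mulVec, Q, Finset.mul_sum, star_trivial, Pi.star_apply]
      refine Finset.sum_congr rfl fun i _ ↦ Finset.sum_congr rfl fun j _ ↦ by ring
    rcases (K ×ˢ Metric.sphere (0 : EuclideanSpace ℝ (Fin n)) 1).eq_empty_or_nonempty with he | hne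
    · refine ⟨1, one_pos, fun x hx ↦ ?_⟩
      have : stdVec (0 : Fin n) ∈ Metric.sphere (0 : EuclideanSpace ℝ (Fin n)) 1 := by simp [stdVec]
      exact (eq_empty_iff_forall_notMem.1 he (x, stdVec 0) (mk_mem_prod hx this)).elim
    obtain ⟨z, hz, hmin⟩ := (hK.prod (isCompact_sphere _ _)).exists_isMinOn hne hQc
    refine ⟨Q z, hQpos z hz, fun x hx ξ ↦ ?_⟩
    rcases eq_or_ne ξ 0 with rfl | hξ
    · simp
    have hn : ‖ξ‖ ≠ 0 := norm_ne_zero_iff.2 hξ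
    have := hmin (a := (x, ‖ξ‖⁻¹ • ξ)) (mk_mem_prod hx (by simp [norm_smul, hn]))
    have e : Q (x, ‖ξ‖⁻¹ • ξ) = (‖ξ‖ ^ 2)⁻¹ * ∑ i, ∑ j, (gram a x)⁻¹ i j * (ξ i * ξ j) := by
      simp only [Q, Finset.mul_sum, PiLp.smul_apply, smul_eq_mul]
      refine Finset.sum_congr rfl fun i _ ↦ Finset.sum_congr rfl fun j _ ↦ by
        ring
    rw [mem_ofPred_eq, e, le_inv_mul_iff₀ (by positivity)] at this
    linarith
  have hbd : ∀ F : EuclideanSpace ℝ (Fin n) → ℝ, ContinuousOn F K → ∃ C, 0 ≤ C ∧ ∀ x ∈ K, F x ≤ C := by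
    intro F hF
    obtain ⟨C, hC⟩ := hK.exists_bound_of_continuousOn hF
    exact ⟨max C 0, le_max_right _ _, fun x hx ↦ (le_abs_self _).trans ((hC x hx).trans (le_max_left _ _))⟩
  obtain ⟨Lam, -, h2⟩ := hbd (fun x ↦ ((gram a x)⁻¹).trace)
    (continuousOn_finsetSum _ fun i _ ↦ hcA i i)
  obtain ⟨bet, hb0, h3⟩ := hbd (fun x ↦ ∑ j, |laplaceDrift a x j|)
    (continuousOn_finsetSum _ fun j _ ↦ ((continuousOn_laplaceDrift a j).mono hKT).abs)
  obtain ⟨kap, -, h4⟩ := hbd k hk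
  refine ⟨lam, hlam, Lam, bet, hb0, kap, fun x hx ↦ (hpos x hx).posSemidef, h1, h2, fun x hx ξ ↦ ?_,
    hk0, h4⟩
  calc ∑ j, laplaceDrift a x j * ξ j ≤ ∑ j, |laplaceDrift a x j| * ‖ξ‖ := by
        refine Finset.sum_le_sum fun j _ ↦ (le_abs_self _).trans ?_
        rw [abs_mul]
        exact mul_le_mul_of_nonneg_left (PiLp.norm_apply_le ξ j) (abs_nonneg _)
    _ = (∑ j, |laplaceDrift a x j|) * ‖ξ‖ := by rw [Finset.sum_mul]
    _ ≤ bet * ‖ξ‖ := mul_le_mul_of_nonneg_right (h3 x hx) (norm_nonneg _)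

end LaplaceBeltrami

/-! ### The Riemannian volume and the chart volumes. -/

section Volume

variable {n : ℕ} [NeZero n] {M : Type*} [MetricSpace M] [ChartedSpace (EuclideanHalfSpace n) M]

lemma volume_hyperplane_eq_zero :
    volume {y : EuclideanSpace ℝ (Fin n) | y 0 = 0} = 0 := by
  have h := Measure.addHaar_submodule (volume : Measure (EuclideanSpace ℝ (Fin n)))
    (LinearMap.ker (EuclideanSpace.proj (𝕜 := ℝ) (0 : Fin n)).toLinearMap) (by
      intro h
      have : stdVec (0 : Fin n) ∈ (⊤ : Submodule ℝ (EuclideanSpace ℝ (Fin n))) := trivial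
      rw [← h] at this
      simp [stdVec] at this)
  exact h

lemma target_ae_eq_chartDomain (a : M) :
    (extChartAt (𝓡∂ n) a).target =ᵐ[volume] chartDomain (n := n) a := by
  have h : ∀ᵐ y : EuclideanSpace ℝ (Fin n), y 0 ≠ 0 := by
    rw [ae_iff]; simpa using volume_hyperplane_eq_zero
  filter_upwards [h] with y hy
  refine propext ⟨fun h ↦ mem_chartDomain_iff.2 ⟨h, ?_⟩, fun h ↦ chartDomain_subset a h⟩
  exact lt_of_le_of_ne (nonneg_of_mem_target h) (Ne.symm hy)

section

variable [MeasurableSpace M] [RiemannianBundle (fun x : M ↦ TangentSpace (𝓡∂ n) x)]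

lemma chartVolume_le (a : M) : chartVolume (n := n) a ≤ riemannianVolume n M :=
  le_iSup (fun a : M ↦ chartVolume (n := n) a) a

end

variable [MeasurableSpace M] [BorelSpace M]

lemma aemeasurable_chartInv (a : M) : AEMeasurable (chartInv (n := n) a)
    (volume.restrict (extChartAt (𝓡∂ n) a).target) :=
  (continuousOn_extChartAt_symm a).aemeasurable (measurableSet_extChartAt_target a)

variable [RiemannianBundle (fun x : M ↦ TangentSpace (𝓡∂ n) x)]

lemma chartVolume_apply (a : M) {s : Set M} (hs : MeasurableSet s) :
    chartVolume (n := n) a s =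
      ∫⁻ y in chartInv a ⁻¹' s ∩ (extChartAt (𝓡∂ n) a).target, ENNReal.ofReal (volDensity a y) := by
  rw [chartVolume, Measure.map_apply_of_aemeasurable
    ((aemeasurable_chartInv a).mono_ac (withDensity_absolutelyContinuous _ _)) hs,
    withDensity_apply', Measure.restrict_restrict' (measurableSet_extChartAt_target a)]

variable [IsManifold (𝓡∂ n) ∞ M]

/-- Change of variables: the density transforms by the Jacobian of the coordinate change. Only an
inequality holds in general, since the chart at `b` may miss part of `s`. The boundary hyperplane, a
null set, is discarded to work between open sets. -/
lemma chartVolume_apply_le (a b : M) {s : Set M} (hs : MeasurableSet s)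
    (hsa : s ⊆ (extChartAt (𝓡∂ n) a).source) :
    chartVolume (n := n) b s ≤ chartVolume (n := n) a s := by
  rw [chartVolume_apply b hs, chartVolume_apply a hs]
  set S := chartInv b ⁻¹' s ∩ chartDomain (n := n) b
  have hS : S ⊆ overlap a b := fun y hy ↦ ⟨hy.2, hsa hy.1⟩
  have hSm : MeasurableSet S := by
    have h1 := (continuousOn_iff_continuous_domRestrict.1 ((continuousOn_extChartAt_symm b).mono
      (chartDomain_subset (n := n) b))).measurable hs
    have h2 := (isOpen_chartDomain b).measurableSet.subtype_image h1
    rwa [domRestrict_eq, preimage_comp, Subtype.image_preimage_coe, inter_comm] at h2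
  have e1 : (chartInv b ⁻¹' s ∩ (extChartAt (𝓡∂ n) b).target : Set (EuclideanSpace ℝ (Fin n)))
      =ᵐ[volume] S := (Filter.EventuallyEq.refl _ _).inter (target_ae_eq_chartDomain b)
  rw [setLIntegral_congr e1]
  have hder : ∀ y ∈ S, HasFDerivAt (coordChange a b) (fderiv ℝ (coordChange (n := n) a b) y) y :=
    fun y hy ↦ (((contDiffOn_coordChange a b).contDiffAt
      ((isOpen_overlap a b).mem_nhds (hS hy))).differentiableAt (by simp)).hasFDerivAt
  have hinj : InjOn (coordChange (n := n) a b) S := fun y hy z hz h ↦ by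
    rw [← coordChange_coordChange a b (hS hy), h, coordChange_coordChange a b (hS hz)]
  have hcv := lintegral_image_eq_lintegral_abs_det_fderiv_mul volume hSm
    (fun y hy ↦ (hder y hy).hasFDerivWithinAt) hinj (fun y ↦ ENNReal.ofReal (volDensity a y))
  have himg : coordChange a b '' S ⊆ chartInv a ⁻¹' s ∩ (extChartAt (𝓡∂ n) a).target := by
    rintro _ ⟨y, hy, rfl⟩
    refine ⟨?_, chartDomain_subset a (mapsTo_coordChange a b (hS hy)).1⟩
    rw [mem_preimage, chartInv_coordChange (hS hy).2]
    exact hy.1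
  refine le_trans (le_of_eq ?_) (lintegral_mono_set himg)
  rw [hcv]
  refine setLIntegral_congr_fun hSm fun y hy ↦ ?_
  have hy' := hS hy
  change _ = _ * _
  rw [← ENNReal.ofReal_mul (abs_nonneg _), ← det_jacobian, volDensity, volDensity, gram_change a b
    (chartDomain_subset b hy'.1) hy'.2, sqrt_det_transform,
    fderivWithin_of_mem_nhds (range_mem_nhds (mem_chartDomain_iff.1 hy'.1).2)]
  rfl

/-- A supremum of measures is controlled by exhibiting an upper bound: the volume of chart `a` on
its domain, plus the full volume off it, dominates every chart volume. Restricting to the domain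
leaves the first term. -/
lemma riemannianVolume_restrict_le (a : M) :
    (riemannianVolume n M).restrict (extChartAt (𝓡∂ n) a).source ≤ chartVolume (n := n) a := by
  set S := (extChartAt (𝓡∂ n) a).source
  have hS : MeasurableSet S := (isOpen_extChartAt_source a).measurableSet
  have h : riemannianVolume n M ≤
      (chartVolume (n := n) a).restrict S + (riemannianVolume n M).restrict Sᶜ := by
    refine iSup_le fun b ↦ Measure.le_iff.2 fun s hs ↦ ?_
    rw [← measure_inter_add_sdiff s hS, Measure.add_apply, Measure.restrict_apply hs,
      Measure.restrict_apply hs]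
    exact add_le_add (chartVolume_apply_le a b (hs.inter hS) inter_subset_right)
      (chartVolume_le b _)
  refine (Measure.restrict_mono_measure h S).trans ?_
  rw [Measure.restrict_add, Measure.restrict_restrict hS, Measure.restrict_restrict hS]
  simp [Measure.restrict_le_self]

end Volume

/-! ### Comparison of integrals over `M` and over a chart. -/

section VolumeIntegral

variable {n : ℕ} [NeZero n] {M : Type*} [MetricSpace M] [ChartedSpace (EuclideanHalfSpace n) M]
  [RiemannianBundle (fun x : M ↦ TangentSpace (𝓡∂ n) x)]
  [IsManifold (𝓡∂ n) ∞ M]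
  [IsContMDiffRiemannianBundle (𝓡∂ n) ∞ (EuclideanSpace ℝ (Fin n))
      (fun x : M ↦ TangentSpace (𝓡∂ n) x)]

lemma lintegral_withDensity_volDensity (a : M) (F : EuclideanSpace ℝ (Fin n) → ℝ≥0∞) :
    ∫⁻ y, F y ∂(((volume : Measure (EuclideanSpace ℝ (Fin n))).restrict
      (extChartAt (𝓡∂ n) a).target).withDensity fun y ↦ ENNReal.ofReal (volDensity a y)) =
    ∫⁻ y in (extChartAt (𝓡∂ n) a).target, ENNReal.ofReal (volDensity a y) * F y := by
  have := lintegral_withDensity_eq_lintegral_mul_non_measurable₀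
    ((volume : Measure (EuclideanSpace ℝ (Fin n))).restrict (extChartAt (𝓡∂ n) a).target)
    (f := fun y ↦ ENNReal.ofReal (volDensity a y))
    ((contDiffOn_volDensity a).continuousOn.aemeasurable
      (measurableSet_extChartAt_target a)).ennreal_ofReal
    (Filter.Eventually.of_forall fun y ↦ ENNReal.ofReal_lt_top) F
  exact this

variable [MeasurableSpace M] [BorelSpace M]

/-- `F` is arbitrary because it will be the squared norm of a covector field not assumed measurable.
For such `F` this direction is not automatic for a pushforward: a measurable minorant with the same
integral is chosen in the chart and carried back to `M`. -/
lemma lintegral_chartInv_le (a : M) (F : M → ℝ≥0∞) :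
    ∫⁻ y in (extChartAt (𝓡∂ n) a).target, ENNReal.ofReal (volDensity a y) * F (chartInv a y) ≤
      ∫⁻ p, F p ∂(riemannianVolume n M) := by
  rw [← lintegral_withDensity_volDensity a (fun y ↦ F (chartInv a y))]
  refine le_trans ?_ (lintegral_mono' (chartVolume_le (n := n) a) le_rfl)
  obtain ⟨g, hg, hgF, hgi⟩ := exists_measurable_le_lintegral_eq
    (μ := (((volume : Measure (EuclideanSpace ℝ (Fin n))).restrict
      (extChartAt (𝓡∂ n) a).target).withDensity fun y ↦ ENNReal.ofReal (volDensity a y)))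
    (fun y ↦ F (chartInv a y))
  set S := (extChartAt (𝓡∂ n) a).source
  have hS : MeasurableSet S := (isOpen_extChartAt_source a).measurableSet
  set G : M → ℝ≥0∞ := S.indicator fun p ↦ g (extChartAt (𝓡∂ n) a p)
  have hG : Measurable G := by
    refine measurable_of_restrict_of_restrict_compl hS ?_ ?_
    · have : S.domRestrict G = g ∘ (S.domRestrict (extChartAt (𝓡∂ n) a)) := by
        funext x
        exact indicator_of_mem (s := S) x.2 (fun p ↦ g (extChartAt (𝓡∂ n) a p))
      rw [this]
      exact hg.comp (continuousOn_iff_continuous_domRestrict.1 (continuousOn_extChartAt a)).measurable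
    · have : Sᶜ.domRestrict G = fun _ ↦ 0 := by
        funext x
        exact indicator_of_notMem (s := S) x.2 (fun p ↦ g (extChartAt (𝓡∂ n) a p))
      rw [this]; exact measurable_const
  have hGF : G ≤ F := by
    intro p
    by_cases hp : p ∈ S
    · rw [show G p = g (extChartAt (𝓡∂ n) a p) from indicator_of_mem hp _]
      refine (hgF _).trans_eq ?_
      exact congrArg F ((extChartAt (𝓡∂ n) a).left_inv hp)
    · rw [show G p = 0 from indicator_of_notMem hp _]; exact zero_le
  rw [hgi]
  refine le_trans (le_of_eq ?_) (lintegral_mono hGF)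
  rw [chartVolume, lintegral_map' hG.aemeasurable
    ((aemeasurable_chartInv a).mono_ac (withDensity_absolutelyContinuous _ _))]
  rw [lintegral_withDensity_volDensity, lintegral_withDensity_volDensity]
  refine setLIntegral_congr_fun (measurableSet_extChartAt_target a) fun y hy ↦ ?_
  have h1 : chartInv a y ∈ S := (extChartAt (𝓡∂ n) a).map_target hy
  have h2 : extChartAt (𝓡∂ n) a (chartInv a y) = y := (extChartAt (𝓡∂ n) a).right_inv hy
  simp only [G, indicator_of_mem h1, h2]

lemma setLIntegral_riemannianVolume_le (a : M) {W : Set M} (hW : MeasurableSet W)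
    (hWa : W ⊆ (extChartAt (𝓡∂ n) a).source) (F : M → ℝ≥0∞) :
    ∫⁻ p in W, F p ∂(riemannianVolume n M) ≤ ∫⁻ y in (extChartAt (𝓡∂ n) a).target,
        ENNReal.ofReal (volDensity a y) * W.indicator F (chartInv a y) := by
  have h1 : (riemannianVolume n M).restrict W ≤ chartVolume (n := n) a :=
    (Measure.restrict_mono_set _ hWa).trans (riemannianVolume_restrict_le a)
  have h2 : ((riemannianVolume n M).restrict W).restrict W ≤ (chartVolume (n := n) a).restrict W :=
    Measure.restrict_mono_measure h1 W
  rw [Measure.restrict_restrict hW, inter_self] at h2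
  refine (lintegral_mono' h2 le_rfl).trans ?_
  rw [← lintegral_indicator hW, ← lintegral_withDensity_volDensity a]
  exact lintegral_map_le _ _

end VolumeIntegral

/-! ### Norms on a compact part of a chart in terms of norms on `M`. -/

section ChartNorms

variable {𝕜 : Type*} [RCLike 𝕜] {n : ℕ} [NeZero n]
  {M : Type*} [MetricSpace M] [ChartedSpace (EuclideanHalfSpace n) M]
  [RiemannianBundle (fun x : M ↦ TangentSpace (𝓡∂ n) x)]

/-- Expand `v` in the orthonormal basis defining `covectorNormSq` and apply Cauchy-Schwarz. -/
lemma enorm_apply_sq_le (p : M) (α : TangentSpace (𝓡∂ n) p →L[ℝ] 𝕜) (v : TangentSpace (𝓡∂ n) p) :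
    ‖α v‖ₑ ^ 2 ≤ ENNReal.ofReal (inner ℝ v v) * covectorNormSq p α := by
  set e := stdOrthonormalBasis ℝ (TangentSpace (𝓡∂ n) p)
  have h1 : ‖α v‖ ≤ ∑ i, ‖inner ℝ (e i) v‖ * ‖α (e i)‖ := by
    conv_lhs => rw [← e.sum_repr' v, map_sum]
    refine (norm_sum_le _ _).trans (Finset.sum_le_sum fun i _ ↦ ?_)
    rw [map_smul, norm_smul]
  have h2 : ‖α v‖ ^ 2 ≤ inner ℝ v v * ∑ i, ‖α (e i)‖ ^ 2 := by
    refine (pow_le_pow_left₀ (norm_nonneg _) h1 2).trans ?_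
    refine (Finset.sum_mul_sq_le_sq_mul_sq _ _ _).trans_eq ?_
    rw [e.sum_sq_norm_inner_right, real_inner_self_eq_norm_sq]
  have h3 : covectorNormSq p α = ENNReal.ofReal (∑ i, ‖α (e i)‖ ^ 2) := by
    rw [ENNReal.ofReal_sum_of_nonneg fun i _ ↦ by positivity]
    refine Finset.sum_congr rfl fun i _ ↦ ?_
    rw [← ofReal_norm, ENNReal.ofReal_pow (norm_nonneg _)]
  rw [h3, ← ENNReal.ofReal_mul real_inner_self_nonneg, ← ofReal_norm,
    ← ENNReal.ofReal_pow (norm_nonneg _)]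
  exact ENNReal.ofReal_le_ofReal h2

variable [IsManifold (𝓡∂ n) ∞ M]
  [IsContMDiffRiemannianBundle (𝓡∂ n) ∞ (EuclideanSpace ℝ (Fin n))
      (fun x : M ↦ TangentSpace (𝓡∂ n) x)]

lemma exists_one_le_mul_volDensity (a : M) {K : Set (EuclideanSpace ℝ (Fin n))} (hK : IsCompact K)
    (hKT : K ⊆ (extChartAt (𝓡∂ n) a).target) :
    ∃ C : ℝ≥0, ∀ y ∈ K, 1 ≤ C * ENNReal.ofReal (volDensity a y) := by
  obtain ⟨C, hC⟩ := hK.exists_bound_of_continuousOn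
    (((contDiffOn_volDensity a).continuousOn.mono hKT).inv₀ fun y hy ↦ (volDensity_pos (hKT hy)).ne')
  refine ⟨C.toNNReal, fun y hy ↦ ?_⟩
  have hpos := volDensity_pos (hKT hy)
  have h : (volDensity a y)⁻¹ ≤ C := (le_abs_self _).trans (hC y hy)
  have hC0 : 0 ≤ C := (inv_pos.2 hpos).le.trans h
  change 1 ≤ ENNReal.ofReal C * _
  rw [← ENNReal.ofReal_mul hC0, ENNReal.one_le_ofReal]
  calc 1 = (volDensity a y)⁻¹ * volDensity a y := (inv_mul_cancel₀ hpos.ne').symm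
    _ ≤ C * volDensity a y := mul_le_mul_of_nonneg_right h hpos.le

variable [MeasurableSpace M] [BorelSpace M]

/-- On compact parts of the chart, boundary points included, the density is bounded away from zero,
so Lebesgue measure is dominated by the volume. -/
lemma exists_lintegral_chart_le (a : M) {K : Set (EuclideanSpace ℝ (Fin n))} (hK : IsCompact K)
    (hKT : K ⊆ (extChartAt (𝓡∂ n) a).target) :
    ∃ C : ℝ≥0, ∀ F : M → ℝ≥0∞,
      ∫⁻ y in K, F (chartInv a y) ≤ C * ∫⁻ p, F p ∂(riemannianVolume n M) := by
  obtain ⟨C, hC⟩ := exists_one_le_mul_volDensity a hK hKT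
  refine ⟨C, fun F ↦ ?_⟩
  calc ∫⁻ y in K, F (chartInv a y)
      ≤ ∫⁻ y in K, C * (ENNReal.ofReal (volDensity a y) * F (chartInv a y)) := by
        refine setLIntegral_mono' hK.measurableSet fun y hy ↦ ?_
        rw [← mul_assoc]
        exact le_mul_of_one_le_left zero_le (hC y hy)
    _ = C * ∫⁻ y in K, ENNReal.ofReal (volDensity a y) * F (chartInv a y) :=
        lintegral_const_mul' _ _ ENNReal.coe_ne_top
    _ ≤ C * ∫⁻ p, F p ∂(riemannianVolume n M) := by
        gcongr
        exact (lintegral_mono_set hKT).trans (lintegral_chartInv_le a F)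

variable (𝕜) in
lemma exists_lintegral_coordVec_sq_le (a : M) {K : Set (EuclideanSpace ℝ (Fin n))} (hK : IsCompact K)
    (hKT : K ⊆ (extChartAt (𝓡∂ n) a).target) (i : Fin n) :
    ∃ C : ℝ≥0, ∀ α : ∀ p : M, TangentSpace (𝓡∂ n) p →L[ℝ] 𝕜,
      ∫⁻ y in K, ‖α (chartInv a y) (coordVec a y i)‖ₑ ^ 2 ≤
        C * ∫⁻ p, covectorNormSq p (α p) ∂(riemannianVolume n M) := by
  obtain ⟨C, hC⟩ := exists_lintegral_chart_le a hK hKT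
  obtain ⟨D, hD⟩ := hK.exists_bound_of_continuousOn ((contDiffOn_gram a i i).continuousOn.mono hKT)
  refine ⟨D.toNNReal * C, fun α ↦ ?_⟩
  calc ∫⁻ y in K, ‖α (chartInv a y) (coordVec a y i)‖ₑ ^ 2
      ≤ ∫⁻ y in K, D.toNNReal * covectorNormSq (chartInv a y) (α (chartInv a y)) := by
        refine setLIntegral_mono' hK.measurableSet fun y hy ↦ ?_
        refine (enorm_apply_sq_le _ _ _).trans ?_
        gcongr
        exact ENNReal.ofReal_le_ofReal ((le_abs_self _).trans (hD y hy))
    _ = D.toNNReal * ∫⁻ y in K, covectorNormSq (chartInv a y) (α (chartInv a y)) :=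
        lintegral_const_mul' _ _ ENNReal.coe_ne_top
    _ ≤ _ := by
        rw [ENNReal.coe_mul, mul_assoc]
        gcongr
        exact hC fun p ↦ covectorNormSq p (α p)

end ChartNorms

/-! ### Strips along the boundary of the half-space. -/

section BoundaryStrip

variable {n : ℕ} [NeZero n]

/-- The part `{‖x' - y'‖ ≤ r, 0 ≤ x₀ ≤ h}` of the closed half-space, where `x'` denotes the
projection of `x` to the hyperplane `x₀ = 0`. -/
def boundaryStrip (y : EuclideanSpace ℝ (Fin n)) (r h : ℝ) : Set (EuclideanSpace ℝ (Fin n)) :=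
  {x | ‖x - x 0 • stdVec 0 - y‖ ≤ r ∧ 0 ≤ x 0 ∧ x 0 ≤ h}

lemma dist_le_of_mem_boundaryStrip {y x : EuclideanSpace ℝ (Fin n)} {r h : ℝ}
    (hx : x ∈ boundaryStrip y r h) : dist x y ≤ r + h := by
  rw [dist_eq_norm]
  calc ‖x - y‖ = ‖(x - x 0 • stdVec 0 - y) + x 0 • stdVec 0‖ := by congr 1; abel
    _ ≤ ‖x - x 0 • stdVec 0 - y‖ + ‖x 0 • (stdVec 0 : EuclideanSpace ℝ (Fin n))‖ := norm_add_le _ _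
    _ ≤ r + h := by
      refine add_le_add hx.1 ?_
      rw [norm_smul, Real.norm_of_nonneg hx.2.1]
      simpa [stdVec] using hx.2.2

lemma isCompact_boundaryStrip (y : EuclideanSpace ℝ (Fin n)) (r h : ℝ) :
    IsCompact (boundaryStrip y r h) := by
  refine Metric.isCompact_of_isClosed_isBounded ?_
    ((Metric.isBounded_closedBall (x := y) (r := r + h)).subset
      fun x hx ↦ dist_le_of_mem_boundaryStrip hx)
  have h1 : Continuous fun x : EuclideanSpace ℝ (Fin n) ↦ ‖x - x 0 • stdVec 0 - y‖ := by fun_prop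
  have h2 : Continuous fun x : EuclideanSpace ℝ (Fin n) ↦ x 0 := by fun_prop
  exact (isClosed_le h1 continuous_const).inter ((isClosed_le continuous_const h2).inter
    (isClosed_le h2 continuous_const))

end BoundaryStrip

/-! ### Boundary values are controlled by the `W^{1,1}` norm in a strip. -/

section StripEstimate

variable {n : ℕ} [NeZero n]

/-- A smooth step in the variable `x₀`, from `0` on `{x₀ ≤ δ}` to `1` on `{x₀ ≥ 2δ}`, times a bump
function of the other variables. -/
def stepBump {y : EuclideanSpace ℝ (Fin n)} (β : ContDiffBump y) (δ : ℝ)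
    (x : EuclideanSpace ℝ (Fin n)) : ℝ :=
  β (x - x 0 • stdVec 0) * Real.smoothTransition (x 0 / δ - 1)

/-- The partial derivative of `stepBump` in the direction `x₀`. -/
def stepBumpDeriv {y : EuclideanSpace ℝ (Fin n)} (β : ContDiffBump y) (δ : ℝ)
    (x : EuclideanSpace ℝ (Fin n)) : ℝ :=
  β (x - x 0 • stdVec 0) * (deriv Real.smoothTransition (x 0 / δ - 1) * δ⁻¹)

variable {y : EuclideanSpace ℝ (Fin n)} (β : ContDiffBump y)

lemma contDiff_stepBump (δ : ℝ) : ContDiff ℝ (⊤ : ℕ∞) (stepBump β δ) := by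
  have h0 : ContDiff ℝ (⊤ : ℕ∞) fun x : EuclideanSpace ℝ (Fin n) ↦ x 0 := by fun_prop
  refine ContDiff.mul (β.contDiff.comp ?_) (Real.smoothTransition.contDiff.comp ?_)
  · exact contDiff_id.sub (h0.smul contDiff_const)
  · exact (h0.div_const δ).sub contDiff_const

lemma partialDeriv_stepBump (δ : ℝ) (x : EuclideanSpace ℝ (Fin n)) :
    partialDeriv 0 (stepBump β δ) x = stepBumpDeriv β δ x := by
  have hd : DifferentiableAt ℝ (stepBump β δ) x :=
    (contDiff_stepBump β δ).differentiable (by simp) x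
  have h1 : HasDerivAt (fun t : ℝ ↦ stepBump β δ (x + t • stdVec 0))
      (partialDeriv 0 (stepBump β δ) x) 0 := by
    have := hd.hasFDerivAt.hasLineDerivAt (stdVec 0)
    exact this
  have h2 : HasDerivAt (fun t : ℝ ↦ stepBump β δ (x + t • stdVec 0)) (stepBumpDeriv β δ x) 0 := by
    have e : (fun t : ℝ ↦ stepBump β δ (x + t • stdVec 0)) = fun t ↦
        β (x - x 0 • stdVec 0) * Real.smoothTransition ((x 0 + t) / δ - 1) := by
      funext t
      have e1 : (x + t • stdVec 0 : EuclideanSpace ℝ (Fin n)) 0 = x 0 + t := by simp [stdVec]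
      rw [stepBump, e1]
      congr 2
      rw [add_smul]; abel
    rw [e]
    have h3 : HasDerivAt (fun t : ℝ ↦ (x 0 + t) / δ - 1) δ⁻¹ 0 := by
      simpa using (((hasDerivAt_id (0 : ℝ)).const_add (x 0)).div_const δ).sub_const 1
    have h4 : HasDerivAt Real.smoothTransition (deriv Real.smoothTransition (x 0 / δ - 1))
        ((x 0 + 0) / δ - 1) := by
      rw [add_zero]
      exact ((Real.smoothTransition.contDiff (n := 1)).differentiable (by simp) _).hasDerivAt
    exact (h4.comp 0 h3).const_mul _
  exact h1.unique h2

lemma stepBumpDeriv_nonneg {δ : ℝ} (hδ : 0 < δ) (x : EuclideanSpace ℝ (Fin n)) :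
    0 ≤ stepBumpDeriv β δ x :=
  mul_nonneg β.nonneg (mul_nonneg Real.smoothTransition.monotone.deriv_nonneg (inv_pos.2 hδ).le)

lemma deriv_smoothTransition_eq_zero {t : ℝ} (ht : t < 0 ∨ 1 < t) :
    deriv Real.smoothTransition t = 0 := by
  rcases ht with ht | ht
  · have : Real.smoothTransition =ᶠ[nhds t] fun _ ↦ 0 := by
      filter_upwards [Iio_mem_nhds ht] with s hs using Real.smoothTransition.zero_of_nonpos (le_of_lt hs)
    rw [this.deriv_eq, deriv_const]
  · have : Real.smoothTransition =ᶠ[nhds t] fun _ ↦ 1 := by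
      filter_upwards [Ioi_mem_nhds ht] with s hs using Real.smoothTransition.one_of_one_le (le_of_lt hs)
    rw [this.deriv_eq, deriv_const]

lemma isClosed_strip (r a b : ℝ) :
    IsClosed {x : EuclideanSpace ℝ (Fin n) | ‖x - x 0 • stdVec 0 - y‖ ≤ r ∧ a ≤ x 0 ∧ x 0 ≤ b} := by
  have h1 : Continuous fun x : EuclideanSpace ℝ (Fin n) ↦ ‖x - x 0 • stdVec 0 - y‖ := by fun_prop
  have h2 : Continuous fun x : EuclideanSpace ℝ (Fin n) ↦ x 0 := by fun_prop
  exact (isClosed_le h1 continuous_const).inter ((isClosed_le continuous_const h2).inter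
    (isClosed_le h2 continuous_const))

lemma norm_le_of_bump_ne_zero {x : EuclideanSpace ℝ (Fin n)} (h : β (x - x 0 • stdVec 0) ≠ 0) :
    ‖x - x 0 • stdVec 0 - y‖ ≤ β.rOut := by
  have : x - x 0 • stdVec 0 ∈ Function.support β := h
  rw [β.support_eq, Metric.mem_ball, dist_eq_norm] at this
  exact this.le

lemma tsupport_stepBumpDeriv_subset {δ : ℝ} (hδ : 0 < δ) : tsupport (stepBumpDeriv β δ) ⊆
    {x | ‖x - x 0 • stdVec 0 - y‖ ≤ β.rOut ∧ δ ≤ x 0 ∧ x 0 ≤ 2 * δ} := by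
  refine closure_minimal (fun x hx ↦ ?_) (isClosed_strip _ _ _)
  rw [Function.mem_support, stepBumpDeriv] at hx
  have h2 := left_ne_zero_of_mul (right_ne_zero_of_mul hx)
  refine ⟨norm_le_of_bump_ne_zero β (left_ne_zero_of_mul hx), ?_, ?_⟩
  · by_contra! h
    refine h2 (deriv_smoothTransition_eq_zero (Or.inl ?_))
    rw [sub_neg, div_lt_one hδ]; exact h
  · by_contra! h
    refine h2 (deriv_smoothTransition_eq_zero (Or.inr ?_))
    rw [lt_sub_iff_add_lt, lt_div_iff₀ hδ]; linarith

lemma tsupport_stepBump_sub_subset {δ η : ℝ} (hδ : 0 < δ) (hδη : δ ≤ η) :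
    tsupport (fun x ↦ stepBump β δ x - stepBump β η x) ⊆
      {x | ‖x - x 0 • stdVec 0 - y‖ ≤ β.rOut ∧ δ ≤ x 0 ∧ x 0 ≤ 2 * η} := by
  refine closure_minimal (fun x hx ↦ ?_) (isClosed_strip _ _ _)
  have hη : 0 < η := hδ.trans_le hδη
  rw [Function.mem_support, stepBump, stepBump, ← mul_sub] at hx
  have h2 := right_ne_zero_of_mul hx
  refine ⟨norm_le_of_bump_ne_zero β (left_ne_zero_of_mul hx), ?_, ?_⟩
  · by_contra! h
    refine h2 ?_
    rw [Real.smoothTransition.zero_of_nonpos, Real.smoothTransition.zero_of_nonpos, sub_zero]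
    · rw [sub_nonpos, div_le_one hη]; linarith
    · rw [sub_nonpos, div_le_one hδ]; linarith
  · by_contra! h
    refine h2 ?_
    rw [Real.smoothTransition.one_of_one_le, Real.smoothTransition.one_of_one_le, sub_self]
    · rw [le_sub_iff_add_le, le_div_iff₀ hη]; linarith
    · rw [le_sub_iff_add_le, le_div_iff₀ hδ]; linarith

lemma strip_subset_boundaryStrip {r a b h : ℝ} (ha : 0 ≤ a) (hb : b ≤ h) :
    {x : EuclideanSpace ℝ (Fin n) | ‖x - x 0 • stdVec 0 - y‖ ≤ r ∧ a ≤ x 0 ∧ x 0 ≤ b} ⊆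
      boundaryStrip y r h :=
  fun _ hx ↦ ⟨hx.1, ha.trans hx.2.1, hx.2.2.trans hb⟩

lemma continuous_stepBumpDeriv (δ : ℝ) : Continuous (stepBumpDeriv β δ) := by
  have := continuous_partialDeriv ((contDiff_stepBump β δ).of_le (by exact_mod_cast le_top)) 0
  rwa [show partialDeriv 0 (stepBump β δ) = stepBumpDeriv β δ from
    funext (partialDeriv_stepBump β δ)] at this

lemma hasCompactSupport_stepBumpDeriv {δ : ℝ} (hδ : 0 < δ) :
    HasCompactSupport (stepBumpDeriv β δ) :=
  (isCompact_boundaryStrip y β.rOut (2 * δ)).of_isClosed_subset (isClosed_tsupport _)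
    ((tsupport_stepBumpDeriv_subset β hδ).trans (strip_subset_boundaryStrip hδ.le le_rfl))

lemma hasCompactSupport_stepBump_sub {δ η : ℝ} (hδ : 0 < δ) (hδη : δ ≤ η) :
    HasCompactSupport (fun x ↦ stepBump β δ x - stepBump β η x) :=
  (isCompact_boundaryStrip y β.rOut (2 * η)).of_isClosed_subset (isClosed_tsupport _)
    ((tsupport_stepBump_sub_subset β hδ hδη).trans (strip_subset_boundaryStrip hδ.le le_rfl))

lemma partialDeriv_stepBump_sub (δ η : ℝ) (x : EuclideanSpace ℝ (Fin n)) :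
    partialDeriv 0 (fun x ↦ stepBump β δ x - stepBump β η x) x =
      stepBumpDeriv β δ x - stepBumpDeriv β η x := by
  rw [← partialDeriv_stepBump, ← partialDeriv_stepBump, partialDeriv, partialDeriv, partialDeriv,
    fderiv_fun_sub ((contDiff_stepBump β δ).differentiable (by simp) x)
    ((contDiff_stepBump β η).differentiable (by simp) x)]
  rfl

/-- The two integrands differ by the derivative of a compactly supported function. Hence the mass
does not change as the step moves towards the boundary. -/
lemma integral_stepBumpDeriv_eq {δ η : ℝ} (hδ : 0 < δ) (hδη : δ ≤ η) :
    ∫ x, stepBumpDeriv β δ x = ∫ x, stepBumpDeriv β η x := by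
  have h := integral_mul_partialDeriv isOpen_univ (F := fun _ ↦ (1 : ℝ))
    (((contDiff_stepBump β δ).sub (contDiff_stepBump β η)).of_le (by exact_mod_cast le_top))
    (hasCompactSupport_stepBump_sub β hδ hδη) (subset_univ _) contDiffOn_const 0
  have h1 : ∀ x, partialDeriv (n := n) 0 (fun _ ↦ (1 : ℝ)) x = 0 := fun x ↦ by simp [partialDeriv]
  simp only [h1, mul_zero, integral_zero, mul_one, partialDeriv_stepBump_sub] at h
  rw [integral_sub ((continuous_stepBumpDeriv β δ).integrable_of_hasCompactSupport
    (hasCompactSupport_stepBumpDeriv β hδ)) ((continuous_stepBumpDeriv β η).integrable_of_hasCompactSupport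
    (hasCompactSupport_stepBumpDeriv β (hδ.trans_le hδη)))] at h
  linarith

lemma integral_stepBumpDeriv_pos (hy : y 0 = 0) {δ : ℝ} (hδ : 0 < δ) :
    0 < ∫ x, stepBumpDeriv β δ x := by
  obtain ⟨t, ht, hts⟩ := exists_deriv_eq_slope Real.smoothTransition (zero_lt_one (α := ℝ))
    Real.smoothTransition.continuous.continuousOn
    ((Real.smoothTransition.contDiff (n := 1)).differentiable (by simp)).differentiableOn
  rw [Real.smoothTransition.one, Real.smoothTransition.zero] at hts
  refine (continuous_stepBumpDeriv β δ).integral_pos_of_hasCompactSupport_nonneg_nonzero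
    (hasCompactSupport_stepBumpDeriv β hδ) (stepBumpDeriv_nonneg β hδ)
    (x := y + ((t + 1) * δ) • stdVec 0) ?_
  have e1 : (y + ((t + 1) * δ) • stdVec 0 : EuclideanSpace ℝ (Fin n)) 0 = (t + 1) * δ := by
    simp [stdVec, hy]
  rw [stepBumpDeriv, e1, add_sub_cancel_right, mul_div_cancel_right₀ _ hδ.ne', add_sub_cancel_right,
    hts, β.one_of_mem_closedBall (Metric.mem_closedBall_self β.rIn_pos.le)]
  simp [hδ.ne']

/-- A trace inequality without traces. The derivative of a step at height `ε` averages `w` near the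
boundary, with mass independent of `ε`. Its difference from the same average at height `h / 2` is an
integral of `D` against a function bounded by `1`. The point is that `c` and `C` do not depend on
`δ`, the height below which `w` is controlled. -/
lemma exists_strip_estimate (y : EuclideanSpace ℝ (Fin n)) (hy : y 0 = 0) {r h : ℝ} (hr : 0 < r)
    (hh : 0 < h) : ∃ c > 0, ∃ C : ℝ≥0, ∀ (Ω : Set (EuclideanSpace ℝ (Fin n)))
      (w D : EuclideanSpace ℝ (Fin n) → ℝ) (σ m δ : ℝ), IsOpen Ω →
      (∀ x ∈ boundaryStrip y r h, 0 < x 0 → x ∈ Ω) → HasWeakPartial Ω 0 w D → |σ| = 1 → 0 < δ →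
      (∀ x ∈ boundaryStrip y r h, 0 < x 0 → x 0 ≤ δ → m ≤ σ * w x) →
      ENNReal.ofReal (c * m) ≤ C * ∫⁻ x in boundaryStrip y r h ∩ {x | 0 < x 0}, (‖w x‖ₑ + ‖D x‖ₑ) := by
  let β : ContDiffBump y := ⟨r / 2, r, by positivity, by linarith⟩
  have hh2 : 0 < h / 2 := by positivity
  obtain ⟨C₀, hC₀⟩ := (hasCompactSupport_stepBumpDeriv β hh2).exists_bound_of_continuous
    (continuous_stepBumpDeriv β (h / 2))
  refine ⟨∫ x, stepBumpDeriv β (h / 2) x, integral_stepBumpDeriv_pos β hy hh2,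
    max C₀.toNNReal 1, fun Ω w D σ m δ hΩ hsub hw hσ hδ hm ↦ ?_⟩
  -- The derivative of the step lives in `ε ≤ x₀ ≤ 2ε`, so `2ε ≤ δ` is needed for the lower bound on
  -- `σ * w`.
  set ε := min (δ / 2) (h / 2)
  have hε : 0 < ε := by positivity
  have hεh : ε ≤ h / 2 := min_le_right _ _
  have hεδ : 2 * ε ≤ δ := by linarith [min_le_left (δ / 2) (h / 2)]
  set S := boundaryStrip y r h ∩ {x | 0 < x 0}
  have hSΩ : S ⊆ Ω := fun x hx ↦ hsub x hx.1 hx.2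
  have hSm : MeasurableSet S := (isCompact_boundaryStrip y r h).measurableSet.inter
    (isOpen_lt continuous_const (by fun_prop)).measurableSet
  set θ := fun x ↦ stepBump β ε x - stepBump β (h / 2) x
  have hθS : tsupport θ ⊆ S := fun x hx ↦ by
    have := tsupport_stepBump_sub_subset β hε hεh hx
    exact ⟨strip_subset_boundaryStrip hε.le (by linarith) this, hε.trans_le this.2.1⟩
  have hdS : ∀ {η}, 0 < η → η ≤ h / 2 → tsupport (stepBumpDeriv β η) ⊆ S := fun {η} h0 h1 x hx ↦ by
    have := tsupport_stepBumpDeriv_subset β h0 hx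
    exact ⟨strip_subset_boundaryStrip h0.le (by linarith) this, h0.trans_le this.2.1⟩
  have hweak := hw.2.2 θ ((contDiff_stepBump β ε).sub (contDiff_stepBump β (h / 2)))
    (hasCompactSupport_stepBump_sub β hε hεh) (hθS.trans hSΩ)
  have hi1 : Integrable fun x ↦ stepBumpDeriv β ε x • w x :=
    integrable_smul_of_tsupport_subset hw.1 (continuous_stepBumpDeriv β ε)
      (hasCompactSupport_stepBumpDeriv β hε) ((hdS hε hεh).trans hSΩ)
  have hi2 : Integrable fun x ↦ stepBumpDeriv β (h / 2) x • w x :=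
    integrable_smul_of_tsupport_subset hw.1 (continuous_stepBumpDeriv β (h / 2))
      (hasCompactSupport_stepBumpDeriv β hh2) ((hdS hh2 le_rfl).trans hSΩ)
  -- `θ` is compactly supported in the open half-space although neither step is compactly supported,
  -- so the weak derivative may be tested with it.
  have hkey : ∫ x, stepBumpDeriv β ε x • w x =
      (∫ x, stepBumpDeriv β (h / 2) x • w x) - ∫ x, θ x • D x := by
    have e : ∀ x, fderiv ℝ θ x (stdVec 0) • w x =
        stepBumpDeriv β ε x • w x - stepBumpDeriv β (h / 2) x • w x := fun x ↦ by
      rw [← sub_smul, ← partialDeriv_stepBump_sub]; rfl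
    simp_rw [e] at hweak
    rw [integral_sub hi1 hi2] at hweak
    linarith
  have hlow : (∫ x, stepBumpDeriv β (h / 2) x) * m ≤ σ * ∫ x, stepBumpDeriv β ε x • w x := by
    rw [← integral_stepBumpDeriv_eq β hε hεh, ← integral_mul_const, ← integral_const_mul]
    refine integral_mono (((continuous_stepBumpDeriv β ε).integrable_of_hasCompactSupport
      (hasCompactSupport_stepBumpDeriv β hε)).mul_const m) (hi1.const_mul σ) fun x ↦ ?_
    by_cases hx : x ∈ tsupport (stepBumpDeriv β ε)
    · have h1 := tsupport_stepBumpDeriv_subset β hε hx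
      have h2 := hm x (hdS hε hεh hx).1 (hdS hε hεh hx).2 (h1.2.2.trans hεδ)
      calc stepBumpDeriv β ε x * m ≤ stepBumpDeriv β ε x * (σ * w x) :=
            mul_le_mul_of_nonneg_left h2 (stepBumpDeriv_nonneg β hε x)
        _ = σ * (stepBumpDeriv β ε x • w x) := by rw [smul_eq_mul]; ring
    · simp [image_eq_zero_of_notMem_tsupport hx]
  have hb : ∀ (g F : EuclideanSpace ℝ (Fin n) → ℝ) (B : ℝ≥0), tsupport g ⊆ S →
      (∀ x, ‖g x‖ ≤ B) → ‖∫ x, g x • F x‖ₑ ≤ B * ∫⁻ x in S, ‖F x‖ₑ := by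
    intro g F B hg hB
    refine (enorm_integral_le_lintegral_enorm _).trans ?_
    rw [← lintegral_const_mul' _ _ ENNReal.coe_ne_top, ← lintegral_indicator hSm]
    refine lintegral_mono fun x ↦ ?_
    by_cases hx : x ∈ S
    · rw [indicator_of_mem hx, enorm_smul]
      gcongr
      rw [← ofReal_norm, ← ENNReal.ofReal_coe_nnreal]
      exact ENNReal.ofReal_le_ofReal (hB x)
    · rw [image_eq_zero_of_notMem_tsupport fun h ↦ hx (hg h)]
      simp
  have hB1 := hb (stepBumpDeriv β (h / 2)) w C₀.toNNReal (hdS hh2 le_rfl) fun x ↦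
    (hC₀ x).trans (Real.le_coe_toNNReal _)
  have hB2 := hb θ D 1 hθS fun x ↦ by
    have hβ : β (x - x 0 • stdVec 0) ∈ Icc (0 : ℝ) 1 := ⟨β.nonneg, β.le_one⟩
    have h1 : ∀ η, stepBump β η x ∈ Icc (0 : ℝ) 1 := fun η ↦
      ⟨mul_nonneg hβ.1 (Real.smoothTransition.nonneg _),
        mul_le_one₀ hβ.2 (Real.smoothTransition.nonneg _) (Real.smoothTransition.le_one _)⟩
    rw [Real.norm_eq_abs, NNReal.coe_one, abs_le]
    have := h1 ε; have := h1 (h / 2)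
    constructor <;> simp only [θ] <;> linarith [(h1 ε).1, (h1 ε).2, (h1 (h / 2)).1, (h1 (h / 2)).2]
  have hle : (∫ x, stepBumpDeriv β (h / 2) x) * m ≤
      ‖(∫ x, stepBumpDeriv β (h / 2) x • w x) - ∫ x, θ x • D x‖ := by
    refine hlow.trans ((le_abs_self _).trans_eq ?_)
    rw [abs_mul, hσ, one_mul, hkey, Real.norm_eq_abs]
  refine (ENNReal.ofReal_le_ofReal hle).trans ?_
  rw [ofReal_norm]
  refine enorm_sub_le.trans ((add_le_add hB1 hB2).trans ?_)
  have hwm : AEMeasurable (fun x ↦ ‖w x‖ₑ) (volume.restrict S) :=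
    ((hw.1.aestronglyMeasurable).mono_set hSΩ).enorm
  rw [lintegral_add_left' hwm, mul_add]
  gcongr
  · exact le_max_left _ _
  · exact le_max_right _ _

end StripEstimate

/-! ### Continuous functions in `H¹₀(M)` vanish on the boundary. -/

section Trace

variable {n : ℕ} [NeZero n] {M : Type*} [MetricSpace M] [ChartedSpace (EuclideanHalfSpace n) M]

lemma exists_halfBall_subset (a p : M) (hp : p ∈ (extChartAt (𝓡∂ n) a).source)
    {P : EuclideanSpace ℝ (Fin n) → Prop}
    (hP : ∀ᶠ x in nhdsWithin (extChartAt (𝓡∂ n) a p) (range (𝓡∂ n)), P x) :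
    ∃ ρ > 0, ∀ x, dist x (extChartAt (𝓡∂ n) a p) ≤ ρ → 0 ≤ x 0 →
      x ∈ (extChartAt (𝓡∂ n) a).target ∧ P x := by
  have h := Filter.inter_mem (extChartAt_target_mem_nhdsWithin_of_mem
    ((extChartAt (𝓡∂ n) a).map_source hp)) hP
  rw [Metric.mem_nhdsWithin_iff] at h
  obtain ⟨ρ, hρ, hsub⟩ := h
  refine ⟨ρ / 2, by positivity, fun x hx hx0 ↦ hsub ⟨Metric.mem_ball.2 (by linarith), ?_⟩⟩
  rw [range_modelWithCornersEuclideanHalfSpace]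
  exact hx0

lemma ennreal_add_sq_le (a b : ℝ≥0∞) : (a + b) ^ 2 ≤ 4 * (a ^ 2 + b ^ 2) := by
  have key : ∀ {a b : ℝ≥0∞}, a ≤ b → (a + b) ^ 2 ≤ 4 * (a ^ 2 + b ^ 2) := fun {a b} h ↦
    calc (a + b) ^ 2 ≤ (b + b) ^ 2 := by gcongr
      _ = 4 * b ^ 2 := by ring
      _ ≤ 4 * (a ^ 2 + b ^ 2) := by gcongr; exact le_add_self
  rcases le_total a b with h | h
  · exact key h
  · rw [add_comm a, add_comm (a ^ 2)]; exact key h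

lemma eq_zero_of_forall_sq_le {X L : ℝ≥0} (h : ∀ ε : ℝ≥0, 0 < ε → X ^ 2 ≤ L * ε ^ 2) : X = 0 := by
  by_contra hX
  have hX : 0 < X := pos_iff_ne_zero.2 hX
  have h1 := h (X / (L + 1)) (by positivity)
  have h2 : X ^ 2 * (L + 1) ^ 2 ≤ X ^ 2 * L := by
    rwa [div_pow, mul_div_assoc', le_div_iff₀ (by positivity), mul_comm L] at h1
  have h3 : (L + 1) ^ 2 ≤ L := le_of_mul_le_mul_left h2 (by positivity)
  have h4 : ((L : ℝ) + 1) ^ 2 ≤ L := by exact_mod_cast h3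
  nlinarith [L.2]

section

variable [RiemannianBundle (fun x : M ↦ TangentSpace (𝓡∂ n) x)] [MeasurableSpace M]

/-- The strict inequality yields an almost optimal weak differential, so it need not be known that
the infimum in `energy` is attained. -/
lemma exists_weakDifferential_of_h1Norm_lt {𝕜 : Type*} [RCLike 𝕜] {f : M → 𝕜} {ε : ℝ≥0}
    (h : h1Norm n f < ε) : ∃ α : ∀ p : M, TangentSpace (𝓡∂ n) p →L[ℝ] 𝕜, IsWeakDifferential f α ∧
      ∫⁻ p, ‖f p‖ₑ ^ 2 ∂(riemannianVolume n M) ≤ (ε : ℝ≥0∞) ^ 2 ∧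
      ∫⁻ p, covectorNormSq p (α p) ∂(riemannianVolume n M) ≤ (ε : ℝ≥0∞) ^ 2 := by
  have h2 : l2Norm n f ^ 2 + energy n f < (ε : ℝ≥0∞) ^ 2 := by
    have := ENNReal.rpow_lt_rpow h (z := 2) (by norm_num)
    rw [h1Norm, ← ENNReal.rpow_mul] at this
    simpa using this
  have h3 : energy n f < (ε : ℝ≥0∞) ^ 2 := le_add_self.trans_lt h2
  simp only [energy, iInf_lt_iff] at h3
  obtain ⟨α, hα, h4⟩ := h3
  refine ⟨α, hα, ?_, h4.le⟩
  rw [← eLpNorm_two_sq]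
  exact le_self_add.trans h2.le

end

variable [IsManifold (𝓡∂ n) ∞ M]
  [RiemannianBundle (fun x : M ↦ TangentSpace (𝓡∂ n) x)]
  [IsContMDiffRiemannianBundle (𝓡∂ n) ∞ (EuclideanSpace ℝ (Fin n))
      (fun x : M ↦ TangentSpace (𝓡∂ n) x)]
  [MeasurableSpace M] [BorelSpace M]

/-- If `u p ≠ 0`, then `u` keeps its sign and a size at least `m` near `p`. An approximant `φ`
supported in the interior vanishes close to the boundary, so `u - φ` has size at least `m` there.
The strip estimate then bounds `m` by a constant times the `H¹` norm of `u - φ`, which can be made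
arbitrarily small. -/
theorem eq_zero_on_boundary_of_memH10 {u : M → ℝ} (hu : Continuous u) (h : MemH10 n u) {p : M}
    (hp : p ∈ (𝓡∂ n).boundary M) : u p = 0 := by
  by_contra hne
  set y := extChartAt (𝓡∂ n) p p
  have hps : p ∈ (extChartAt (𝓡∂ n) p).source := mem_extChartAt_source p
  have hy0 : y 0 = 0 := (mem_boundary_iff p hps).1 hp
  obtain ⟨σ, hσ, hσu⟩ : ∃ σ : ℝ, |σ| = 1 ∧ 0 < σ * u p := by
    rcases lt_or_gt_of_ne hne with h | h
    · exact ⟨-1, by simp, by linarith⟩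
    · exact ⟨1, by simp, by linarith⟩
  set m := σ * u p / 2
  have hm : 0 < m := by positivity
  have hev : ∀ᶠ x in nhdsWithin y (range (𝓡∂ n)), m ≤ σ * u (chartInv p x) := by
    have hc : ContinuousWithinAt (fun x ↦ σ * u (chartInv p x)) (range (𝓡∂ n)) y :=
      continuousWithinAt_const.mul (hu.continuousAt.comp_continuousWithinAt
        (continuousAt_extChartAt_symm p).continuousWithinAt)
    have e : chartInv p y = p := extChartAt_to_inv p
    have hlt : m < σ * u (chartInv p y) := by rw [e]; simp only [m]; linarith
    exact (hc.eventually_const_lt hlt).mono fun x hx ↦ hx.le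
  obtain ⟨ρ, hρ, hT⟩ := exists_halfBall_subset p p hps hev
  set K := boundaryStrip y (ρ / 2) (ρ / 2)
  have hKmem : ∀ x ∈ K, x ∈ (extChartAt (𝓡∂ n) p).target ∧ m ≤ σ * u (chartInv p x) :=
    fun x hx ↦ hT x ((dist_le_of_mem_boundaryStrip hx).trans (by linarith)) hx.2.1
  have hKc : IsCompact K := isCompact_boundaryStrip y _ _
  have hKT : K ⊆ (extChartAt (𝓡∂ n) p).target := fun x hx ↦ (hKmem x hx).1
  obtain ⟨c, hc, C, hest⟩ := exists_strip_estimate y hy0 (half_pos hρ) (half_pos hρ)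
  obtain ⟨C₁, hC₁⟩ := exists_lintegral_chart_le p hKc hKT
  obtain ⟨C₂, hC₂⟩ := exists_lintegral_coordVec_sq_le ℝ p hKc hKT 0
  set S := K ∩ {x | 0 < x 0}
  have hSK : S ⊆ K := inter_subset_left
  obtain ⟨V, hV⟩ : ∃ V : ℝ≥0, volume S = V :=
    ⟨(volume S).toNNReal, (ENNReal.coe_toNNReal
      ((measure_mono hSK).trans_lt hKc.measure_lt_top).ne).symm⟩
  have key : ∀ ε : ℝ≥0, 0 < ε →
      ENNReal.ofReal (c * m) ^ 2 ≤ (C ^ 2 * (4 * (V * C₁ + V * C₂)) : ℝ≥0) * (ε : ℝ≥0∞) ^ 2 := by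
    intro ε hε
    obtain ⟨φ, hφ, -, hφs, hφε⟩ := h.2 ε (by exact_mod_cast hε)
    obtain ⟨α, hα, h0, h1⟩ := exists_weakDifferential_of_h1Norm_lt hφε
    -- The compact part of the support of `φ` seen in `K` has positive minimal height. This `δ`
    -- depends on `φ`, which is harmless as the strip constants do not depend on it.
    obtain ⟨δ, hδ, hδφ⟩ : ∃ δ > 0, ∀ x ∈ K, x 0 ≤ δ → φ (chartInv p x) = 0 := by
      have hZ : IsCompact (K ∩ chartInv p ⁻¹' tsupport φ) :=
        hKc.of_isClosed_subset (((continuousOn_extChartAt_symm p).mono hKT).preimage_isClosed_of_isClosed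
          hKc.isClosed (isClosed_tsupport φ)) inter_subset_left
      have hpos : ∀ x ∈ K ∩ chartInv p ⁻¹' tsupport φ, 0 < x 0 := fun x hx ↦ by
        have h1 := (interior_iff p ((extChartAt (𝓡∂ n) p).map_target (hKT hx.1))).1 (hφs hx.2)
        rwa [(extChartAt (𝓡∂ n) p).right_inv (hKT hx.1)] at h1
      rcases (K ∩ chartInv p ⁻¹' tsupport φ).eq_empty_or_nonempty with he | hne
      · refine ⟨1, one_pos, fun x hx _ ↦ ?_⟩
        by_contra h
        exact eq_empty_iff_forall_notMem.1 he x ⟨hx, subset_tsupport φ h⟩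
      · obtain ⟨z, hz, hmin⟩ := hZ.exists_isMinOn hne
          (f := fun x : EuclideanSpace ℝ (Fin n) ↦ x 0) (by fun_prop)
        refine ⟨z 0 / 2, half_pos (hpos z hz), fun x hx hxz ↦ ?_⟩
        by_contra h
        have h2 : z 0 ≤ x 0 := hmin (a := x) ⟨hx, subset_tsupport φ h⟩
        have h3 := hpos z hz
        linarith
    have hw := hα p 0
    have hSΩ : ∀ x ∈ K, 0 < x 0 → x ∈ chartDomain p := fun x hx hx0 ↦
      mem_chartDomain_iff.2 ⟨hKT hx, hx0⟩
    have hSΩ' : S ⊆ chartDomain p := fun x hx ↦ hSΩ x hx.1 hx.2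
    have hE := hest _ _ _ σ m δ (isOpen_chartDomain p) hSΩ hw hσ hδ fun x hx _ hxδ ↦ by
      beta_reduce
      rw [hδφ x hx hxδ, sub_zero]; exact (hKmem x hx).2
    have hwm := ((hw.1.aestronglyMeasurable).mono_set hSΩ').enorm
    have hDm := ((hw.2.1.aestronglyMeasurable).mono_set hSΩ').enorm
    have hCS : ∀ {F : EuclideanSpace ℝ (Fin n) → ℝ≥0∞}, AEMeasurable F (volume.restrict S) →
        (∫⁻ x in S, F x) ^ 2 ≤ V * ∫⁻ x in S, F x ^ 2 := fun {F} hF ↦ by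
      have := sq_lintegral_mul_le (aemeasurable_const (b := (1 : ℝ≥0∞))) hF
      simpa [hV] using this
    rw [lintegral_add_left' hwm] at hE
    calc ENNReal.ofReal (c * m) ^ 2 ≤ _ := pow_le_pow_left' hE 2
      _ ≤ C ^ 2 * (4 * (V * (C₁ * ε ^ 2) + V * (C₂ * ε ^ 2))) := by
        rw [mul_pow]
        gcongr
        refine (ennreal_add_sq_le _ _).trans ?_
        gcongr
        · refine (hCS hwm).trans ?_
          gcongr
          exact ((lintegral_mono_set hSK).trans (hC₁ fun p ↦ ‖u p - φ p‖ₑ ^ 2)).trans (by gcongr)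
        · refine (hCS hDm).trans ?_
          gcongr
          exact ((lintegral_mono_set hSK).trans (hC₂ α)).trans (by gcongr)
      _ = _ := by push_cast; ring
  set L : ℝ≥0 := C ^ 2 * (4 * (V * C₁ + V * C₂))
  have hX : 0 < (c * m).toNNReal := Real.toNNReal_pos.2 (mul_pos hc hm)
  refine hX.ne' (eq_zero_of_forall_sq_le (L := L) fun ε hε ↦ ?_)
  have hk := key ε hε
  rw [ENNReal.ofReal] at hk
  exact_mod_cast hk

end Trace

/-! ### Sign of `u` and its linear growth at the boundary. -/

section Positivity

variable {n : ℕ} [NeZero n] {M : Type*} [MetricSpace M] [ChartedSpace (EuclideanHalfSpace n) M]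

lemma continuousOn_comp_chartInv {g : M → ℝ} (hg : Continuous g) (a : M) :
    ContinuousOn (fun y ↦ g (chartInv a y)) (extChartAt (𝓡∂ n) a).target :=
  hg.comp_continuousOn (continuousOn_extChartAt_symm a)

lemma nhds_extChartAt_symm {a p : M} (hp : p ∈ (extChartAt (𝓡∂ n) a).source) {P : M → Prop}
    {ρ : ℝ} (hρ : 0 < ρ) (h : ∀ x ∈ (extChartAt (𝓡∂ n) a).target,
      dist x (extChartAt (𝓡∂ n) a p) < ρ → P (chartInv a x)) : ∀ᶠ p' in nhds p, P p' := by
  filter_upwards [(isOpen_extChartAt_source a).mem_nhds hp,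
    (continuousAt_extChartAt' hp).preimage_mem_nhds (Metric.ball_mem_nhds _ hρ)] with p' h1 h2
  have := h _ ((extChartAt (𝓡∂ n) a).map_source h1) h2
  rwa [show chartInv a (extChartAt (𝓡∂ n) a p') = p' from (extChartAt (𝓡∂ n) a).left_inv h1] at this

lemma halfBall_isPreconnected (y : EuclideanSpace ℝ (Fin n)) (ρ : ℝ) :
    IsPreconnected (Metric.ball y ρ ∩ {x | 0 < x 0}) := by
  refine ((convex_ball y ρ).inter ?_).isPreconnected
  exact convex_halfSpace_gt (IsLinearMap.mk (fun _ _ ↦ rfl) (fun _ _ ↦ rfl)) 0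

lemma isOpen_halfSpace : IsOpen {x : EuclideanSpace ℝ (Fin n) | 0 < x 0} :=
  isOpen_lt continuous_const (by fun_prop)

/-- Zero sets found in an open half-ball extend to its flat boundary by density, which carries the
maximum principle up to boundary points of `M`. -/
lemma neBot_nhdsWithin_halfSpace {x : EuclideanSpace ℝ (Fin n)} (hx : 0 ≤ x 0) :
    (nhdsWithin x {x : EuclideanSpace ℝ (Fin n) | 0 < x 0}).NeBot := by
  rw [← mem_closure_iff_nhdsWithin_neBot]
  have ht : Filter.Tendsto (fun t : ℝ ↦ x + t • stdVec 0) (nhdsWithin 0 (Ioi 0)) (nhds x) := by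
    have : Continuous fun t : ℝ ↦ x + t • (stdVec 0 : EuclideanSpace ℝ (Fin n)) := by fun_prop
    have := this.tendsto 0
    simp only [zero_smul, add_zero] at this
    exact this.mono_left nhdsWithin_le_nhds
  refine mem_closure_of_tendsto ht ?_
  filter_upwards [self_mem_nhdsWithin] with t ht
  have : (x + t • stdVec 0 : EuclideanSpace ℝ (Fin n)) 0 = x 0 + t := by simp [stdVec]
  rw [this]
  exact add_pos_of_nonneg_of_pos hx ht

variable [IsManifold (𝓡∂ n) ∞ M]
  [RiemannianBundle (fun x : M ↦ TangentSpace (𝓡∂ n) x)]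
  [IsContMDiffRiemannianBundle (𝓡∂ n) ∞ (EuclideanSpace ℝ (Fin n))
      (fun x : M ↦ TangentSpace (𝓡∂ n) x)]

lemma exists_ellipticBounds_nhds (a : M) {k : EuclideanSpace ℝ (Fin n) → ℝ}
    (hk : ContinuousOn k (extChartAt (𝓡∂ n) a).target)
    (hk0 : ∀ y ∈ (extChartAt (𝓡∂ n) a).target, 0 ≤ k y)
    {x : EuclideanSpace ℝ (Fin n)} (hx : x ∈ chartDomain a) :
    ∃ V ∈ nhds x, ∃ lam > 0, ∃ Lam, ∃ bet ≥ 0, ∃ kap,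
      EllipticBounds (fun y ↦ (gram a y)⁻¹) (laplaceDrift a) k V lam Lam bet kap := by
  obtain ⟨ε, hε, hball⟩ := Metric.isOpen_iff.1 (isOpen_chartDomain a) x hx
  have hsub : Metric.closedBall x (ε / 2) ⊆ (extChartAt (𝓡∂ n) a).target :=
    ((Metric.closedBall_subset_ball (by linarith)).trans hball).trans (chartDomain_subset a)
  exact ⟨_, Metric.closedBall_mem_nhds x (by positivity), exists_ellipticBounds a
    (isCompact_closedBall x (ε / 2)) hsub (hk.mono hsub) fun y hy ↦ hk0 y (hsub hy)⟩

variable {q u : M → ℝ}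

lemma nondivOp_sub_mul_nonpos (hu : ContMDiff (𝓡∂ n) 𝓘(ℝ, ℝ) 2 u)
    (hsup : ∀ p, laplaceBeltrami (n := n) u p + q p * u p ≤ 0) (a : M)
    {y : EuclideanSpace ℝ (Fin n)} (hy : y ∈ chartDomain a) :
    nondivOp (fun y ↦ (gram a y)⁻¹) (laplaceDrift a) (fun z ↦ u (chartInv a z)) y -
      (-q (chartInv a y)) * u (chartInv a y) ≤ 0 := by
  have h := hsup (chartInv a y)
  rw [laplaceBeltrami_eq_nondivOp hu a hy] at h
  linarith

/-- Suppose the minimum is negative. The set where it is attained is closed, misses the boundary,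
and is open by the strong maximum principle applied to `u` minus its minimum. Connectedness makes
`u` constant, against its boundary values. -/
theorem nonneg_of_supersolution [CompactSpace M] [ConnectedSpace M]
    (hbdry : ((𝓡∂ n).boundary M).Nonempty) (hq_nonpos : ∀ p, q p ≤ 0)
    (hu : ContMDiff (𝓡∂ n) 𝓘(ℝ, ℝ) 2 u) (hu0 : ∀ p ∈ (𝓡∂ n).boundary M, u p = 0)
    (hsup : ∀ p, laplaceBeltrami (n := n) u p + q p * u p ≤ 0) (p : M) : 0 ≤ u p := by
  by_contra! hneg
  have huc : Continuous u := hu.continuous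
  obtain ⟨p₀, -, hmin⟩ := isCompact_univ.exists_isMinOn ⟨p, mem_univ p⟩ huc.continuousOn
  have hmin' : ∀ z, u p₀ ≤ u z := fun z ↦ hmin (mem_univ z)
  have hp₀ : u p₀ < 0 := (hmin' p).trans_lt hneg
  have hclopen : IsClopen {z | u z = u p₀} := by
    refine ⟨isClosed_eq huc continuous_const, isOpen_iff_mem_nhds.2 fun z hz ↦ ?_⟩
    have hz : u z = u p₀ := hz
    have hzi : z ∈ (𝓡∂ n).interior M := by
      rw [← (𝓡∂ n).compl_boundary (M := M)]
      intro hzb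
      rw [hu0 z hzb] at hz; linarith
    have hzs : z ∈ (extChartAt (𝓡∂ n) z).source := mem_extChartAt_source z
    set y := extChartAt (𝓡∂ n) z z
    have hy : y ∈ chartDomain z := extChartAt_mem_chartDomain hzs hzi
    have hyz : chartInv z y = z := extChartAt_to_inv z
    have hopen : IsOpen (chartDomain z ∩ (fun x ↦ u (chartInv (n := n) z x)) ⁻¹' Iio 0) :=
      ((continuousOn_comp_chartInv huc z).mono (chartDomain_subset z)).isOpen_inter_preimage
        (isOpen_chartDomain z) isOpen_Iio
    obtain ⟨ρ, hρ, hball⟩ := Metric.isOpen_iff.1 hopen y ⟨hy, by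
      rw [mem_preimage, hyz, hz]; exact hp₀⟩
    have hbD : Metric.ball y ρ ⊆ chartDomain z := hball.trans inter_subset_left
    have hC2 : ContDiffOn ℝ 2 (fun x ↦ u (chartInv z x)) (Metric.ball y ρ) :=
      (contDiffOn_comp_chartInv hu z).mono (hbD.trans (chartDomain_subset z))
    have hzero := eq_zero_of_supersolution (A := fun y ↦ (gram z y)⁻¹) (B := laplaceDrift z)
      -- Where `u < 0`, the product `q * u` is nonnegative, so the potential can be dropped from the
      -- inequality; subtracting a constant is then harmless.
      (k := fun _ ↦ 0) (v := fun x ↦ u (chartInv z x) - u p₀ * (fun _ ↦ (1 : ℝ)) x)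
      Metric.isOpen_ball (convex_ball y ρ).isPreconnected
      (fun x hx ↦ exists_ellipticBounds_nhds z continuousOn_const (fun _ _ ↦ le_rfl) (hbD hx))
      (hC2.sub contDiffOn_const) (fun x _ ↦ by simpa using hmin' (chartInv z x)) (fun x hx ↦ by
        rw [nondivOp_sub_const_mul _ (hC2.contDiffAt (Metric.isOpen_ball.mem_nhds hx))
          contDiffAt_const]
        have h1 := nondivOp_sub_mul_nonpos hu hsup z (hbD hx)
        have h2 : u (chartInv z x) < 0 := (hball hx).2
        have h3 : nondivOp (fun y ↦ (gram z y)⁻¹) (laplaceDrift z) (fun _ ↦ (1 : ℝ)) x = 0 := by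
          have h4 : ∀ j : Fin n, partialDeriv j (fun _ ↦ (1 : ℝ)) = fun _ ↦ 0 := fun j ↦ by
            funext; simp [partialDeriv]
          have h5 : ∀ i : Fin n, partialDeriv i (fun _ ↦ (0 : ℝ)) x = 0 := fun i ↦ by
            simp [partialDeriv]
          simp [nondivOp, h4, h5]
        rw [h3]
        nlinarith [hq_nonpos (chartInv z x)])
      (Metric.mem_ball_self hρ) (by simp [hyz, hz])
    refine nhds_extChartAt_symm hzs hρ fun x _ hx ↦ ?_
    have := hzero x hx
    simpa [sub_eq_zero] using this
  have huniv := hclopen.eq_univ ⟨p₀, rfl⟩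
  obtain ⟨b, hb⟩ := hbdry
  have : u b = u p₀ := (huniv ▸ mem_univ b : b ∈ {z | u z = u p₀})
  rw [hu0 b hb] at this
  linarith

/-- The interior of the zero set is shown to be closed as well. Half-balls at boundary points are
treated like balls, so connectedness of `M` itself suffices. An interior zero would put a point in
this set, giving `u = 0`. -/
theorem pos_of_supersolution [ConnectedSpace M] (hq : Continuous q) (hq_nonpos : ∀ p, q p ≤ 0)
    (hu : ContMDiff (𝓡∂ n) 𝓘(ℝ, ℝ) 2 u) (hu_ne : u ≠ 0) (hu0 : ∀ p, 0 ≤ u p)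
    (hsup : ∀ p, laplaceBeltrami (n := n) u p + q p * u p ≤ 0) {p : M}
    (hp : p ∈ (𝓡∂ n).interior M) : 0 < u p := by
  have huc : Continuous u := hu.continuous
  -- One zero in the open half-ball spreads over the whole half-ball by the strong maximum
  -- principle, and by continuity to a neighbourhood of `z` in `M`.
  have hsmp : ∀ (z : M), ∃ ρ > 0, ∀ x ∈ Metric.ball (extChartAt (𝓡∂ n) z z) ρ ∩ {x | 0 < x 0},
      x ∈ chartDomain z ∧ (u (chartInv z x) = 0 → ∀ᶠ p' in nhds z, u p' = 0) := by
    intro z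
    set y := extChartAt (𝓡∂ n) z z
    have hzs : z ∈ (extChartAt (𝓡∂ n) z).source := mem_extChartAt_source z
    obtain ⟨ρ, hρ, hT⟩ := exists_halfBall_subset z z hzs (P := fun _ ↦ True) (by simp)
    have hUD : Metric.ball y ρ ∩ {x | 0 < x 0} ⊆ chartDomain z := fun x hx ↦
      mem_chartDomain_iff.2 ⟨(hT x (le_of_lt hx.1) (le_of_lt (α := ℝ) hx.2)).1, hx.2⟩
    refine ⟨ρ, hρ, fun x hx ↦ ⟨hUD hx, fun hux ↦ ?_⟩⟩
    have hzero := eq_zero_of_supersolution (A := fun y ↦ (gram z y)⁻¹) (B := laplaceDrift z)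
      (k := fun x ↦ -q (chartInv z x)) (v := fun x ↦ u (chartInv z x))
      (Metric.isOpen_ball.inter isOpen_halfSpace) (halfBall_isPreconnected y ρ)
      (fun x hx ↦ exists_ellipticBounds_nhds z (continuousOn_comp_chartInv hq z).neg
        (fun _ _ ↦ neg_nonneg.2 (hq_nonpos _)) (hUD hx))
      ((contDiffOn_comp_chartInv hu z).mono (hUD.trans (chartDomain_subset z)))
      (fun x _ ↦ hu0 _) (fun x hx ↦ nondivOp_sub_mul_nonpos hu hsup z (hUD hx)) hx hux
    refine nhds_extChartAt_symm hzs hρ fun x hxT hx ↦ ?_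
    by_contra hne
    have h1 : ∀ᶠ x' in nhds x, u (chartInv z x') ≠ 0 :=
      (huc.continuousAt.comp (continuousAt_extChartAt_symm'' hxT)).eventually_ne hne
    have := neBot_nhdsWithin_halfSpace (nonneg_of_mem_target hxT)
    obtain ⟨x', hx'⟩ := ((h1.and (Metric.isOpen_ball.mem_nhds hx)).filter_mono
      nhdsWithin_le_nhds).and (self_mem_nhdsWithin (s := {x | 0 < x 0})) |>.exists
    exact hx'.1.1 (hzero x' ⟨hx'.1.2, hx'.2⟩)
  set S := {z | ∀ᶠ p' in nhds z, u p' = 0}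
  have hSo : IsOpen S := isOpen_setOfPred_eventually_nhds
  have hSc : IsClosed S := by
    rw [← closure_subset_iff_isClosed]
    intro z hz
    obtain ⟨ρ, hρ, hx⟩ := hsmp z
    have hzs : z ∈ (extChartAt (𝓡∂ n) z).source := mem_extChartAt_source z
    obtain ⟨s, ⟨hs1, hs2⟩, hsS⟩ := mem_closure_iff_nhds.1 hz _ (Filter.inter_mem
      ((isOpen_extChartAt_source z).mem_nhds hzs)
      ((continuousAt_extChartAt (I := 𝓡∂ n) z).preimage_mem_nhds (Metric.ball_mem_nhds _ hρ)))
    set x := extChartAt (𝓡∂ n) z s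
    have hxT : x ∈ (extChartAt (𝓡∂ n) z).target := (extChartAt (𝓡∂ n) z).map_source hs1
    have hxs : chartInv z x = s := (extChartAt (𝓡∂ n) z).left_inv hs1
    have h1 : ∀ᶠ x' in nhds x, u (chartInv z x') = 0 := by
      have hc : Filter.Tendsto (chartInv z) (nhds x) (nhds s) := by
        have := (continuousAt_extChartAt_symm'' hxT).tendsto
        rwa [show (extChartAt (𝓡∂ n) z).symm x = s from hxs] at this
      exact hc.eventually hsS
    have := neBot_nhdsWithin_halfSpace (nonneg_of_mem_target hxT)
    obtain ⟨x', hx'⟩ := ((h1.and (Metric.isOpen_ball.mem_nhds hs2)).filter_mono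
      nhdsWithin_le_nhds).and (self_mem_nhdsWithin (s := {x | 0 < x 0})) |>.exists
    exact (hx x' ⟨hx'.1.2, hx'.2⟩).2 hx'.1.1
  rcases isClopen_iff.1 ⟨hSc, hSo⟩ with he | hu'
  · refine lt_of_le_of_ne (hu0 p) fun h0 ↦ ?_
    obtain ⟨ρ, hρ, hx⟩ := hsmp p
    have hps : p ∈ (extChartAt (𝓡∂ n) p).source := mem_extChartAt_source p
    have hpS : p ∈ S := (hx _ ⟨Metric.mem_ball_self hρ, (interior_iff p hps).1 hp⟩).2 (by
      rw [show chartInv p (extChartAt (𝓡∂ n) p p) = p from extChartAt_to_inv p, ← h0])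
    rw [he] at hpS
    exact hpS.elim
  · refine absurd (funext fun z ↦ ?_) hu_ne
    have hz : z ∈ S := hu' ▸ mem_univ z
    exact hz.self_of_nhds

/-- Hopf's lemma is applied to balls of one fixed radius tangent to the boundary hyperplane. All of
them lie in one compact half-ball, so they share the coefficient bounds and a positive lower bound
for `u` on their inner halves. -/
theorem exists_boundary_lower_bound [CompactSpace M] (hq : Continuous q) (hq_nonpos : ∀ p, q p ≤ 0)
    (hu : ContMDiff (𝓡∂ n) 𝓘(ℝ, ℝ) 2 u) (hu0 : ∀ p, 0 ≤ u p)
    (hupos : ∀ p ∈ (𝓡∂ n).interior M, 0 < u p)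
    (hsup : ∀ p, laplaceBeltrami (n := n) u p + q p * u p ≤ 0) {p : M}
    (hp : p ∈ (𝓡∂ n).boundary M) :
    ∃ ρ > 0, ∃ c > 0, ∀ x, dist x (extChartAt (𝓡∂ n) p p) ≤ ρ → 0 ≤ x 0 →
      x ∈ (extChartAt (𝓡∂ n) p).target ∧ c * x 0 ≤ u (chartInv p x) := by
  have huc : Continuous u := hu.continuous
  have hps : p ∈ (extChartAt (𝓡∂ n) p).source := mem_extChartAt_source p
  set y := extChartAt (𝓡∂ n) p p
  have hy0 : y 0 = 0 := (mem_boundary_iff p hps).1 hp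
  obtain ⟨ρ, hρ, hT⟩ := exists_halfBall_subset p p hps (P := fun _ ↦ True) (by simp)
  set K := Metric.closedBall y ρ ∩ {x | 0 ≤ x 0}
  have hcoord : Continuous fun x : EuclideanSpace ℝ (Fin n) ↦ x 0 := by fun_prop
  have hKc : IsCompact K := (isCompact_closedBall y ρ).inter_right
    (isClosed_le continuous_const hcoord)
  have hKT : K ⊆ (extChartAt (𝓡∂ n) p).target := fun x hx ↦ (hT x hx.1 hx.2).1
  obtain ⟨lam, hlam, Lam, bet, hbet, kap, hE⟩ := exists_ellipticBounds p
    (k := fun x ↦ -q (chartInv p x)) hKc hKT ((continuousOn_comp_chartInv hq p).neg.mono hKT)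
    (fun _ _ ↦ neg_nonneg.2 (hq_nonpos _))
  have hR : 0 < ρ / 4 := by positivity
  obtain ⟨c, hc, hopf⟩ := exists_hopf_constant (n := n) (Lam := Lam) (kap := kap) hlam hbet hR
  obtain ⟨m, hm, hmu⟩ : ∃ m > 0, ∀ x ∈ K ∩ {x | ρ / 8 ≤ x 0}, m ≤ u (chartInv p x) := by
    have hK' : IsCompact (K ∩ {x | ρ / 8 ≤ x 0}) :=
      hKc.inter_right (isClosed_le continuous_const hcoord)
    rcases (K ∩ {x | ρ / 8 ≤ x 0}).eq_empty_or_nonempty with he | hne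
    · exact ⟨1, one_pos, fun x hx ↦ (eq_empty_iff_forall_notMem.1 he x hx).elim⟩
    · obtain ⟨z, hz, hmin⟩ := hK'.exists_isMinOn hne
        ((continuousOn_comp_chartInv huc p).mono (inter_subset_left.trans hKT))
      refine ⟨u (chartInv p z), hupos _ (chartInv_mem_interior
        (mem_chartDomain_iff.2 ⟨hKT hz.1, ?_⟩)), fun x hx ↦ hmin hx⟩
      exact lt_of_lt_of_le (by positivity) hz.2
  refine ⟨ρ / 4, hR, c * m, mul_pos hc hm, fun x hx hx0 ↦ ?_⟩
  refine ⟨(hT x (hx.trans (by linarith)) hx0).1, ?_⟩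
  have hxR : x 0 ≤ ρ / 4 := by
    have h1 := PiLp.norm_apply_le (x - y) 0
    rw [PiLp.sub_apply, hy0, sub_zero, Real.norm_of_nonneg hx0, ← dist_eq_norm] at h1
    exact h1.trans hx
  -- The centre is placed at height `ρ / 4` above `x`. The distance from `x` to the bounding sphere
  -- is then exactly `x₀`, and the concentric ball of half the radius stays at height at least `ρ /
  -- 8`.
  set z := x + (ρ / 4 - x 0) • (stdVec 0 : EuclideanSpace ℝ (Fin n))
  have hz0 : z 0 = ρ / 4 := by simp [z, stdVec]
  have hxz : ‖x - z‖ = ρ / 4 - x 0 := by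
    rw [show x - z = -((ρ / 4 - x 0) • (stdVec 0 : EuclideanSpace ℝ (Fin n))) by simp [z],
      norm_neg, norm_smul, Real.norm_of_nonneg (by linarith)]
    simp [stdVec]
  have hzb : ∀ t ≤ ρ / 4, ∀ w ∈ Metric.closedBall z t, w ∈ K ∧ ρ / 4 - t ≤ w 0 := by
    intro t ht w hw
    have hw' : dist w z ≤ t := hw
    have h1 := PiLp.norm_apply_le (w - z) 0
    rw [PiLp.sub_apply, hz0, Real.norm_eq_abs, ← dist_eq_norm] at h1
    have h2 := (abs_le.1 (h1.trans hw')).1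
    refine ⟨⟨?_, ?_⟩, by linarith⟩
    · have h3 : dist x z = ρ / 4 - x 0 := by rw [dist_eq_norm, hxz]
      have h4 := dist_triangle w z y
      have h5 := dist_triangle z x y
      rw [dist_comm z x] at h5
      rw [Metric.mem_closedBall]; linarith
    · show 0 ≤ w 0
      linarith
  have hbD : Metric.ball z (ρ / 4) ⊆ chartDomain p := by
    intro w hw
    have hd : dist w z < ρ / 4 := hw
    have h := hzb (dist w z) hd.le w (Metric.mem_closedBall.2 le_rfl)
    exact mem_chartDomain_iff.2 ⟨hKT h.1, by linarith [h.2]⟩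
  have hfin := hopf (fun y ↦ (gram p y)⁻¹) (laplaceDrift p) (fun x ↦ -q (chartInv p x))
    (fun x ↦ u (chartInv p x)) z m hm
    (hE.mono fun w hw ↦ (hzb _ le_rfl w (Metric.ball_subset_closedBall hw)).1)
    ((continuousOn_comp_chartInv huc p).mono fun w hw ↦ hKT (hzb _ le_rfl w hw).1)
    (fun w hw ↦ ((contDiffOn_comp_chartInv hu p).mono (chartDomain_subset p)).contDiffAt
      ((isOpen_chartDomain p).mem_nhds (hbD hw)))
    (fun w hw ↦ nondivOp_sub_mul_nonpos hu hsup p (hbD hw)) (fun w _ ↦ hu0 _)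
    (fun w hw ↦ by
      have h := hzb (ρ / 4 / 2) (by linarith) w hw
      refine hmu w ⟨h.1, ?_⟩
      show ρ / 8 ≤ w 0
      linarith [h.2])
    x (by rw [Metric.mem_closedBall, dist_eq_norm, hxz]; linarith)
  rw [hxz] at hfin
  calc c * m * x 0 = c * m * (ρ / 4 - (ρ / 4 - x 0)) := by ring
    _ ≤ _ := hfin

end Positivity

/-! ### A criterion for square integrability. -/

section SquareIntegrability

variable {𝕜 : Type*} [RCLike 𝕜] {n : ℕ}

lemma memLp_two_of_lintegral_lt_top {f : EuclideanSpace ℝ (Fin n) → 𝕜}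
    {K : Set (EuclideanSpace ℝ (Fin n))} (hf : AEStronglyMeasurable f (volume.restrict K))
    (h : ∫⁻ x in K, ‖f x‖ₑ ^ 2 < ⊤) : MemLp f 2 (volume.restrict K) := by
  refine ⟨hf, ?_⟩
  rw [← eLpNorm_two_sq] at h
  exact (ENNReal.pow_lt_top_iff.1 h).resolve_right two_ne_zero

end SquareIntegrability

/-! ### The interpolation estimate near a point. -/

section LocalEstimate

variable {𝕜 : Type*} [RCLike 𝕜] {n : ℕ} [NeZero n]
  {M : Type*} [MetricSpace M] [ChartedSpace (EuclideanHalfSpace n) M]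
  [RiemannianBundle (fun x : M ↦ TangentSpace (𝓡∂ n) x)] [MeasurableSpace M]

variable (n 𝕜) in
/-- The `H¹`-interpolation estimate for functions with finite `H¹`-norm, localized to `W`, with the
weight `u`. -/
def HasLocalEstimate (u : M → ℝ) (W : Set M) : Prop :=
  ∃ C : ℝ≥0, ∀ (f : M → 𝕜) (α : ∀ p : M, TangentSpace (𝓡∂ n) p →L[ℝ] 𝕜), IsWeakDifferential f α →
    ∫⁻ p, ‖f p‖ₑ ^ 2 ∂(riemannianVolume n M) < ⊤ →
    ∫⁻ p, covectorNormSq p (α p) ∂(riemannianVolume n M) < ⊤ →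
    (∫⁻ p in W, ‖f p‖ₑ ^ 2 ∂(riemannianVolume n M)) ^ 2 ≤
      C * (∫⁻ p, ‖(u p : 𝕜) * f p‖ₑ ^ 2 ∂(riemannianVolume n M)) *
        (∫⁻ p, ‖f p‖ₑ ^ 2 ∂(riemannianVolume n M) +
          ∫⁻ p, covectorNormSq p (α p) ∂(riemannianVolume n M))

/-- Of the two factors of `(∫ |f|²)²`, one is bounded by `m⁻² ∫ |u f|²` and the other by the squared
`H¹` norm. -/
lemma hasLocalEstimate_of_le {u : M → ℝ} {W : Set M} (hW : MeasurableSet W) {m : ℝ} (hm : 0 < m)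
    (hu : ∀ p ∈ W, m ≤ u p) : HasLocalEstimate 𝕜 n u W := by
  refine ⟨(m⁻¹.toNNReal) ^ 2, fun f α _ _ _ ↦ ?_⟩
  rw [pow_two]
  refine mul_le_mul' ?_ ((lintegral_mono' Measure.restrict_le_self le_rfl).trans le_self_add)
  rw [← lintegral_const_mul' _ _ ENNReal.coe_ne_top]
  refine (setLIntegral_mono' hW fun p hp ↦ ?_).trans (lintegral_mono' Measure.restrict_le_self le_rfl)
  have h1 : (1 : ℝ≥0∞) ≤ m⁻¹.toNNReal * ‖(u p : 𝕜)‖ₑ := by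
    rw [← ofReal_norm, RCLike.norm_ofReal, abs_of_pos (hm.trans_le (hu p hp))]
    change 1 ≤ ENNReal.ofReal _ * _
    rw [← ENNReal.ofReal_mul (by positivity), ENNReal.one_le_ofReal, le_inv_mul_iff₀ hm, mul_one]
    exact hu p hp
  calc ‖f p‖ₑ ^ 2 ≤ (m⁻¹.toNNReal * ‖(u p : 𝕜)‖ₑ * ‖f p‖ₑ) ^ 2 := by
        gcongr
        exact le_mul_of_one_le_left zero_le h1
    _ = _ := by rw [enorm_mul, mul_assoc, mul_pow]; push_cast; rfl

variable [IsManifold (𝓡∂ n) ∞ M]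
  [IsContMDiffRiemannianBundle (𝓡∂ n) ∞ (EuclideanSpace ℝ (Fin n))
      (fun x : M ↦ TangentSpace (𝓡∂ n) x)]
  [BorelSpace M]

/-- The half-space estimate in the chart at `p`, with the weight `x₀` exchanged for `u / c`,
followed by Cauchy-Schwarz between `|u f|` and `|f| + |∂₀ f|`. -/
lemma hasLocalEstimate_of_boundary {u : M → ℝ} (hu : Continuous u) {p : M} {ρ c : ℝ} (hρ : 0 < ρ)
    (hc : 0 < c) (hlow : ∀ x, dist x (extChartAt (𝓡∂ n) p p) ≤ ρ → 0 ≤ x 0 →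
      x ∈ (extChartAt (𝓡∂ n) p).target ∧ c * x 0 ≤ u (chartInv p x)) :
    ∃ W ∈ nhds p, HasLocalEstimate 𝕜 n u W := by
  set y := extChartAt (𝓡∂ n) p p
  have hps : p ∈ (extChartAt (𝓡∂ n) p).source := mem_extChartAt_source p
  have hcoord : Continuous fun x : EuclideanSpace ℝ (Fin n) ↦ x 0 := by fun_prop
  obtain ⟨χ, hχ, hχc, hχs, hχ0, U, hU, hyU, hχ1⟩ := exists_smooth_cutoff
    (isCompact_singleton (x := y)) Metric.isOpen_ball
    (singleton_subset_iff.2 (Metric.mem_ball_self hρ))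
  set K := Metric.closedBall y ρ ∩ {x | 0 ≤ x 0}
  have hKc : IsCompact K := (isCompact_closedBall y ρ).inter_right
    (isClosed_le continuous_const hcoord)
  have hKT : K ⊆ (extChartAt (𝓡∂ n) p).target := fun x hx ↦ (hlow x hx.1 hx.2).1
  set Q := tsupport χ ∩ {x | 0 < x 0}
  have hQK : Q ⊆ K := fun x hx ↦ ⟨Metric.ball_subset_closedBall (hχs hx.1), le_of_lt (α := ℝ) hx.2⟩
  have hQΩ : Q ⊆ chartDomain p := fun x hx ↦ mem_chartDomain_iff.2 ⟨hKT (hQK hx), hx.2⟩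
  have hQm : MeasurableSet Q := (isClosed_tsupport χ).measurableSet.inter
    isOpen_halfSpace.measurableSet
  obtain ⟨C₀, hC₀⟩ := exists_lintegral_normSq_le (𝕜 := 𝕜) hχ hχc hχ0
  obtain ⟨C₁, hC₁⟩ := exists_lintegral_chart_le p hKc hKT
  obtain ⟨C₂, hC₂⟩ := exists_lintegral_coordVec_sq_le 𝕜 p hKc hKT 0
  obtain ⟨R, hR⟩ := hKc.exists_bound_of_continuousOn ((contDiffOn_volDensity p).continuousOn.mono hKT)
  set W := (extChartAt (𝓡∂ n) p).source ∩ extChartAt (𝓡∂ n) p ⁻¹' U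
  have hWo : IsOpen W := (continuousOn_extChartAt p).isOpen_inter_preimage
    (isOpen_extChartAt_source p) hU
  refine ⟨W, hWo.mem_nhds ⟨hps, hyU rfl⟩,
    (R.toNNReal * C₀ * c⁻¹.toNNReal) ^ 2 * (C₁ * (4 * max C₁ C₂)), fun f α hα hf hαf ↦ ?_⟩
  set A := ∫⁻ p, ‖(u p : 𝕜) * f p‖ₑ ^ 2 ∂(riemannianVolume n M)
  set F := fun x : EuclideanSpace ℝ (Fin n) ↦ f (chartInv p x)
  set D := fun x : EuclideanSpace ℝ (Fin n) ↦ α (chartInv p x) (coordVec p x 0)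
  have hw : HasWeakPartial (chartDomain p) 0 F D := hα p 0
  have hFm : AEMeasurable (fun x ↦ ‖F x‖ₑ) (volume.restrict Q) :=
    (hw.1.aestronglyMeasurable.mono_set hQΩ).enorm
  have hDm : AEMeasurable (fun x ↦ ‖D x‖ₑ) (volume.restrict Q) :=
    (hw.2.1.aestronglyMeasurable.mono_set hQΩ).enorm
  have hF : LocSqIntegrableOn F (chartDomain p) := fun L hL hLc ↦ by
    obtain ⟨C, hC⟩ := exists_lintegral_chart_le p hLc (hL.trans (chartDomain_subset p))
    exact memLp_two_of_lintegral_lt_top (hw.1.aestronglyMeasurable.mono_set hL)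
      ((hC fun p ↦ ‖f p‖ₑ ^ 2).trans_lt (ENNReal.mul_lt_top ENNReal.coe_lt_top hf))
  have hD : LocSqIntegrableOn D (chartDomain p) := fun L hL hLc ↦ by
    obtain ⟨C, hC⟩ := exists_lintegral_coordVec_sq_le 𝕜 p hLc (hL.trans (chartDomain_subset p)) 0
    exact memLp_two_of_lintegral_lt_top (hw.2.1.aestronglyMeasurable.mono_set hL)
      ((hC α).trans_lt (ENNReal.mul_lt_top ENNReal.coe_lt_top hαf))
  -- `χ = 1` on the chart image of `W`, and `R` bounds the volume density.
  have h1 : ∫⁻ p in W, ‖f p‖ₑ ^ 2 ∂(riemannianVolume n M) ≤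
      R.toNNReal * ∫⁻ x in {x : EuclideanSpace ℝ (Fin n) | 0 < x 0},
        ENNReal.ofReal (χ x) * ‖F x‖ₑ ^ 2 := by
    refine (setLIntegral_riemannianVolume_le p hWo.measurableSet inter_subset_left _).trans ?_
    rw [setLIntegral_congr (target_ae_eq_chartDomain p), ← lintegral_const_mul' _ _ ENNReal.coe_ne_top]
    refine (setLIntegral_mono' (isOpen_chartDomain p).measurableSet fun x hx ↦ ?_).trans
      (lintegral_mono_set fun x hx ↦ (mem_chartDomain_iff.1 hx).2)
    by_cases hxW : chartInv p x ∈ W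
    · have hxU : x ∈ U := by
        have := hxW.2
        rwa [mem_preimage, (extChartAt (𝓡∂ n) p).right_inv (chartDomain_subset p hx)] at this
      have hxQ : x ∈ Q := ⟨subset_tsupport χ (by rw [Function.mem_support, hχ1 x hxU]; simp),
        (mem_chartDomain_iff.1 hx).2⟩
      rw [indicator_of_mem hxW, hχ1 x hxU, ENNReal.ofReal_one, one_mul]
      gcongr
      exact ENNReal.ofReal_le_ofReal ((le_abs_self _).trans (hR x (hQK hxQ)))
    · rw [indicator_of_notMem hxW, mul_zero]; exact zero_le
  -- Here the growth of `u` enters: `x₀ ≤ c⁻¹ u`.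
  have h2 : ∫⁻ x in Q, ENNReal.ofReal (x 0) * (‖F x‖ₑ * (‖F x‖ₑ + ‖D x‖ₑ)) ≤
      c⁻¹.toNNReal * ∫⁻ x in Q, ‖(u (chartInv p x) : 𝕜) * F x‖ₑ * (‖F x‖ₑ + ‖D x‖ₑ) := by
    rw [← lintegral_const_mul' _ _ ENNReal.coe_ne_top]
    refine setLIntegral_mono' hQm fun x hx ↦ ?_
    have hx' := hlow x (hQK hx).1 (hQK hx).2
    have h3 : ENNReal.ofReal (x 0) ≤ c⁻¹.toNNReal * ‖(u (chartInv p x) : 𝕜)‖ₑ := by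
      rw [← ofReal_norm, RCLike.norm_ofReal]
      change _ ≤ ENNReal.ofReal _ * _
      rw [← ENNReal.ofReal_mul (by positivity)]
      refine ENNReal.ofReal_le_ofReal ?_
      rw [le_inv_mul_iff₀ hc]
      exact hx'.2.trans (le_abs_self _)
    rw [enorm_mul, ← mul_assoc, ← mul_assoc, ← mul_assoc]
    gcongr
  have hum : AEMeasurable (fun x ↦ ‖(u (chartInv p x) : 𝕜) * F x‖ₑ) (volume.restrict Q) := by
    have huc : AEStronglyMeasurable (fun x ↦ (u (chartInv p x) : 𝕜)) (volume.restrict Q) :=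
      ((RCLike.continuous_ofReal.comp_continuousOn
        (continuousOn_comp_chartInv hu p)).mono (hQK.trans hKT)).aestronglyMeasurable hQm
    exact (huc.mul (hw.1.aestronglyMeasurable.mono_set hQΩ)).enorm
  have h4 := sq_lintegral_mul_le hum (hFm.add hDm)
  have h5 : ∫⁻ x in Q, ‖(u (chartInv p x) : 𝕜) * F x‖ₑ ^ 2 ≤ C₁ * A :=
    (lintegral_mono_set hQK).trans (hC₁ fun p ↦ ‖(u p : 𝕜) * f p‖ₑ ^ 2)
  have h6 : ∫⁻ x in Q, (‖F x‖ₑ + ‖D x‖ₑ) ^ 2 ≤ 4 * max C₁ C₂ *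
      (∫⁻ p, ‖f p‖ₑ ^ 2 ∂(riemannianVolume n M) +
        ∫⁻ p, covectorNormSq p (α p) ∂(riemannianVolume n M)) := by
    calc ∫⁻ x in Q, (‖F x‖ₑ + ‖D x‖ₑ) ^ 2 ≤ ∫⁻ x in Q, 4 * (‖F x‖ₑ ^ 2 + ‖D x‖ₑ ^ 2) :=
          lintegral_mono fun x ↦ ennreal_add_sq_le _ _
      _ = 4 * ((∫⁻ x in Q, ‖F x‖ₑ ^ 2) + ∫⁻ x in Q, ‖D x‖ₑ ^ 2) := by
          rw [lintegral_const_mul' _ _ (by simp), lintegral_add_left' (hFm.pow_const 2)]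
      _ ≤ 4 * (C₁ * ∫⁻ p, ‖f p‖ₑ ^ 2 ∂(riemannianVolume n M) +
            C₂ * ∫⁻ p, covectorNormSq p (α p) ∂(riemannianVolume n M)) := by
          gcongr
          · exact (lintegral_mono_set hQK).trans (hC₁ fun p ↦ ‖f p‖ₑ ^ 2)
          · exact (lintegral_mono_set hQK).trans (hC₂ α)
      _ ≤ _ := by
          rw [mul_assoc, mul_add ((max C₁ C₂ : ℝ≥0) : ℝ≥0∞)]
          gcongr
          · exact le_max_left _ _
          · exact le_max_right _ _
  have h7 := hC₀ (chartDomain p) F D (isOpen_chartDomain p) (fun x hx hx0 ↦ hQΩ ⟨hx, hx0⟩) hw hF hD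
  calc (∫⁻ p in W, ‖f p‖ₑ ^ 2 ∂(riemannianVolume n M)) ^ 2
      ≤ (R.toNNReal * (C₀ * (c⁻¹.toNNReal *
          ∫⁻ x in Q, ‖(u (chartInv p x) : 𝕜) * F x‖ₑ * (‖F x‖ₑ + ‖D x‖ₑ)))) ^ 2 := by
        gcongr
        refine h1.trans ?_
        gcongr
        refine h7.trans ?_
        gcongr
    _ = (R.toNNReal * C₀ * c⁻¹.toNNReal) ^ 2 *
          (∫⁻ x in Q, ‖(u (chartInv p x) : 𝕜) * F x‖ₑ * (‖F x‖ₑ + ‖D x‖ₑ)) ^ 2 := by ring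
    _ ≤ (R.toNNReal * C₀ * c⁻¹.toNNReal) ^ 2 * ((C₁ * A) * (4 * max C₁ C₂ *
          (∫⁻ p, ‖f p‖ₑ ^ 2 ∂(riemannianVolume n M) +
            ∫⁻ p, covectorNormSq p (α p) ∂(riemannianVolume n M)))) := by
        gcongr
        exact h4.trans (mul_le_mul' h5 h6)
    _ = _ := by push_cast; ring

end LocalEstimate

/-! ### From the local estimates to the interpolation inequality on `M`. -/

section GlobalEstimate

variable {𝕜 : Type*} [RCLike 𝕜] {n : ℕ} [NeZero n]
  {M : Type*} [MetricSpace M] [ChartedSpace (EuclideanHalfSpace n) M]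
  [RiemannianBundle (fun x : M ↦ TangentSpace (𝓡∂ n) x)] [MeasurableSpace M]

/-- After a square root the left side is an integral over `W`, hence subadditive over a finite
subcover. This is why the square roots of the local constants are added. -/
lemma hasLocalEstimate_univ [CompactSpace M] {u : M → ℝ}
    (h : ∀ p : M, ∃ W ∈ nhds p, HasLocalEstimate 𝕜 n u W) :
    HasLocalEstimate 𝕜 n u univ := by
  choose W hW hWe using h
  obtain ⟨t, -, ht⟩ := isCompact_univ.elim_nhds_subcover W fun p _ ↦ hW p
  choose C hC using hWe
  refine ⟨(∑ p : t, NNReal.sqrt (C p)) ^ 2, fun f α hα hf hαf ↦ ?_⟩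
  set A := ∫⁻ p, ‖(u p : 𝕜) * f p‖ₑ ^ 2 ∂(riemannianVolume n M)
  set N := ∫⁻ p, ‖f p‖ₑ ^ 2 ∂(riemannianVolume n M) +
          ∫⁻ p, covectorNormSq p (α p) ∂(riemannianVolume n M)
  have hsq : ∀ x : ℝ≥0∞, (x ^ (1 / 2 : ℝ)) ^ 2 = x := fun x ↦ by
    rw [← ENNReal.rpow_two, ← ENNReal.rpow_mul]; simp
  have h1 : ∀ p, ∫⁻ x in W p, ‖f x‖ₑ ^ 2 ∂(riemannianVolume n M) ≤
      NNReal.sqrt (C p) * (A * N) ^ (1 / 2 : ℝ) := fun p ↦ by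
    rw [← ENNReal.pow_le_pow_left_iff (n := 2) two_ne_zero, mul_pow, hsq, ← ENNReal.coe_pow,
      NNReal.sq_sqrt, ← mul_assoc]
    exact hC p f α hα hf hαf
  have h2 : ∫⁻ p in univ, ‖f p‖ₑ ^ 2 ∂(riemannianVolume n M) ≤
      (∑ p : t, NNReal.sqrt (C p) : ℝ≥0) * (A * N) ^ (1 / 2 : ℝ) := by
    calc ∫⁻ p in univ, ‖f p‖ₑ ^ 2 ∂(riemannianVolume n M)
        ≤ ∫⁻ p in ⋃ i : t, W i, ‖f p‖ₑ ^ 2 ∂(riemannianVolume n M) := by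
          refine lintegral_mono_set (ht.trans ?_)
          exact iUnion₂_subset fun p hp ↦ subset_iUnion (fun i : t ↦ W i) ⟨p, hp⟩
      _ ≤ ∑' i : t, ∫⁻ p in W i, ‖f p‖ₑ ^ 2 ∂(riemannianVolume n M) := lintegral_iUnion_le _ _
      _ = ∑ i : t, ∫⁻ p in W i, ‖f p‖ₑ ^ 2 ∂(riemannianVolume n M) := tsum_fintype _
      _ ≤ ∑ i : t, NNReal.sqrt (C i) * (A * N) ^ (1 / 2 : ℝ) := Finset.sum_le_sum fun i _ ↦ h1 i
      _ = _ := by rw [← Finset.sum_mul]; push_cast; rfl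
  calc _ ≤ _ := pow_le_pow_left' h2 2
    _ = _ := by rw [mul_pow, hsq, ← ENNReal.coe_pow, mul_assoc]

/-- With `X`, `Y`, `H` the three norms, the estimate becomes `X⁴ ≤ 2 C Y² H²`; the exponent `1 / 4`
of the constant comes from the fourth root. -/
lemma l2Norm_le_of_hasLocalEstimate_univ {u : M → ℝ} (h : HasLocalEstimate 𝕜 n u univ) :
    ∃ C : ℝ≥0, ∀ f : M → 𝕜, MemH2 n f →
      l2Norm n f ≤ C * l2Norm n (fun p ↦ (u p : 𝕜) * f p) ^ (1 / 2 : ℝ) *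
        h2Norm n f ^ (1 / 2 : ℝ) := by
  obtain ⟨C, hC⟩ := h
  refine ⟨(2 * C) ^ (1 / 4 : ℝ), fun f hf ↦ ?_⟩
  set X := l2Norm n f
  set Y := l2Norm n (fun p ↦ (u p : 𝕜) * f p)
  set H := h2Norm n f
  rcases eq_or_ne X 0 with hX0 | hX0
  · rw [hX0]; exact zero_le
  have hX : X ^ 2 = ∫⁻ p, ‖f p‖ₑ ^ 2 ∂(riemannianVolume n M) := eLpNorm_two_sq _ _
  have hY : Y ^ 2 = ∫⁻ p, ‖(u p : 𝕜) * f p‖ₑ ^ 2 ∂(riemannianVolume n M) := eLpNorm_two_sq _ _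
  set J := ⨅ (α : ∀ p : M, TangentSpace (𝓡∂ n) p →L[ℝ] 𝕜) (_ : IsWeakDifferential f α)
      (B : ∀ p : M, TangentSpace (𝓡∂ n) p →L[ℝ] TangentSpace (𝓡∂ n) p →L[ℝ] 𝕜)
      (_ : IsWeakCovDeriv α B),
      ∫⁻ p, (covectorNormSq p (α p) + bilinNormSq p (B p)) ∂(riemannianVolume n M)
  have hH : H ^ 2 = X ^ 2 + J := by
    rw [← ENNReal.rpow_two]
    change ((X ^ 2 + J) ^ (1 / 2 : ℝ)) ^ (2 : ℝ) = _
    rw [← ENNReal.rpow_mul]; simp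
  have hHfin : X ^ 2 + J < ⊤ := hH ▸ ENNReal.pow_lt_top hf.2
  have hXfin : X ^ 2 < ⊤ := le_self_add.trans_lt hHfin
  -- The infimum `J` need not be attained. A weak differential within `X²` of it is used instead;
  -- the slack costs the factor `2`, and `X ≠ 0` makes the inequality strict.
  have hlt : J < J + X ^ 2 :=
    ENNReal.lt_add_right (le_add_self.trans_lt hHfin).ne (pow_ne_zero 2 hX0)
  simp only [J, iInf_lt_iff] at hlt
  obtain ⟨α, hα, B, -, hlt⟩ := hlt
  have hcov : ∫⁻ p, covectorNormSq p (α p) ∂(riemannianVolume n M) ≤ J + X ^ 2 :=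
    (lintegral_mono fun p ↦ le_self_add).trans hlt.le
  have hest := hC f α hα (hX ▸ hXfin) (hcov.trans_lt (by rwa [add_comm]))
  rw [Measure.restrict_univ, ← hX, ← hY] at hest
  have h4 : X ^ 4 ≤ (2 * C : ℝ≥0) * Y ^ 2 * H ^ 2 := by
    calc X ^ 4 = (X ^ 2) ^ 2 := by ring
      _ ≤ C * Y ^ 2 * (X ^ 2 + (J + X ^ 2)) := hest.trans (by gcongr)
      _ ≤ C * Y ^ 2 * (2 * (X ^ 2 + J)) := by
        gcongr
        calc X ^ 2 + (J + X ^ 2) = 2 * X ^ 2 + J := by ring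
          _ ≤ 2 * X ^ 2 + 2 * J := by gcongr; exact le_mul_of_one_le_left zero_le (by norm_num)
          _ = _ := by ring
      _ = _ := by rw [hH]; push_cast; ring
  have h5 := ENNReal.rpow_le_rpow h4 (z := 1 / 4) (by norm_num)
  have e1 : (X ^ 4) ^ (1 / 4 : ℝ) = X := by
    rw [← ENNReal.rpow_natCast, ← ENNReal.rpow_mul]; norm_num
  have e2 : ∀ Z : ℝ≥0∞, (Z ^ 2) ^ (1 / 4 : ℝ) = Z ^ (1 / 2 : ℝ) := fun Z ↦ by
    rw [← ENNReal.rpow_natCast, ← ENNReal.rpow_mul]; norm_num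
  rwa [e1, ENNReal.mul_rpow_of_nonneg _ _ (by norm_num), ENNReal.mul_rpow_of_nonneg _ _ (by norm_num),
    e2, e2, ← ENNReal.coe_rpow_of_nonneg _ (by norm_num)] at h5

end GlobalEstimate

end RiemannianSobolev

end

/-! ### Conclusion: interior points use positivity of `u`, boundary points its linear growth. -/

theorem corollary3p3 {𝕜 : Type*} [RCLike 𝕜] {n : ℕ} [NeZero n] (hn : 2 ≤ n)
    {M : Type*} [MetricSpace M] [CompactSpace M] [ConnectedSpace M]
    [MeasurableSpace M] [BorelSpace M]
    [ChartedSpace (EuclideanHalfSpace n) M] [IsManifold (𝓡∂ n) ∞ M]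
    [RiemannianBundle (fun x : M ↦ TangentSpace (𝓡∂ n) x)]
    [IsContMDiffRiemannianBundle (𝓡∂ n) ∞ (EuclideanSpace ℝ (Fin n))
      (fun x : M ↦ TangentSpace (𝓡∂ n) x)]
    [IsRiemannianManifold (𝓡∂ n) M]
    (hbdry : ((𝓡∂ n).boundary M).Nonempty)
    (hardy : RiemannianSobolev.HardyInequality n 𝕜 M)
    (q : M → ℝ) (hq : Continuous q) (hq_nonpos : ∀ p, q p ≤ 0)
    (u : M → ℝ) (hu : ContMDiff (𝓡∂ n) 𝓘(ℝ, ℝ) 2 u) (hu_zero : RiemannianSobolev.MemH10 n u)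
    (hu_ne : u ≠ 0)
    (hu_super : ∀ p, RiemannianSobolev.laplaceBeltrami (n := n) u p + q p * u p ≤ 0) :
    ∃ C : ℝ≥0, ∀ f : M → 𝕜, RiemannianSobolev.MemH2 n f →
      RiemannianSobolev.l2Norm n f ≤
        C * RiemannianSobolev.l2Norm n (fun p ↦ (u p : 𝕜) * f p) ^ (1 / 2 : ℝ)
          * RiemannianSobolev.h2Norm n f ^ (1 / 2 : ℝ) := by
  have hu0 : ∀ p ∈ (𝓡∂ n).boundary M, u p = 0 := fun p hp ↦
    RiemannianSobolev.eq_zero_on_boundary_of_memH10 hu.continuous hu_zero hp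
  have hnn := RiemannianSobolev.nonneg_of_supersolution hbdry hq_nonpos hu hu0 hu_super
  have hpos : ∀ p ∈ (𝓡∂ n).interior M, 0 < u p := fun p hp ↦
    RiemannianSobolev.pos_of_supersolution hq hq_nonpos hu hu_ne hnn hu_super hp
  refine RiemannianSobolev.l2Norm_le_of_hasLocalEstimate_univ
    (RiemannianSobolev.hasLocalEstimate_univ fun p ↦ ?_)
  by_cases hp : p ∈ (𝓡∂ n).interior M
  · have hW : IsOpen {p' | u p / 2 < u p'} := isOpen_lt continuous_const hu.continuous
    have hup := hpos p hp
    exact ⟨_, hW.mem_nhds (show u p / 2 < u p by linarith),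
      RiemannianSobolev.hasLocalEstimate_of_le hW.measurableSet (half_pos hup)
        fun p' hp' ↦ le_of_lt hp'⟩
  · rw [← (𝓡∂ n).compl_boundary, Set.notMem_compl_iff] at hp
    obtain ⟨ρ, hρ, c, hc, hlow⟩ := RiemannianSobolev.exists_boundary_lower_bound hq hq_nonpos hu hnn
      hpos hu_super hp
    exact RiemannianSobolev.hasLocalEstimate_of_boundary hu.continuous hρ hc hlow
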